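/- Let $A=\{x\in\mathbb R^3 : x_1+x_2+x_3=0\}$. A \emph{root half-space} is a set $\{x\in A: x_i-x_j\ge c\}$ with $i\ne j$ and $c\in\mathbb R$; the \emph{affine Weyl group} is generated by the reflections in all the hyperplanes $x_i-x_j=c$ ($c$ real), so it is $S_3\ltimes A$. An \emph{enclosure} is a bounded intersection of finitely many root half-spaces (the empty set is allowed). Enclosures form a category, the morphisms $E\to E'$ being the maps which are restrictions of elements of the affine Weyl group, with the Grothendieck topology in which coverings are finite families of morphisms $E_i\to E$ whose images cover $E$. A \emph{construction} is a sheaf of sets $F$ on this site which is finitely related: for all sections $s\in F(E)$, $s'\in F(E')$ there are finitely many maps from enclosures to $E\times_F E'$ that are jointly surjective as a map of sheaves. A section of $F$ over $E$ is also called a map $E\to F$. Write $F(p)$ for the sections over a one-point enclosure $p$; a map $f:E\to F$ induces $E=E(p)\to F(p)$, $e\mapsto f(e)$, and $U\subseteq F(p)$ is open when its preimage in $E$ is open for every such $f$. Let $C=\{x_1\ge x_2\ge x_3\}\subset A$, with edges $\nu^+=\{x_1\ge x_2=x_3\}$ and $\nu^-=\{x_1=x_2\ge x_3\}$. For $x\in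 F(p)$ and $\sigma\in\{C,\nu^+,\nu^-\}$ let $F_x(\sigma)$ be the set of germs at $0$ of maps $E\to F$ that send $0$ to $x$, where $E$ runs over the enclosures containing $0$ that coincide with $\sigma$ near $0$. Then $F_x$ is the graph with positive vertices $F_x(\nu^+)$, negative vertices $F_x(\nu^-)$ and edges $F_x(C)$, each edge joining its two restrictions. Similarly for the representable (pre)sheaf $E$ and for $A$, the presheaf of restrictions of affine Weyl group elements $E\to A$ (or its associated sheaf, the sheaf of folding maps to $A$); $A_a$ is a hexagon. A map $f:E\to F$ is \emph{immersive} if for every $e\in E$ the map $E_e\to F_{f(e)}$ preserves distances between vertices, where distances in $E_e$ are computed in $A_e$. An \emph{apartment} is a map $A\to F$ whose restriction to every enclosure $E\subset A$ is immersive. Let $w^+$, $w^-$ be vectors of the same length spanning $\nu^+$, $\nu^-$, let $S^{t,\pm}=\{s\,w^\pm:0\le s\le t\}$, let $\omega$ be the rotation $(x_1,x_2,x_3)\mapsto(x_3,x_1,x_2)$, and let $P^{a,b,\pm}=\{p\,w^\pm+q\,\omega w^\pm: 0\le p\le a,\ 0\le q\le b\}$. Consider the following conditions. \begin{itemize} \item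 \textbf{SB-loc}: for every $x\in F(p)$ the graph $F_x$ is a spherical building, i.e. it is nonempty, any two vertices have distance $\le 3$, any two vertices lie in a common hexagon, and there are no loops of length $2$ (double edges) or $4$. \item \textbf{Ex-Seg}: for each sign $\pm$, all $0<t<t'$, every immersive $\varphi:S^{t,\pm}\to F$ and every $\nu\in F_{\varphi(t)}(\nu^{\pm})$ at distance $3$ from the backward direction of $\varphi$ at its endpoint $\varphi(t):=\varphi(t\,w^{\pm})$, there is an immersive $\varphi':S^{t',\pm}\to F$ extending $\varphi$ whose forward direction at $t$ is $\nu$. \item \textbf{Ex-Obt}: for each sign $\pm$, all $a,b>0$ and all immersive $\varphi:S^{a,\pm}\to F$, $\psi:\omega S^{b,\pm}\to F$ with $\varphi(0)=\psi(0)=x$ whose directions at $0$ have distance $\ge 2$ in $F_x$, there is an immersive $\zeta:P^{a,b,\pm}\to F$ restricting to $\varphi$ and $\psi$ on the two edges. \end{itemize} \textbf{Theorem.} Let $F$ be a construction satisfying SB-loc, Ex-Seg and Ex-Obt, with $F(p)$ connected. Then for all $x,y\in F(p)$ there is an immersive map $f:E\to F$ from an enclosure such that $x$ and $y$ are both in the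 image of $f(p):E(p)\to F(p)$. Moreover, for all $x,y\in F(p)$ there is an apartment $A\to F$ such that $x$ and $y$ are both in the image of $A(p)\to F(p)$. -/

import Mathlib

open CategoryTheory Opposite Topology

namespace SL3

/-! ### The affine space, root half-spaces and the affine Weyl group -/

/-- The plane of triples of real numbers with sum zero. -/
def aptSubmodule : Submodule ℝ (Fin 3 → ℝ) where
  carrier := {x | ∑ i, x i = 0}
  add_mem' := by
    intro a b ha hb
    simp only [Set.mem_ofPred_eq, Pi.add_apply, Finset.sum_add_distrib] at *
    rw [ha, hb, add_zero]
  zero_mem' := by simp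
  smul_mem' := by
    intro c x hx
    simp only [Set.mem_ofPred_eq, Pi.smul_apply, smul_eq_mul, ← Finset.mul_sum] at *
    rw [hx, mul_zero]

/-- The affine space `A` on which buildings for `SL₃` are modelled. -/
abbrev Apt : Type := aptSubmodule

/-- The coordinates of a point of `A`. -/
def crd (x : Apt) (i : Fin 3) : ℝ := (x : Fin 3 → ℝ) i

theorem crd_ext {x y : Apt} (h : ∀ i, crd x i = crd y i) : x = y :=
  Subtype.ext (funext h)

theorem crd_sum (x : Apt) : crd x 0 + crd x 1 + crd x 2 = 0 := by
  have h : ∑ i, (x : Fin 3 → ℝ) i = 0 := x.2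
  rw [Fin.sum_univ_three] at h
  exact h

@[simp] theorem crd_add (x y : Apt) (i : Fin 3) : crd (x + y) i = crd x i + crd y i := rfl

@[simp] theorem crd_neg (x : Apt) (i : Fin 3) : crd (-x) i = -crd x i := rfl

@[simp] theorem crd_zero (i : Fin 3) : crd 0 i = 0 := rfl

@[simp] theorem crd_smul (c : ℝ) (x : Apt) (i : Fin 3) : crd (c • x) i = c * crd x i := rfl

/-- The action of the spherical Weyl group `S₃` on `A` by permuting coordinates. -/
def permAct (σ : Equiv.Perm (Fin 3)) (x : Apt) : Apt :=
  ⟨fun i => crd x (σ i), by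
    have h : ∑ i, crd x i = 0 := x.2
    change ∑ i, crd x (σ i) = 0
    rw [Equiv.sum_comp σ (fun i => crd x i), h]⟩

@[simp] theorem crd_permAct (σ : Equiv.Perm (Fin 3)) (x : Apt) (i : Fin 3) :
    crd (permAct σ x) i = crd x (σ i) := rfl

/-- `g` belongs to the affine Weyl group, i.e. the group generated by the reflections in all the
root hyperplanes `x i - x j = c` with `c` real: it is a permutation of the coordinates followed by
a translation. -/
def IsWeyl (g : Apt → Apt) : Prop :=
  ∃ (σ : Equiv.Perm (Fin 3)) (v : Apt), ∀ x, g x = permAct σ x + v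

theorem isWeyl_id : IsWeyl id :=
  ⟨1, 0, fun x => crd_ext fun i => by simp⟩

theorem isWeyl_perm (σ : Equiv.Perm (Fin 3)) (v : Apt) : IsWeyl (fun x => permAct σ x + v) :=
  ⟨σ, v, fun _ => rfl⟩

theorem isWeyl_translate (v : Apt) : IsWeyl (fun x => x + v) :=
  ⟨1, v, fun x => crd_ext fun i => by simp⟩

theorem IsWeyl.comp {g h : Apt → Apt} (hg : IsWeyl g) (hh : IsWeyl h) :
    IsWeyl (fun x => g (h x)) := by
  obtain ⟨σ, v, hg⟩ := hg
  obtain ⟨τ, w, hh⟩ := hh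
  refine ⟨σ.trans τ, permAct σ w + v, fun x => crd_ext fun i => ?_⟩
  simp [hg, hh, add_assoc]

theorem IsWeyl.exists_inv {g : Apt → Apt} (hg : IsWeyl g) :
    ∃ k, IsWeyl k ∧ (∀ x, k (g x) = x) ∧ ∀ x, g (k x) = x := by
  obtain ⟨σ, v, hg⟩ := hg
  refine ⟨fun x => permAct σ.symm x + -permAct σ.symm v, isWeyl_perm _ _,
    fun x => crd_ext fun i => ?_, fun x => crd_ext fun i => ?_⟩
  · simp [hg]
  · simp [hg]

/-- A root half-space of `A`. -/
def IsRootHalfSpace (h : Set Apt) : Prop :=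
  ∃ (i j : Fin 3) (c : ℝ), i ≠ j ∧ h = {x | c ≤ crd x i - crd x j}

/-- A finite intersection of root half-spaces. -/
def IsRootPolyhedron (s : Set Apt) : Prop :=
  ∃ H : Set (Set Apt), H.Finite ∧ (∀ h ∈ H, IsRootHalfSpace h) ∧ s = ⋂₀ H

theorem IsRootPolyhedron.inter {s t : Set Apt} (hs : IsRootPolyhedron s)
    (ht : IsRootPolyhedron t) : IsRootPolyhedron (s ∩ t) := by
  obtain ⟨H, hH, hH', rfl⟩ := hs
  obtain ⟨K, hK, hK', rfl⟩ := ht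
  refine ⟨H ∪ K, hH.union hK, ?_, (Set.sInter_union H K).symm⟩
  rintro h (h1 | h1)
  · exact hH' h h1
  · exact hK' h h1

theorem isRootPolyhedron_half {i j : Fin 3} (hij : i ≠ j) (c : ℝ) :
    IsRootPolyhedron {x | c ≤ crd x i - crd x j} :=
  ⟨{{x | c ≤ crd x i - crd x j}}, Set.finite_singleton _, by
    rintro h rfl
    exact ⟨i, j, c, hij, rfl⟩, (Set.sInter_singleton _).symm⟩

theorem IsRootPolyhedron.preimage {s : Set Apt} (hs : IsRootPolyhedron s) {g : Apt → Apt}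
    (hg : IsWeyl g) : IsRootPolyhedron (g ⁻¹' s) := by
  obtain ⟨H, hH, hH', rfl⟩ := hs
  refine ⟨(fun h => g ⁻¹' h) '' H, hH.image _, ?_, by ext x; simp⟩
  rintro _ ⟨h, h1, rfl⟩
  obtain ⟨i, j, c, hij, rfl⟩ := hH' h h1
  obtain ⟨σ, v, hg⟩ := hg
  refine ⟨σ i, σ j, c - (crd v i - crd v j), fun e => hij (σ.injective e), ?_⟩
  ext x
  simp only [hg, Set.mem_preimage, Set.mem_ofPred_eq, crd_add, crd_permAct]
  constructor <;> intro h <;> linarith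

theorem isBounded_of_root {s : Set Apt} (M : ℝ)
    (h : ∀ x ∈ s, ∀ i j, crd x i - crd x j ≤ M) : Bornology.IsBounded s := by
  rw [isBounded_iff_forall_norm_le]
  refine ⟨M, fun x hx => ?_⟩
  have hM : 0 ≤ M := by have := h x hx 0 0; simpa using this
  rw [← Submodule.norm_coe, pi_norm_le_iff_of_nonneg hM]
  intro i
  have h0 := crd_sum x
  have hh := h x hx
  have a01 := hh 0 1
  have a02 := hh 0 2
  have a10 := hh 1 0
  have a12 := hh 1 2
  have a20 := hh 2 0
  have a21 := hh 2 1
  rw [Real.norm_eq_abs, abs_le]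
  change -M ≤ crd x i ∧ crd x i ≤ M
  fin_cases i
  · change -M ≤ crd x 0 ∧ crd x 0 ≤ M
    constructor <;> linarith
  · change -M ≤ crd x 1 ∧ crd x 1 ≤ M
    constructor <;> linarith
  · change -M ≤ crd x 2 ∧ crd x 2 ≤ M
    constructor <;> linarith

/-! ### The site of enclosures -/

/-- An enclosure: a bounded finite intersection of root half-spaces (possibly empty). -/
@[ext] structure Enclosure where
  carrier : Set Apt
  isPoly : IsRootPolyhedron carrier
  isBounded : Bornology.IsBounded carrier

/-- A map of sets which is the restriction of an element of the affine Weyl group. -/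
def IsAffineMap {s : Set Apt} (f : s → Apt) : Prop :=
  ∃ g : Apt → Apt, IsWeyl g ∧ ∀ x : s, f x = g x

/-- Affine maps of enclosures; two of them are equal when they are equal as functions. -/
@[ext] structure Enclosure.Hom (E E' : Enclosure) where
  toFun : E.carrier → E'.carrier
  isAffine : IsAffineMap (fun x => (toFun x : Apt))

/-- The category of enclosures and affine maps. -/
instance : Category Enclosure where
  Hom := Enclosure.Hom
  id E := ⟨id, id, isWeyl_id, fun _ => rfl⟩
  comp f g := ⟨g.toFun ∘ f.toFun, by
    obtain ⟨a, ha, hf⟩ := f.isAffine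
    obtain ⟨b, hb, hg⟩ := g.isAffine
    exact ⟨fun x => b (a x), hb.comp ha, fun x => by simp only [Function.comp, hg, hf]⟩⟩

/-- The restriction to `D` of an affine Weyl group element that maps `D` into `E`. -/
def Enclosure.homOf {D E : Enclosure} (g : Apt → Apt) (hg : IsWeyl g)
    (h : ∀ x ∈ D.carrier, g x ∈ E.carrier) : D ⟶ E :=
  ⟨fun x => ⟨g x, h x x.2⟩, g, hg, fun _ => rfl⟩

/-- The inclusion of an enclosure in a larger one. -/
def Enclosure.incl {D E : Enclosure} (h : D.carrier ⊆ E.carrier) : D ⟶ E :=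
  Enclosure.homOf id isWeyl_id h

theorem Enclosure.incl_comp {C D E : Enclosure} (h : C.carrier ⊆ D.carrier)
    (h' : D.carrier ⊆ E.carrier) :
    Enclosure.incl h ≫ Enclosure.incl h' = Enclosure.incl (h.trans h') := rfl

/-- The intersection of two enclosures. -/
def Enclosure.inter (E E' : Enclosure) : Enclosure where
  carrier := E.carrier ∩ E'.carrier
  isPoly := E.isPoly.inter E'.isPoly
  isBounded := E.isBounded.subset Set.inter_subset_left

/-- The Grothendieck topology on enclosures: a sieve covers `E` when it contains a finite family of
affine maps whose images cover `E`. -/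
def encTopology : GrothendieckTopology Enclosure where
  sieves E := {S | ∃ (ι : Type) (_ : Finite ι) (D : ι → Enclosure) (f : ∀ i, D i ⟶ E),
    (∀ i, S.arrows (f i)) ∧ ∀ x : E.carrier, ∃ i, x ∈ Set.range (f i).toFun}
  top_mem' E := ⟨Unit, inferInstance, fun _ => E, fun _ => 𝟙 E, fun _ => trivial,
    fun x => ⟨(), x, rfl⟩⟩
  pullback_stable' := by
    rintro X Y S h ⟨ι, hι, D, f, hf, hc⟩
    obtain ⟨b, hb, hb'⟩ := h.isAffine
    have hh : ∀ y : Y.carrier, (h.toFun y : Apt) = b y := hb'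
    have key : ∀ i, ∃ a k : Apt → Apt, IsWeyl k ∧ (∀ x, k (a x) = x) ∧ (∀ x, a (k x) = x) ∧
        ∀ x, ((f i).toFun x : Apt) = a x := by
      intro i
      obtain ⟨a, ha, hfa⟩ := (f i).isAffine
      obtain ⟨k, hk, h1, h2⟩ := ha.exists_inv
      exact ⟨a, k, hk, h1, h2, hfa⟩
    choose a k hk hka hak hfa using key
    let D' : ι → Enclosure := fun i =>
      { carrier := Y.carrier ∩ (fun x => k i (b x)) ⁻¹' (D i).carrier
        isPoly := Y.isPoly.inter ((D i).isPoly.preimage ((hk i).comp hb))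
        isBounded := Y.isBounded.subset Set.inter_subset_left }
    refine ⟨ι, hι, D', fun i => Enclosure.incl Set.inter_subset_left, fun i => ?_, fun y => ?_⟩
    · let q : D' i ⟶ D i := Enclosure.homOf (fun x => k i (b x)) ((hk i).comp hb)
        (fun x hx => hx.2)
      have hq : (Enclosure.incl Set.inter_subset_left : D' i ⟶ Y) ≫ h = q ≫ f i := by
        apply Enclosure.Hom.ext
        funext x
        apply Subtype.ext
        change (h.toFun ⟨x, _⟩ : Apt) = ((f i).toFun (q.toFun x) : Apt)
        exact (hh _).trans ((hak i _).symm.trans (hfa i (q.toFun x)).symm)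
      change S.arrows (_ ≫ h)
      rw [hq]
      exact S.downward_closed (hf i) q
    · obtain ⟨i, z, hz⟩ := hc (h.toFun y)
      have hz' : a i z = b y := by rw [← hfa i z, hz, hh]
      refine ⟨i, ⟨y, y.2, ?_⟩, rfl⟩
      change k i (b y) ∈ (D i).carrier
      rw [← hz', hka]
      exact z.2
  transitive' := by
    rintro X S ⟨ι, hι, D, f, hf, hc⟩ R hR
    have key : ∀ i, ∃ (κ : Type) (_ : Finite κ) (C : κ → Enclosure) (g : ∀ j, C j ⟶ D i),
        (∀ j, R.arrows (g j ≫ f i)) ∧ ∀ x : (D i).carrier, ∃ j, x ∈ Set.range (g j).toFun :=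
      fun i => hR (hf i)
    choose κ hκ C g hg hgc using key
    refine ⟨Σ i, κ i, inferInstance, fun p => C p.1 p.2, fun p => g p.1 p.2 ≫ f p.1,
      fun p => hg p.1 p.2, fun x => ?_⟩
    obtain ⟨i, z, rfl⟩ := hc x
    obtain ⟨j, w, rfl⟩ := hgc i z
    exact ⟨⟨i, j⟩, w, rfl⟩

/-! ### Constructions -/

/-- A presheaf `P` is finitely generated if there are finitely many maps `E i → P` from enclosures
(that is, sections `s i` of `P` over `E i`) such that `∐ E i → P` becomes surjective after
sheafification, i.e. every section of `P` lies locally in its image. -/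
def IsFinitelyGenerated (P : Enclosureᵒᵖ ⥤ Type) : Prop :=
  ∃ (ι : Type) (_ : Finite ι) (E : ι → Enclosure) (s : ∀ i, P.obj (op (E i))),
    ∀ (G : Enclosure) (t : P.obj (op G)),
      ∃ S ∈ encTopology G, ∀ (H : Enclosure) (g : H ⟶ G), S.arrows g →
        ∃ (i : ι) (a : H ⟶ E i), P.map g.op t = P.map a.op (s i)

/-- The fibre product `E ×_F E'` of two maps from enclosures to `F`, given as sections of `F`. -/
def fiberProduct (F : Enclosureᵒᵖ ⥤ Type) {E E' : Enclosure} (s : F.obj (op E))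
    (s' : F.obj (op E')) : Enclosureᵒᵖ ⥤ Type where
  obj G := {q : (G.unop ⟶ E) × (G.unop ⟶ E') // F.map q.1.op s = F.map q.2.op s'}
  map {G G'} h := TypeCat.ofHom fun q => ⟨(h.unop ≫ q.1.1, h.unop ≫ q.1.2), by
    have := congrArg (fun z => F.map h z) q.2
    simpa using this⟩

/-- A construction: a sheaf on the site of enclosures which is finitely related, i.e. all the fibre
products `E ×_F E'` are finitely generated. -/
structure IsConstruction (F : Enclosureᵒᵖ ⥤ Type) : Prop where
  isSheaf : Presheaf.IsSheaf encTopology F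
  finitelyRelated : ∀ (E E' : Enclosure) (s : F.obj (op E)) (s' : F.obj (op E')),
    IsFinitelyGenerated (fiberProduct F s s')

/-! ### Points -/

/-- The enclosure consisting of a single point (the origin of `A`). -/
def pt : Enclosure where
  carrier := {0}
  isPoly := by
    have h : ({0} : Set Apt) = ({x | 0 ≤ crd x 0 - crd x 1} ∩ {x | 0 ≤ crd x 1 - crd x 2}) ∩
        {x | 0 ≤ crd x 2 - crd x 0} := by
      ext x
      simp only [Set.mem_singleton_iff, Set.mem_inter_iff, Set.mem_ofPred_eq]
      constructor
      · rintro rfl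
        simp
      · rintro ⟨⟨h1, h2⟩, h3⟩
        have h0 := crd_sum x
        apply crd_ext
        intro i
        fin_cases i
        · change crd x 0 = 0
          linarith
        · change crd x 1 = 0
          linarith
        · change crd x 2 = 0
          linarith
    rw [h]
    exact ((isRootPolyhedron_half (by decide) 0).inter (isRootPolyhedron_half (by decide) 0)).inter
      (isRootPolyhedron_half (by decide) 0)
  isBounded := Bornology.isBounded_singleton

/-- The map `p → E` whose image is the point `e` of `E`. -/
def Enclosure.point {E : Enclosure} (e : E.carrier) : pt ⟶ E :=
  Enclosure.homOf (fun x => x + (e : Apt)) (isWeyl_translate _) (by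
    rintro x hx
    have hx0 : x = 0 := hx
    rw [hx0, zero_add]
    exact e.2)

/-- The set `F(p)` of points of `F`. -/
def Points (F : Enclosureᵒᵖ ⥤ Type) : Type := F.obj (op pt)

/-- The point `f(e)` of `F`, for a map `f : E → F` (a section of `F` over `E`). -/
def evalAt {F : Enclosureᵒᵖ ⥤ Type} {E : Enclosure} (f : F.obj (op E)) (e : E.carrier) :
    Points F :=
  F.map (Enclosure.point e).op f

/-- The topology on `F(p)`: a subset is open when its preimage in `E` is open for every map
`E → F` from an enclosure, `E` having its topology as a subset of `A`. -/
instance (F : Enclosureᵒᵖ ⥤ Type) : TopologicalSpace (Points F) :=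
  ⨆ (E : Enclosure) (f : F.obj (op E)), TopologicalSpace.coinduced (evalAt f) inferInstance

theorem evalAt_map {F : Enclosureᵒᵖ ⥤ Type} {D E : Enclosure} (h : D ⟶ E) (f : F.obj (op E))
    (d : D.carrier) : evalAt (F.map h.op f) d = evalAt f (h.toFun d) := by
  have hh : Enclosure.point d ≫ h = Enclosure.point (h.toFun d) := by
    obtain ⟨a, ha, hb⟩ := h.isAffine
    apply Enclosure.Hom.ext
    funext x
    have hx : x = ⟨0, rfl⟩ := Subtype.ext x.2
    subst hx
    apply Subtype.ext
    have e1 : ((Enclosure.point d).toFun ⟨0, rfl⟩) = d := Subtype.ext (zero_add _)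
    have e2 : ((Enclosure.point (h.toFun d)).toFun ⟨0, rfl⟩) = h.toFun d :=
      Subtype.ext (zero_add _)
    change ((h.toFun ((Enclosure.point d).toFun ⟨0, rfl⟩)) : Apt) = _
    rw [e1, e2]
  change F.map (Enclosure.point d).op (F.map h.op f) = F.map (Enclosure.point (h.toFun d)).op f
  rw [← hh]
  simp

theorem evalAt_naturality {F G : Enclosureᵒᵖ ⥤ Type} (η : F ⟶ G) {E : Enclosure}
    (f : F.obj (op E)) (e : E.carrier) :
    evalAt (η.app _ f) e = η.app (op pt) (evalAt f e) := by
  have := NatTrans.naturality_apply η (Enclosure.point e).op f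
  exact this.symm

/-! ### Sectors, segments and parallelograms

The two parities of one-dimensional sectors are indexed by `Bool`, with `true` for positive. -/

/-- The two simple roots, `x 0 - x 1` for `true` and `x 1 - x 2` for `false`. -/
def root (ε : Bool) (x : Apt) : ℝ := if ε then crd x 0 - crd x 1 else crd x 1 - crd x 2

/-- The two-dimensional standard sector `η`. -/
def chamber : Set Apt := {x | ∀ ε, 0 ≤ root ε x}

/-- The one-dimensional standard sectors: the two edges `ν⁺`, `ν⁻` of `chamber`. -/
def ray (ε : Bool) : Set Apt := {x | 0 ≤ root ε x ∧ root (!ε) x = 0}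

theorem ray_subset (ε : Bool) : ray ε ⊆ chamber := by
  intro x hx δ
  obtain ⟨h1, h2⟩ := hx
  cases ε <;> cases δ <;> simp_all

theorem root_continuous (ε : Bool) : Continuous (root ε) := by
  have h : ∀ i, Continuous (fun x : Apt => crd x i) := fun i =>
    (continuous_apply i).comp continuous_subtype_val
  cases ε
  · exact (h 1).sub (h 2)
  · exact (h 0).sub (h 1)

/-- The direction vector of `ray ε`, normalized by `root ε = 1`. -/
noncomputable def wt (ε : Bool) : Apt :=
  ⟨if ε then ![2 / 3, -1 / 3, -1 / 3] else ![1 / 3, 1 / 3, -2 / 3], by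
    change ∑ i, _ = _
    cases ε <;> simp [Fin.sum_univ_three] <;> norm_num⟩

@[simp] theorem crd_wt_true (i : Fin 3) : crd (wt true) i = ![2 / 3, -1 / 3, -1 / 3] i := rfl

@[simp] theorem crd_wt_false (i : Fin 3) : crd (wt false) i = ![1 / 3, 1 / 3, -2 / 3] i := rfl

/-- The segment of length `t` based at the origin with direction `ray ε`; the unit of length is the
length of `wt ε`. -/
def seg (ε : Bool) (t : ℝ) : Enclosure where
  carrier := {x | 0 ≤ root ε x ∧ root ε x ≤ t ∧ root (!ε) x = 0}
  isPoly := by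
    cases ε
    · have h : {x | 0 ≤ root false x ∧ root false x ≤ t ∧ root (!false) x = 0} =
          (({x | 0 ≤ crd x 1 - crd x 2} ∩ {x | -t ≤ crd x 2 - crd x 1}) ∩
          {x | 0 ≤ crd x 0 - crd x 1}) ∩ {x | 0 ≤ crd x 1 - crd x 0} := by
        ext x
        simp only [root, Set.mem_inter_iff, Set.mem_ofPred_eq, Bool.not_false, if_true,
          Bool.false_eq_true, if_false]
        constructor
        · rintro ⟨h1, h2, h3⟩
          refine ⟨⟨⟨?_, ?_⟩, ?_⟩, ?_⟩ <;> linarith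
        · rintro ⟨⟨⟨h1, h2⟩, h3⟩, h4⟩
          refine ⟨?_, ?_, ?_⟩ <;> linarith
      rw [h]
      exact (((isRootPolyhedron_half (by decide) _).inter
        (isRootPolyhedron_half (by decide) _)).inter (isRootPolyhedron_half (by decide) _)).inter
        (isRootPolyhedron_half (by decide) _)
    · have h : {x | 0 ≤ root true x ∧ root true x ≤ t ∧ root (!true) x = 0} =
          (({x | 0 ≤ crd x 0 - crd x 1} ∩ {x | -t ≤ crd x 1 - crd x 0}) ∩
          {x | 0 ≤ crd x 1 - crd x 2}) ∩ {x | 0 ≤ crd x 2 - crd x 1} := by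
        ext x
        simp only [root, Set.mem_inter_iff, Set.mem_ofPred_eq, Bool.not_true, if_true,
          Bool.false_eq_true, if_false]
        constructor
        · rintro ⟨h1, h2, h3⟩
          refine ⟨⟨⟨?_, ?_⟩, ?_⟩, ?_⟩ <;> linarith
        · rintro ⟨⟨⟨h1, h2⟩, h3⟩, h4⟩
          refine ⟨?_, ?_, ?_⟩ <;> linarith
      rw [h]
      exact (((isRootPolyhedron_half (by decide) _).inter
        (isRootPolyhedron_half (by decide) _)).inter (isRootPolyhedron_half (by decide) _)).inter
        (isRootPolyhedron_half (by decide) _)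
  isBounded := by
    refine isBounded_of_root t ?_
    rintro x ⟨h1, h2, h3⟩ i j
    have h0 := crd_sum x
    cases ε <;> simp only [root, Bool.not_true, Bool.not_false, if_true, Bool.false_eq_true,
      if_false] at h1 h2 h3 <;> fin_cases i <;> fin_cases j <;> simp <;> linarith

/-- The rotation `rot` of order three of `A`; it preserves the parity of directions. -/
def rot (x : Apt) : Apt := permAct (Equiv.subRight (1 : Fin 3)) x

theorem isWeyl_rot : IsWeyl rot :=
  ⟨Equiv.subRight 1, 0, fun _ => (add_zero _).symm⟩

/-- The parallelogram with an obtuse corner at the origin, whose edges at the origin are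
`seg ε a` and `rot (seg ε b)`. -/
noncomputable def para (ε : Bool) (a b : ℝ) : Enclosure where
  carrier := {x | ∃ p q : ℝ, (0 ≤ p ∧ p ≤ a) ∧ (0 ≤ q ∧ q ≤ b) ∧
    x = p • wt ε + q • rot (wt ε)}
  isPoly := by
    cases ε
    · have h : {x | ∃ p q : ℝ, (0 ≤ p ∧ p ≤ a) ∧ (0 ≤ q ∧ q ≤ b) ∧
          x = p • wt false + q • rot (wt false)} =
          (({x | 0 ≤ crd x 1 - crd x 2} ∩ {x | -a ≤ crd x 2 - crd x 1}) ∩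
          {x | 0 ≤ crd x 1 - crd x 0}) ∩ {x | -b ≤ crd x 0 - crd x 1} := by
        ext x
        simp only [Set.mem_inter_iff, Set.mem_ofPred_eq]
        constructor
        · rintro ⟨p, q, ⟨h1, h2⟩, ⟨h3, h4⟩, rfl⟩
          simp [rot]
          refine ⟨⟨⟨?_, ?_⟩, ?_⟩, ?_⟩ <;> linarith
        · rintro ⟨⟨⟨h1, h2⟩, h3⟩, h4⟩
          have h0 := crd_sum x
          refine ⟨crd x 1 - crd x 2, crd x 1 - crd x 0, ⟨?_, ?_⟩, ⟨?_, ?_⟩, ?_⟩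
          · linarith
          · linarith
          · linarith
          · linarith
          · apply crd_ext
            intro i
            fin_cases i <;> simp [rot] <;> linarith
      rw [h]
      exact (((isRootPolyhedron_half (by decide) _).inter
        (isRootPolyhedron_half (by decide) _)).inter (isRootPolyhedron_half (by decide) _)).inter
        (isRootPolyhedron_half (by decide) _)
    · have h : {x | ∃ p q : ℝ, (0 ≤ p ∧ p ≤ a) ∧ (0 ≤ q ∧ q ≤ b) ∧
          x = p • wt true + q • rot (wt true)} =
          (({x | 0 ≤ crd x 0 - crd x 2} ∩ {x | -a ≤ crd x 2 - crd x 0}) ∩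
          {x | 0 ≤ crd x 1 - crd x 2}) ∩ {x | -b ≤ crd x 2 - crd x 1} := by
        ext x
        simp only [Set.mem_inter_iff, Set.mem_ofPred_eq]
        constructor
        · rintro ⟨p, q, ⟨h1, h2⟩, ⟨h3, h4⟩, rfl⟩
          simp [rot]
          refine ⟨⟨⟨?_, ?_⟩, ?_⟩, ?_⟩ <;> linarith
        · rintro ⟨⟨⟨h1, h2⟩, h3⟩, h4⟩
          have h0 := crd_sum x
          refine ⟨crd x 0 - crd x 2, crd x 1 - crd x 2, ⟨?_, ?_⟩, ⟨?_, ?_⟩, ?_⟩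
          · linarith
          · linarith
          · linarith
          · linarith
          · apply crd_ext
            intro i
            fin_cases i <;> simp [rot] <;> linarith
      rw [h]
      exact (((isRootPolyhedron_half (by decide) _).inter
        (isRootPolyhedron_half (by decide) _)).inter (isRootPolyhedron_half (by decide) _)).inter
        (isRootPolyhedron_half (by decide) _)
  isBounded := by
    refine isBounded_of_root (a + b) ?_
    rintro x ⟨p, q, ⟨h1, h2⟩, ⟨h3, h4⟩, rfl⟩ i j
    cases ε <;> fin_cases i <;> fin_cases j <;> simp [rot] <;> linarith

/-! ### The spherical construction at a point -/

/-- The enclosure `E` contains the origin and looks like the cone `σ` near it. -/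
def IsCorner (σ : Set Apt) (E : Enclosure) : Prop :=
  0 ∈ E.carrier ∧ ∀ᶠ z in 𝓝 (0 : Apt), z ∈ E.carrier ↔ z ∈ σ

theorem IsCorner.inter {σ τ : Set Apt} {E E' : Enclosure} (h : IsCorner σ E)
    (h' : IsCorner τ E') (hτ : τ ⊆ σ) : IsCorner τ (E.inter E') := by
  refine ⟨⟨h.1, h'.1⟩, ?_⟩
  filter_upwards [h.2, h'.2] with z hz hz'
  change (z ∈ E.carrier ∧ z ∈ E'.carrier) ↔ z ∈ τ
  rw [hz, hz']
  exact ⟨fun q => q.2, fun q => ⟨hτ q, q⟩⟩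

theorem seg_corner (ε : Bool) {t : ℝ} (ht : 0 < t) : IsCorner (ray ε) (seg ε t) := by
  have h0 : ∀ δ, root δ 0 = 0 := by
    intro δ
    cases δ <;> simp [root]
  refine ⟨⟨(h0 ε).ge, by rw [h0]; exact ht.le, h0 _⟩, ?_⟩
  have h : ∀ᶠ z in 𝓝 (0 : Apt), root ε z < t :=
    (root_continuous ε).continuousAt.eventually_lt continuousAt_const (by rw [h0]; exact ht)
  filter_upwards [h] with z hz
  exact ⟨fun q => ⟨q.1, q.2.2⟩, fun q => ⟨q.1, hz.le, q.2⟩⟩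

/-- A map from an enclosure with corner `σ` at the origin to `F` which sends the origin to `x`. -/
structure GermRep (F : Enclosureᵒᵖ ⥤ Type) (x : Points F) (σ : Set Apt) where
  E : Enclosure
  corner : IsCorner σ E
  sec : F.obj (op E)
  base : evalAt sec ⟨0, corner.1⟩ = x

/-- Two such maps have the same germ if they agree on a smaller enclosure with corner `σ`. -/
instance germSetoid (F : Enclosureᵒᵖ ⥤ Type) (x : Points F) (σ : Set Apt) :
    Setoid (GermRep F x σ) where
  r a b := ∃ (D : Enclosure) (_ : IsCorner σ D) (ha : D.carrier ⊆ a.E.carrier)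
    (hb : D.carrier ⊆ b.E.carrier),
    F.map (Enclosure.incl ha).op a.sec = F.map (Enclosure.incl hb).op b.sec
  iseqv :=
    { refl := fun a => ⟨a.E, a.corner, subset_rfl, subset_rfl, rfl⟩
      symm := fun ⟨D, hD, ha, hb, h⟩ => ⟨D, hD, hb, ha, h.symm⟩
      trans := by
        rintro a b c ⟨D, hD, ha, hb, h⟩ ⟨D', hD', hb', hc, h'⟩
        have i1 : (D.inter D').carrier ⊆ D.carrier := Set.inter_subset_left
        have i2 : (D.inter D').carrier ⊆ D'.carrier := Set.inter_subset_right
        refine ⟨D.inter D', hD.inter hD' subset_rfl, i1.trans ha, i2.trans hc, ?_⟩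
        have e1 := congrArg (F.map (Enclosure.incl i1).op) h
        have e2 := congrArg (F.map (Enclosure.incl i2).op) h'
        simp only [← Functor.map_comp_apply, ← op_comp, Enclosure.incl_comp] at e1 e2
        exact e1.trans e2 }

/-- The set `F_x(σ)` of germs at `x` of maps to `F` with corner `σ`. -/
def Germ (F : Enclosureᵒᵖ ⥤ Type) (x : Points F) (σ : Set Apt) : Type :=
  Quotient (germSetoid F x σ)

/-- The germ of a map to `F`. -/
def Germ.mk {F : Enclosureᵒᵖ ⥤ Type} {x : Points F} {σ : Set Apt} {E : Enclosure}
    (hE : IsCorner σ E) (s : F.obj (op E)) (hs : evalAt s ⟨0, hE.1⟩ = x) : Germ F x σ :=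
  Quotient.mk (germSetoid F x σ) ⟨E, hE, s, hs⟩

/-- Restriction of germs to a smaller cone `τ`; `S` is any enclosure with corner `τ`. -/
def Germ.restrict {F : Enclosureᵒᵖ ⥤ Type} {x : Points F} {σ τ : Set Apt} (hτ : τ ⊆ σ)
    (S : Enclosure) (hS : IsCorner τ S) : Germ F x σ → Germ F x τ :=
  Quotient.map
    (fun a => ⟨a.E.inter S, a.corner.inter hS hτ,
      F.map (Enclosure.incl (D := a.E.inter S) Set.inter_subset_left).op a.sec,
      (evalAt_map _ _ _).trans a.base⟩)
    (by
      rintro a b ⟨D, hD, ha, hb, h⟩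
      have i1 : (D.inter S).carrier ⊆ D.carrier := Set.inter_subset_left
      refine ⟨D.inter S, hD.inter hS hτ, Set.inter_subset_inter_left _ ha,
        Set.inter_subset_inter_left _ hb, ?_⟩
      have e1 := congrArg (F.map (Enclosure.incl i1).op) h
      simp only [← Functor.map_comp_apply, ← op_comp, Enclosure.incl_comp] at e1 ⊢
      exact e1)

/-- The image of a germ under a map of presheaves. -/
def Germ.map {F G : Enclosureᵒᵖ ⥤ Type} (η : F ⟶ G) {x : Points F} {σ : Set Apt} :
    Germ F x σ → Germ G (η.app (op pt) x) σ :=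
  Quotient.map
    (fun a => ⟨a.E, a.corner, η.app _ a.sec, by rw [evalAt_naturality, a.base]⟩)
    (by
      rintro a b ⟨D, hD, ha, hb, h⟩
      refine ⟨D, hD, ha, hb, ?_⟩
      rw [← NatTrans.naturality_apply, ← NatTrans.naturality_apply, h])

/-- A spherical construction: a presheaf on the category of sectors `ν⁻ → η ← ν⁺`. -/
structure SphericalConstruction where
  edge : Type
  node : Bool → Type
  face : ∀ ε, edge → node ε

/-- The vertices of a spherical construction viewed as a graph. -/
abbrev SphericalConstruction.Vertex (H : SphericalConstruction) : Type := Σ ε, H.node ε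

/-- The graph of a spherical construction (multiple edges being forgotten): every edge joins its
positive node to its negative node. -/
def SphericalConstruction.graph (H : SphericalConstruction) : SimpleGraph H.Vertex where
  Adj u v := ∃ (e : H.edge) (ε : Bool), u = ⟨ε, H.face ε e⟩ ∧ v = ⟨!ε, H.face (!ε) e⟩
  symm := by
    constructor
    rintro _ _ ⟨e, ε, rfl, rfl⟩
    refine ⟨e, !ε, rfl, ?_⟩
    rw [Bool.not_not]
  loopless := by
    constructor
    rintro u ⟨e, ε, h1, h2⟩
    have h := congrArg Sigma.fst (h1.symm.trans h2)
    cases ε <;> simp at h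

/-- A (nonempty) spherical building: any two vertices have distance at most `3`, any two vertices
lie in a hexagon, and there are no loops of length `2` (that is, no double edges) or `4`. -/
structure SphericalConstruction.IsBuilding (H : SphericalConstruction) : Prop where
  nonempty : Nonempty H.Vertex
  edist_le : ∀ u v, H.graph.edist u v ≤ 3
  hexagon : ∀ u v, ∃ (w : H.Vertex) (c : H.graph.Walk w w),
    c.IsCycle ∧ c.length = 6 ∧ u ∈ c.support ∧ v ∈ c.support
  no_double_edge : ∀ e e' : H.edge, (∀ ε, H.face ε e = H.face ε e') → e = e'
  no_short_cycle : ∀ (w : H.Vertex) (c : H.graph.Walk w w), c.IsCycle → 4 < c.length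

/-- The spherical construction `F_x`. -/
def sphereAt (F : Enclosureᵒᵖ ⥤ Type) (x : Points F) : SphericalConstruction where
  edge := Germ F x chamber
  node ε := Germ F x (ray ε)
  face ε := Germ.restrict (ray_subset ε) (seg ε 1) (seg_corner ε one_pos)

/-- The map `F_x → G_{η(x)}` on vertices induced by a map `η : F → G`. -/
def sphereMap {F G : Enclosureᵒᵖ ⥤ Type} (η : F ⟶ G) {x : Points F}
    (u : (sphereAt F x).Vertex) : (sphereAt G (η.app (op pt) x)).Vertex :=
  ⟨u.1, Germ.map η u.2⟩

/-- The condition SB-loc. -/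
def SBLoc (F : Enclosureᵒᵖ ⥤ Type) : Prop :=
  ∀ x : Points F, (sphereAt F x).IsBuilding

/-! ### Immersive maps and apartments -/

/-- The affine space `A` as a presheaf on enclosures: its sections over `E` are the restrictions to
`E` of affine Weyl group elements. (Its associated sheaf consists of the folding maps to `A`, so
that a map from that sheaf to a sheaf `F` is the same as a map of presheaves `aptPresheaf ⟶ F`;
germs at a point are the same for this presheaf and for its associated sheaf.) -/
def aptPresheaf : Enclosureᵒᵖ ⥤ Type where
  obj E := {f : E.unop.carrier → Apt // IsAffineMap f}
  map h := TypeCat.ofHom fun f => ⟨f.1 ∘ h.unop.toFun, by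
    obtain ⟨a, ha, hf⟩ := f.2
    obtain ⟨b, hb, hg⟩ := h.unop.isAffine
    exact ⟨fun x => a (b x), ha.comp hb, fun x => by
      rw [Function.comp, hf]
      exact congrArg a (hg x)⟩⟩

/-- The standard inclusion `E → A` of an enclosure. -/
def Enclosure.toApt (E : Enclosure) : yoneda.obj E ⟶ aptPresheaf :=
  yonedaEquiv.symm ⟨Subtype.val, id, isWeyl_id, fun _ => rfl⟩

/-- The map of presheaves `E → F` given by a section of `F` over `E`. -/
def secHom {F : Enclosureᵒᵖ ⥤ Type} {E : Enclosure} (f : F.obj (op E)) : yoneda.obj E ⟶ F :=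
  yonedaEquiv.symm f

/-- The point `e` of `E`, as a point of the presheaf represented by `E`. -/
def Enclosure.pointOf {E : Enclosure} (e : E.carrier) : Points (yoneda.obj E) :=
  Enclosure.point e

/-- A map `f : E → F` is immersive at `e` if `E_e → F_{f(e)}` preserves distances, the distances in
`E_e` being calculated in `A_e`. -/
def ImmersiveAt {F : Enclosureᵒᵖ ⥤ Type} {E : Enclosure} (f : F.obj (op E)) (e : E.carrier) :
    Prop :=
  ∀ u v : (sphereAt (yoneda.obj E) (Enclosure.pointOf e)).Vertex,
    (sphereAt F _).graph.edist (sphereMap (secHom f) u) (sphereMap (secHom f) v) =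
      (sphereAt aptPresheaf _).graph.edist (sphereMap E.toApt u) (sphereMap E.toApt v)

/-- A map from an enclosure to `F` is immersive if it is immersive at all points. -/
def Immersive {F : Enclosureᵒᵖ ⥤ Type} {E : Enclosure} (f : F.obj (op E)) : Prop :=
  ∀ e : E.carrier, ImmersiveAt f e

/-- An apartment of `F`: a map `A → F` which is immersive on each enclosure in `A`. -/
def IsApartment {F : Enclosureᵒᵖ ⥤ Type} (φ : aptPresheaf ⟶ F) : Prop :=
  ∀ E : Enclosure, Immersive (yonedaEquiv (E.toApt ≫ φ))

/-! ### The extension conditions -/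

theorem seg_mono (ε : Bool) {t t' : ℝ} (h : t ≤ t') :
    (seg ε t).carrier ⊆ (seg ε t').carrier :=
  fun _ hx => ⟨hx.1, hx.2.1.trans h, hx.2.2⟩

/-- The map from `seg (!ε) t` to `seg ε t` that reverses the segment: it sends the origin to the
other endpoint. -/
noncomputable def segRev (ε : Bool) (t : ℝ) : seg (!ε) t ⟶ seg ε t :=
  Enclosure.homOf (fun x => permAct (Equiv.swap 0 2) x + t • wt ε) (isWeyl_perm _ _) (by
    rintro x ⟨h1, h2, h3⟩
    have h0 := crd_sum x
    cases ε <;> simp [root] at h1 h2 h3 <;>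
      refine ⟨?_, ?_, ?_⟩ <;> simp [root, Equiv.swap_apply_of_ne_of_ne] <;> linarith)

/-- The translation by `t` along the direction of the segment, from `seg ε (t' - t)` to
`seg ε t'`. -/
noncomputable def segShift (ε : Bool) {t : ℝ} (ht : 0 ≤ t) (t' : ℝ) :
    seg ε (t' - t) ⟶ seg ε t' :=
  Enclosure.homOf (fun x => x + t • wt ε) (isWeyl_translate _) (by
    rintro x ⟨h1, h2, h3⟩
    cases ε <;> simp [root] at h1 h2 h3 <;>
      refine ⟨?_, ?_, ?_⟩ <;> simp [root] <;> linarith)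

/-- The first edge of the parallelogram at the origin. -/
noncomputable def paraFst (ε : Bool) (a : ℝ) {b : ℝ} (hb : 0 ≤ b) : seg ε a ⟶ para ε a b :=
  Enclosure.incl (by
    rintro x ⟨h1, h2, h3⟩
    have h0 := crd_sum x
    refine ⟨root ε x, 0, ⟨h1, h2⟩, ⟨le_rfl, hb⟩, crd_ext fun i => ?_⟩
    cases ε <;> simp [root] at h1 h2 h3 <;> fin_cases i <;> simp [root] <;> linarith)

/-- The second edge of the parallelogram at the origin, parametrized by `seg ε b` through the
rotation. -/
noncomputable def paraSnd (ε : Bool) {a : ℝ} (ha : 0 ≤ a) (b : ℝ) : seg ε b ⟶ para ε a b :=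
  Enclosure.homOf rot isWeyl_rot (by
    rintro x ⟨h1, h2, h3⟩
    have h0 := crd_sum x
    refine ⟨0, root ε x, ⟨le_rfl, ha⟩, ⟨h1, h2⟩, crd_ext fun i => ?_⟩
    cases ε <;> simp [root] at h1 h2 h3 <;> fin_cases i <;> simp [root, rot, show (-1 : Fin 3) = 2 from rfl] <;> linarith)

/-- The condition Ex-Seg, for both orientations: an immersive map `φ` from the segment of length
`t` extends to an immersive map `φ'` from the segment of any length `t' > t`, with any prescribed
direction `ν` at the endpoint that is opposite to the backward direction of `φ` there. -/
def ExSeg (F : Enclosureᵒᵖ ⥤ Type) : Prop :=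
  ∀ (ε : Bool) (t t' : ℝ) (ht : 0 < t) (htt' : t < t') (φ : F.obj (op (seg ε t))),
    Immersive φ →
    ∀ (y : Points F)
      (hy : evalAt (F.map (segRev ε t).op φ) ⟨0, (seg_corner (!ε) ht).1⟩ = y)
      (ν : Germ F y (ray ε)),
      (sphereAt F y).graph.edist
        ⟨!ε, Germ.mk (seg_corner (!ε) ht) (F.map (segRev ε t).op φ) hy⟩ ⟨ε, ν⟩ = 3 →
      ∃ φ' : F.obj (op (seg ε t')), Immersive φ' ∧
        F.map (Enclosure.incl (seg_mono ε htt'.le)).op φ' = φ ∧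
        ∃ hy' : evalAt (F.map (segShift ε ht.le t').op φ')
            ⟨0, (seg_corner ε (sub_pos.2 htt')).1⟩ = y,
          Germ.mk (seg_corner ε (sub_pos.2 htt')) (F.map (segShift ε ht.le t').op φ') hy' = ν

/-- The condition Ex-Obt, for both orientations: two immersive segments `φ`, `ψ` of the same parity
starting at the same point `x` in distinct directions (at distance at least `2` in `F_x`) are the
two edges at the obtuse corner of an immersive parallelogram. -/
def ExObt (F : Enclosureᵒᵖ ⥤ Type) : Prop :=
  ∀ (ε : Bool) (a b : ℝ) (ha : 0 < a) (hb : 0 < b)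
    (φ : F.obj (op (seg ε a))) (ψ : F.obj (op (seg ε b))) (x : Points F)
    (hφ : evalAt φ ⟨0, (seg_corner ε ha).1⟩ = x) (hψ : evalAt ψ ⟨0, (seg_corner ε hb).1⟩ = x),
    Immersive φ → Immersive ψ →
    2 ≤ (sphereAt F x).graph.edist ⟨ε, Germ.mk (seg_corner ε ha) φ hφ⟩
      ⟨ε, Germ.mk (seg_corner ε hb) ψ hψ⟩ →
    ∃ ζ : F.obj (op (para ε a b)), Immersive ζ ∧
      F.map (paraFst ε a hb.le).op ζ = φ ∧ F.map (paraSnd ε ha.le b).op ζ = ψ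

end SL3

/-!
By finite relatedness, sections of a construction `F` are determined by their values at points
(`IsConstruction.isSeparated`). So `F` is an atlas on the set `F(p)`: its charts are functions on
hexagonal regions of the plane, and the vertices of `F_x` are darts, the germs of charts along rays
(`IsConstruction.atlas`). Immersive maps and the conditions SB-loc, Ex-Seg and Ex-Obt are conditions
on charts and darts (`immersive_iff_imm`, `IsConstruction.isBuilding`).

Call two points joined when they lie in the image of an immersive chart. Being joined to `x` is
constant along charts, so that the set of points joined to `x` is open and closed, and all points are
joined by connectedness (`IsConstruction.joined`). For this a chart on a segment may be taken to be
immersive: it is so near each of its points, as folds at infinitely many points would contradict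
finite relatedness (`exists_iseg`). It remains to show that a point `x` joined to the start of an
immersive curve is joined to its end. Let `x` be opposite to the start of the curve in an immersive
parallelogram, both being acute corners. One side of the parallelogram and the curve span a second
parallelogram by Ex-Obt. The two coincide on a maximal strip along this side, and beyond it they are
replaced by a parallelogram whose corner lies further on the curve (`branch`). Either the curve leaves
this parallelogram straight on from a side, and one more use of Ex-Obt finishes the proof, or the
strip is as wide as the shapes allow, and induction applies (`joined_of_rect`, `joined_trans_curve`).
The maximality of the strip is exploited through `propagate`: if two immersive charts coincide along
a line and near one end of it, then they coincide near the whole line, since `F_x` has no cycles of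
length four.

Finally, two joined points lie on two infinite curves of the same parity from a common point, in
different directions (`exists_rays`). A hexagon through these directions provides a third curve, any
two of the three curves bound an immersive sector of angle `120°` (`exists_sector`), and the three
sectors together cover the plane. The resulting map is immersive on the curves too, because a fold
along one of them would propagate back to the common point (`hexAt_ray`). This is an apartment
(`exists_apartment`), first of the atlas and then as a map of presheaves (`exists_aptPresheaf_hom`).
-/

namespace Planar

/-! ### Coordinates on the plane -/

/-- The model plane in coordinates: `(p, q)` stands for `p • dr 0 + q • dr 1`. -/
abbrev Pl : Type := ℝ × ℝ

/-- The six wall directions in cyclic order, consecutive ones making an angle of `60°`. -/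
def dr : Fin 6 → Pl := ![(1, 0), (0, 1), (-1, 1), (-1, 0), (0, -1), (1, -1)]

/-- The intersections of strips in the three wall directions. In these coordinates they are the
bounded finite intersections of root half-spaces. -/
def IsHex (s : Set Pl) : Prop :=
  ∃ a a' b b' c c' : ℝ, s = {z | (a ≤ z.1 ∧ z.1 ≤ a') ∧ (b ≤ z.2 ∧ z.2 ≤ b') ∧
    (c ≤ z.1 + z.2 ∧ z.1 + z.2 ≤ c')}

/-- The rotation by `60°`, sending `dr k` to `dr (k + 1)`. -/
def rotT (z : Pl) : Pl := (-z.2, z.1 + z.2)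

/-- The reflection fixing `dr 0`, sending `dr k` to `dr (-k)`. -/
def reflR (z : Pl) : Pl := (z.1 + z.2, -z.2)

/-- The parity of the direction `dr k` when `dr 0` has parity `τ`. -/
def typ (τ : Bool) (k : Fin 6) : Bool := if k.val % 2 = 0 then τ else !τ

/-- The orientation preserving symmetry of the plane taking `0` to `e` and `dr j` to
`dr (k + j)`. -/
def fr (e : Pl) (k : Fin 6) (z : Pl) : Pl := e + z.1 • dr k + z.2 • dr (k + 1)

theorem dr_zero : dr 0 = (1, 0) := rfl
theorem dr_one : dr 1 = (0, 1) := rfl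
theorem dr_two : dr 2 = (-1, 1) := rfl
theorem dr_three : dr 3 = (-1, 0) := rfl

theorem reflR_dr (k : Fin 6) : reflR (dr k) = dr (-k) := by
  fin_cases k <;> (ext <;> simp [reflR, dr, show (-1 : Fin 6) = 5 from rfl, show (-2 : Fin 6) = 4 from rfl, show (-3 : Fin 6) = 3 from rfl, show (-4 : Fin 6) = 2 from rfl, show (-5 : Fin 6) = 1 from rfl])

theorem dr_add (k j : Fin 6) : dr (k + j) = (dr j).1 • dr k + (dr j).2 • dr (k + 1) := by
  fin_cases k <;> fin_cases j <;> (ext <;> simp [dr])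

theorem fr_line (e : Pl) (k : Fin 6) (z : Pl) (r : ℝ) (j : Fin 6) :
    fr e k (z + r • dr j) = fr e k z + r • dr (k + j) := by
  rw [dr_add]
  ext <;> simp [fr] <;> ring

theorem fr_zero (e : Pl) (k : Fin 6) : fr e k 0 = e := by simp [fr]

theorem fr_std (e : Pl) (z : Pl) : fr e 0 z = e + z := by
  ext <;> simp [fr, dr]

theorem fr_succ (e : Pl) (k : Fin 6) (z : Pl) : fr e (k + 1) z = fr e k (rotT z) := by
  have h : dr (k + 1 + 1) = dr (k + 1) - dr k := by
    rw [add_assoc, show (1 : Fin 6) + 1 = 2 from rfl, dr_add, dr_two]; simp; abel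
  ext <;> simp [fr, rotT, h] <;> ring

theorem typ_typ (τ : Bool) (k j : Fin 6) : typ (typ τ k) j = typ τ (k + j) := by
  revert τ k j; decide

theorem typ_zero (τ : Bool) : typ τ 0 = τ := rfl
theorem typ_neg (τ : Bool) (k : Fin 6) : typ τ (-k) = typ τ k := by
  revert τ k; decide
theorem typ_three (τ : Bool) (k : Fin 6) : typ τ (k + 3) = !typ τ k := by
  revert τ k; decide
theorem typ_two (τ : Bool) (k : Fin 6) : typ τ (k + 2) = typ τ k := by
  revert τ k; decide
theorem typ_succ (τ : Bool) (k : Fin 6) : typ τ (k + 1) = !typ τ k := by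
  revert τ k; decide

theorem IsHex.inter {s t : Set Pl} (hs : IsHex s) (ht : IsHex t) : IsHex (s ∩ t) := by
  obtain ⟨a, a', b, b', c, c', rfl⟩ := hs
  obtain ⟨l, l', m, m', n, n', rfl⟩ := ht
  refine ⟨max a l, min a' l', max b m, min b' m', max c n, min c' n', ?_⟩
  ext z
  simp only [Set.mem_inter_iff, Set.mem_ofPred_eq, max_le_iff, le_min_iff]
  tauto

theorem IsHex.fr_preimage {s : Set Pl} (hs : IsHex s) (e : Pl) (k : Fin 6) :
    IsHex (fr e k ⁻¹' s) := by
  have h1 : ∀ {s : Set Pl}, IsHex s → IsHex ((fun z => e + z) ⁻¹' s) := by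
    rintro s ⟨a, a', b, b', c, c', rfl⟩
    refine ⟨a - e.1, a' - e.1, b - e.2, b' - e.2, c - e.1 - e.2, c' - e.1 - e.2, ?_⟩
    ext z
    simp only [Set.mem_preimage, Set.mem_ofPred_eq, Prod.fst_add, Prod.snd_add]
    constructor <;> (rintro ⟨⟨h1, h2⟩, ⟨h3, h4⟩, h5, h6⟩; refine ⟨⟨?_, ?_⟩, ⟨?_, ?_⟩, ?_, ?_⟩) <;>
      linarith
  have h2 : ∀ {s : Set Pl}, IsHex s → IsHex (rotT ⁻¹' s) := by
    rintro s ⟨a, a', b, b', c, c', rfl⟩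
    refine ⟨c, c', -a', -a, b, b', ?_⟩
    ext z
    simp only [rotT, Set.mem_preimage, Set.mem_ofPred_eq]
    constructor <;> (rintro ⟨⟨h1, h2⟩, ⟨h3, h4⟩, h5, h6⟩; refine ⟨⟨?_, ?_⟩, ⟨?_, ?_⟩, ?_, ?_⟩) <;>
      linarith
  have h3 : ∀ k : Fin 6, IsHex (fr e k ⁻¹' s) → IsHex (fr e (k + 1) ⁻¹' s) := by
    intro k hk
    have : fr e (k + 1) ⁻¹' s = rotT ⁻¹' (fr e k ⁻¹' s) := by
      ext z; simp [fr_succ]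
    rw [this]; exact h2 hk
  have h0 : IsHex (fr e 0 ⁻¹' s) := by
    have : fr e 0 ⁻¹' s = (fun z => e + z) ⁻¹' s := by ext z; simp [fr_std]
    rw [this]; exact h1 hs
  fin_cases k
  · exact h0
  · exact h3 0 h0
  · exact h3 1 (h3 0 h0)
  · exact h3 2 (h3 1 (h3 0 h0))
  · exact h3 3 (h3 2 (h3 1 (h3 0 h0)))
  · exact h3 4 (h3 3 (h3 2 (h3 1 (h3 0 h0))))

theorem IsHex.refl_preimage {s : Set Pl} (hs : IsHex s) : IsHex (reflR ⁻¹' s) := by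
  obtain ⟨a, a', b, b', c, c', rfl⟩ := hs
  refine ⟨c, c', -b', -b, a, a', ?_⟩
  ext z
  simp only [reflR, Set.mem_preimage, Set.mem_ofPred_eq]
  constructor <;> (rintro ⟨⟨h1, h2⟩, ⟨h3, h4⟩, h5, h6⟩; refine ⟨⟨?_, ?_⟩, ⟨?_, ?_⟩, ?_, ?_⟩) <;>
      linarith

theorem isHex_mk (a a' b b' c c' : ℝ) : IsHex {z : Pl | (a ≤ z.1 ∧ z.1 ≤ a') ∧
    (b ≤ z.2 ∧ z.2 ≤ b') ∧ (c ≤ z.1 + z.2 ∧ z.1 + z.2 ≤ c')} := ⟨_, _, _, _, _, _, rfl⟩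

theorem IsHex.isClosed {s : Set Pl} (hs : IsHex s) : IsClosed s := by
  obtain ⟨a, a', b, b', c, c', rfl⟩ := hs
  have c1 : Continuous fun z : Pl => z.1 := continuous_fst
  have c2 : Continuous fun z : Pl => z.2 := continuous_snd
  have c3 : Continuous fun z : Pl => z.1 + z.2 := c1.add c2
  exact ((isClosed_le continuous_const c1).inter (isClosed_le c1 continuous_const)).inter
    (((isClosed_le continuous_const c2).inter (isClosed_le c2 continuous_const)).inter
    ((isClosed_le continuous_const c3).inter (isClosed_le c3 continuous_const)))

theorem IsHex.isCompact {s : Set Pl} (hs : IsHex s) : IsCompact s := by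
  have hc := hs.isClosed
  obtain ⟨a, a', b, b', c, c', rfl⟩ := hs
  refine ((isCompact_Icc (a := a) (b := a')).prod (isCompact_Icc (a := b) (b := b'))).of_isClosed_subset
    hc ?_
  rintro z ⟨h1, h2, -⟩
  exact ⟨h1, h2⟩

/-- Points of the parallelogram spanned by two points at an acute corner lie in any hexagonal
region that contains these. -/
theorem IsHex.acute_hull {s : Set Pl} (hs : IsHex s) {e : Pl} (k : Fin 6) {p q p' q' : ℝ}
    (he : e ∈ s) (hw : e + p • dr k + q • dr (k + 1) ∈ s) (hp' : 0 ≤ p') (hp : p' ≤ p)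
    (hq' : 0 ≤ q') (hq : q' ≤ q) : e + p' • dr k + q' • dr (k + 1) ∈ s := by
  obtain ⟨a, a', b, b', c, c', rfl⟩ := hs
  simp only [Set.mem_ofPred_eq] at he hw ⊢
  obtain ⟨⟨h1, h2⟩, ⟨h3, h4⟩, h5, h6⟩ := he
  obtain ⟨⟨g1, g2⟩, ⟨g3, g4⟩, g5, g6⟩ := hw
  fin_cases k <;> simp [dr] at * <;> refine ⟨⟨?_, ?_⟩, ⟨?_, ?_⟩, ?_, ?_⟩ <;> linarith

theorem IsHex.line {s : Set Pl} (hs : IsHex s) {e : Pl} (k : Fin 6) {r r' : ℝ}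
    (he : e ∈ s) (hw : e + r • dr k ∈ s) (h0 : 0 ≤ r') (h1 : r' ≤ r) : e + r' • dr k ∈ s := by
  have := hs.acute_hull (p := r) (q := 0) (p' := r') (q' := 0) k he (by simpa using hw) h0 h1
    le_rfl le_rfl
  simpa using this

/-- A hexagonal region contains the triangle of side `r` with corner `e` if it contains the corners. -/
theorem IsHex.convex_chamber {s : Set Pl} (hs : IsHex s) {e : Pl} (k : Fin 6) {r p q : ℝ}
    (he : e ∈ s) (hw : e + r • dr k ∈ s) (hw' : e + r • dr (k + 1) ∈ s)
    (hp : 0 ≤ p) (hq : 0 ≤ q) (hpq : p + q ≤ r) : e + p • dr k + q • dr (k + 1) ∈ s := by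
  obtain ⟨a, a', b, b', c, c', rfl⟩ := hs
  simp only [Set.mem_ofPred_eq] at he hw hw' ⊢
  obtain ⟨⟨h1, h2⟩, ⟨h3, h4⟩, h5, h6⟩ := he
  obtain ⟨⟨g1, g2⟩, ⟨g3, g4⟩, g5, g6⟩ := hw
  obtain ⟨⟨i1, i2⟩, ⟨i3, i4⟩, i5, i6⟩ := hw'
  fin_cases k <;> simp [dr] at * <;> refine ⟨⟨?_, ?_⟩, ⟨?_, ?_⟩, ?_, ?_⟩ <;> linarith

/-- Every vector is a nonnegative combination of two consecutive directions. -/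
theorem exists_chamber (z : Pl) : ∃ (k : Fin 6) (p q : ℝ), 0 ≤ p ∧ 0 ≤ q ∧
    z = p • dr k + q • dr (k + 1) := by
  obtain ⟨x, y⟩ := z
  rcases le_total 0 x with hx | hx <;> rcases le_total 0 y with hy | hy <;>
    rcases le_total 0 (x + y) with h | h
  · exact ⟨0, x, y, hx, hy, by ext <;> simp [dr]⟩
  · exact ⟨0, x, y, hx, hy, by ext <;> simp [dr]⟩
  · exact ⟨5, -y, x + y, by linarith, h, by ext <;> simp [dr]⟩
  · exact ⟨4, -(x + y), x, by linarith, hx, by ext <;> simp [dr]⟩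
  · exact ⟨1, x + y, -x, by linarith, by linarith, by ext <;> simp [dr]⟩
  · exact ⟨2, y, -(x + y), by linarith, by linarith, by ext <;> simp [dr]⟩
  · exact ⟨3, -x, -y, by linarith, by linarith, by ext <;> simp [dr]⟩
  · exact ⟨3, -x, -y, by linarith, by linarith, by ext <;> simp [dr]⟩

/-- The region `s` contains a short segment from `e` in the direction `dr k`. -/
def Sees (s : Set Pl) (e : Pl) (k : Fin 6) : Prop :=
  ∀ᶠ r in 𝓝[≥] (0 : ℝ), e + r • dr k ∈ s

theorem eventually_nhdsGE_zero {P : ℝ → Prop} :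
    (∀ᶠ r in 𝓝[≥] (0 : ℝ), P r) ↔ ∃ δ > 0, ∀ r, 0 ≤ r → r ≤ δ → P r := by
  rw [Filter.Eventually, mem_nhdsGE_iff_exists_Icc_subset]
  constructor
  · rintro ⟨u, hu, h⟩
    exact ⟨u, hu, fun r h0 h1 => h ⟨h0, h1⟩⟩
  · rintro ⟨u, hu, h⟩
    exact ⟨u, hu, fun r hr => h r hr.1 hr.2⟩

theorem Sees.mono {s t : Set Pl} {e : Pl} {k : Fin 6} (h : Sees s e k) (hst : s ⊆ t) :
    Sees t e k := by
  filter_upwards [h] with r hr using hst hr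

theorem IsHex.sees {s : Set Pl} (hs : IsHex s) {e : Pl} {k : Fin 6} (he : e ∈ s) {r : ℝ}
    (hr : 0 < r) (h : e + r • dr k ∈ s) : Sees s e k :=
  eventually_nhdsGE_zero.2 ⟨r, hr, fun _ h0 h1 => hs.line k he h h0 h1⟩

theorem Sees.exists_mem {s : Set Pl} {e : Pl} {k : Fin 6} (h : Sees s e k) :
    ∃ r : ℝ, 0 < r ∧ e + r • dr k ∈ s := by
  obtain ⟨δ, hδ, h⟩ := eventually_nhdsGE_zero.1 h
  exact ⟨δ, hδ, h δ hδ.le le_rfl⟩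

theorem sees_fr {s : Set Pl} {e : Pl} {k : Fin 6} {z : Pl} {j : Fin 6} :
    Sees (fr e k ⁻¹' s) z j ↔ Sees s (fr e k z) (k + j) := by
  simp only [Sees, Set.mem_preimage, fr_line]

theorem reflR_line (z : Pl) (r : ℝ) (j : Fin 6) :
    reflR (z + r • dr j) = reflR z + r • dr (-j) := by
  rw [← reflR_dr]
  ext <;> simp [reflR] <;> ring

theorem sees_reflR {s : Set Pl} {z : Pl} {j : Fin 6} :
    Sees (reflR ⁻¹' s) z j ↔ Sees s (reflR z) (-j) := by
  simp only [Sees, Set.mem_preimage, reflR_line]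

/-- Real induction on an interval: a property of points that spreads to the right of initial segments
and passes to their suprema holds everywhere. -/
theorem real_induction {ℓ : ℝ} {P : ℝ → Prop} (h0 : 0 ≤ ℓ → P 0)
    (hstep : ∀ r, 0 ≤ r → r < ℓ → (∀ r', 0 ≤ r' → r' ≤ r → P r') →
      ∃ δ > 0, ∀ r', r ≤ r' → r' ≤ r + δ → r' ≤ ℓ → P r')
    (hlim : ∀ r, 0 < r → r ≤ ℓ → (∀ r', 0 ≤ r' → r' < r → P r') → P r) :
    ∀ r, 0 ≤ r → r ≤ ℓ → P r := by
  intro r hr hrl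
  have hl : 0 ≤ ℓ := hr.trans hrl
  let S : Set ℝ := {x | 0 ≤ x ∧ x ≤ ℓ ∧ ∀ y, 0 ≤ y → y ≤ x → P y}
  have hS0 : (0 : ℝ) ∈ S := ⟨le_rfl, hl, fun y h1 h2 => by
    rw [le_antisymm h2 h1]; exact h0 hl⟩
  have hbdd : BddAbove S := ⟨ℓ, fun x hx => hx.2.1⟩
  have hc0 : 0 ≤ sSup S := le_csSup hbdd hS0
  have hcl : sSup S ≤ ℓ := csSup_le ⟨0, hS0⟩ fun x hx => hx.2.1
  have hlt : ∀ y, 0 ≤ y → y < sSup S → P y := by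
    intro y hy hy'
    obtain ⟨x, hx, hxy⟩ := exists_lt_of_lt_csSup ⟨0, hS0⟩ hy'
    exact hx.2.2 y hy hxy.le
  have hP : P (sSup S) := by
    rcases hc0.eq_or_lt with h | h
    · rw [← h]; exact h0 hl
    · exact hlim _ h hcl hlt
  have hle : ∀ y, 0 ≤ y → y ≤ sSup S → P y := by
    intro y hy hy'
    rcases hy'.eq_or_lt with h | h
    · rw [h]; exact hP
    · exact hlt y hy h
  rcases hcl.eq_or_lt with h | h
  · exact hle r hr (h ▸ hrl)
  · exfalso
    obtain ⟨δ, hδ, hd⟩ := hstep _ hc0 h hle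
    have hm : min (sSup S + δ) ℓ ∈ S := by
      refine ⟨le_min (by linarith) hl, min_le_right _ _, fun y hy hy' => ?_⟩
      rcases le_total y (sSup S) with h1 | h1
      · exact hle y hy h1
      · exact hd y h1 (hy'.trans (min_le_left _ _)) (hy'.trans (min_le_right _ _))
    have := le_csSup hbdd hm
    have : sSup S < min (sSup S + δ) ℓ := lt_min (by linarith) h
    linarith

/-! ### Atlases, darts and immersive charts -/

/-- Germs of parametrized half-lines in `X`, together with a parity. -/
abbrev Dart (X : Type) : Type := Bool × Filter.Germ (𝓝[≥] (0 : ℝ)) X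

/-- The dart of a curve of parity `τ` at its starting point. -/
def cdart {X : Type} (τ : Bool) (γ : ℝ → X) : Dart X := (τ, (γ : Filter.Germ (𝓝[≥] (0 : ℝ)) X))

/-- The dart of a chart `f` at the point `e` in the direction `dr k`. -/
def dart {X : Type} (τ : Bool) (f : Pl → X) (e : Pl) (k : Fin 6) : Dart X :=
  cdart (typ τ k) (fun r => f (e + r • dr k))

/-- A set `X` with charts defined on hexagonal regions of the plane. A chart is recorded as a
function on the whole plane of which only the values on its region matter; `τ` is the parity of the
direction `dr 0`. The last two fields express finite relatedness: the identifications that a chart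
makes between points of its region come from finitely many affine maps, and the locus where two
charts coincide is a finite union of hexagonal regions. -/
structure Atlas (X : Type) where
  Chart : Bool → Set Pl → (Pl → X) → Prop
  isHex : ∀ {τ s f}, Chart τ s f → IsHex s
  congr : ∀ {τ s f g}, Chart τ s f → (∀ z ∈ s, g z = f z) → Chart τ s g
  mono : ∀ {τ s t f}, Chart τ s f → IsHex t → t ⊆ s → Chart τ t f
  frame : ∀ {τ s f}, Chart τ s f → ∀ e k, Chart (typ τ k) (fr e k ⁻¹' s) (fun z => f (fr e k z))
  reflect : ∀ {τ s f}, Chart τ s f → Chart τ (reflR ⁻¹' s) (fun z => f (reflR z))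
  glue : ∀ {τ s f} {ι : Type} [Finite ι] (t : ι → Set Pl), IsHex s → (∀ z, z ∈ s ↔ ∃ i, z ∈ t i) →
    (∀ i, Chart τ (t i) f) → Chart τ s f
  point : ∀ x, Chart true {0} fun _ => x
  finRel : ∀ {τ s f}, Chart τ s f → ∃ K : Set (Pl →ᵃ[ℝ] Pl), K.Finite ∧
    ∀ z ∈ s, ∀ w ∈ s, f z = f w → ∃ k ∈ K, k z = w
  eqHex : ∀ {τ s f g}, Chart τ s f → Chart τ s g → ∃ T : Set (Set Pl), T.Finite ∧
    (∀ t ∈ T, IsHex t) ∧ ∀ z, (z ∈ s ∧ f z = g z) ↔ ∃ t ∈ T, z ∈ t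

variable {X : Type}

/-- Two darts are adjacent when they are the two edges of the germ of a chart on a chamber. -/
def Atlas.Adj (A : Atlas X) (u v : Dart X) : Prop :=
  ∃ τ s f, A.Chart τ s f ∧ 0 ∈ s ∧ Sees s 0 0 ∧ Sees s 0 1 ∧ u = dart τ f 0 0 ∧ v = dart τ f 0 1

/-- `u` is the dart of a chart at the point `x`. -/
def Atlas.IsDart (A : Atlas X) (x : X) (u : Dart X) : Prop :=
  ∃ τ s f, A.Chart τ s f ∧ 0 ∈ s ∧ Sees s 0 0 ∧ f 0 = x ∧ u = dart τ f 0 0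

/-- An immersive chart. In a bipartite graph of diameter three, a map preserves the distances
`2` and `3` of two darts of a hexagon when their images are distinct, respectively not adjacent. -/
def Atlas.Imm (A : Atlas X) (τ : Bool) (s : Set Pl) (f : Pl → X) : Prop :=
  A.Chart τ s f ∧ ∀ e ∈ s, ∀ k,
    (Sees s e k → Sees s e (k + 2) → dart τ f e k ≠ dart τ f e (k + 2)) ∧
    (Sees s e k → Sees s e (k + 3) → ¬ A.Adj (dart τ f e k) (dart τ f e (k + 3)))

/-- The segment of length `c` from the origin in the direction `dr 0`. -/
def hseg (c : ℝ) : Set Pl := {z | 0 ≤ z.1 ∧ z.1 ≤ c ∧ z.2 = 0}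

/-- The parallelogram with obtuse corner `e` and sides of lengths `a`, `b` in the directions `dr k`
and `dr (k + 2)`. -/
def par (e : Pl) (k : Fin 6) (a b : ℝ) : Set Pl :=
  {z | ∃ p q, (0 ≤ p ∧ p ≤ a) ∧ (0 ≤ q ∧ q ≤ b) ∧ z = e + p • dr k + q • dr (k + 2)}

/-- An immersive curve of length `c` and parity `τ`. -/
def Atlas.ISeg (A : Atlas X) (τ : Bool) (c : ℝ) (γ : ℝ → X) : Prop :=
  A.Imm τ (hseg c) (fun z => γ z.1)

/-- The local conditions on darts, that is, the axioms of a spherical building, and the two extension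
conditions for immersive curves, on an atlas. Two darts of equal parity have distance at least `2` if
and only if they are distinct, and two darts of opposite parity have distance `3` if and only if they
are not adjacent. -/
structure Atlas.IsBuilding (A : Atlas X) : Prop where
  exists_dart : ∀ x, ∃ u, A.IsDart x u
  noDouble : ∀ {τ s f g}, A.Chart τ s f → A.Chart τ s g → 0 ∈ s → Sees s 0 0 → Sees s 0 1 →
    dart τ f 0 0 = dart τ g 0 0 → dart τ f 0 1 = dart τ g 0 1 →
    ∃ δ > 0, ∀ p q : ℝ, 0 ≤ p → p ≤ δ → 0 ≤ q → q ≤ δ → f (p, q) = g (p, q)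
  noSquare : ∀ {u v v' w}, A.Adj u v → A.Adj v w → A.Adj u v' → A.Adj v' w → u = w ∨ v = v'
  hexagon : ∀ {x u v}, A.IsDart x u → A.IsDart x v → ∃ c : Fin 6 → Dart X, Function.Injective c ∧
    (∀ k, A.Adj (c k) (c (k + 1))) ∧ ∃ i j, c i = u ∧ c j = v
  exSeg : ∀ {τ t t' γ u}, 0 < t → t < t' → A.ISeg τ t γ → A.IsDart (γ t) u → u.1 = τ →
    ¬ A.Adj (cdart (!τ) fun r => γ (t - r)) u →
    ∃ γ', A.ISeg τ t' γ' ∧ (∀ r, 0 ≤ r → r ≤ t → γ' r = γ r) ∧ cdart τ (fun r => γ' (t + r)) = u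
  exObt : ∀ {τ a b γ₁ γ₂}, 0 < a → 0 < b → A.ISeg τ a γ₁ → A.ISeg τ b γ₂ → γ₁ 0 = γ₂ 0 →
    cdart τ γ₁ ≠ cdart τ γ₂ → ∃ h, A.Imm τ (par 0 0 a b) h ∧
      (∀ r, 0 ≤ r → r ≤ a → h (r, 0) = γ₁ r) ∧ ∀ r, 0 ≤ r → r ≤ b → h (-r, r) = γ₂ r

theorem cdart_eq_iff {τ τ' : Bool} {γ γ' : ℝ → X} : cdart τ γ = cdart τ' γ' ↔
    τ = τ' ∧ ∃ δ > 0, ∀ r, 0 ≤ r → r ≤ δ → γ r = γ' r := by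
  rw [cdart, cdart, Prod.mk.injEq, Filter.Germ.coe_eq, Filter.EventuallyEq,
    eventually_nhdsGE_zero]

theorem cdart_congr {τ : Bool} {γ γ' : ℝ → X} (δ : ℝ) (hδ : 0 < δ)
    (h : ∀ r, 0 ≤ r → r ≤ δ → γ r = γ' r) : cdart τ γ = cdart τ γ' :=
  cdart_eq_iff.2 ⟨rfl, δ, hδ, h⟩

theorem cdart_apply_zero {τ τ' : Bool} {γ γ' : ℝ → X} (h : cdart τ γ = cdart τ' γ') :
    γ 0 = γ' 0 := by
  obtain ⟨-, δ, hδ, h⟩ := cdart_eq_iff.1 h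
  exact h 0 le_rfl hδ.le

theorem dart_eq_iff {τ : Bool} {f g : Pl → X} {e : Pl} {k : Fin 6} :
    dart τ f e k = dart τ g e k ↔ ∀ᶠ r in 𝓝[≥] (0 : ℝ), f (e + r • dr k) = g (e + r • dr k) := by
  rw [dart, dart, cdart, cdart, Prod.mk.injEq, Filter.Germ.coe_eq, Filter.EventuallyEq]
  simp

theorem dart_congr {τ : Bool} {f g : Pl → X} {s : Set Pl} {e : Pl} {k : Fin 6} (hs : Sees s e k)
    (h : ∀ z ∈ s, f z = g z) : dart τ f e k = dart τ g e k := by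
  rw [dart_eq_iff]
  filter_upwards [hs] with r hr using h _ hr

theorem dart_fr {τ : Bool} {f : Pl → X} {e : Pl} {k : Fin 6} {z : Pl} {j : Fin 6} :
    dart (typ τ k) (fun z => f (fr e k z)) z j = dart τ f (fr e k z) (k + j) := by
  simp only [dart, typ_typ, fr_line]

theorem dart_reflR {τ : Bool} {f : Pl → X} {z : Pl} {j : Fin 6} :
    dart τ (fun z => f (reflR z)) z j = dart τ f (reflR z) (-j) := by
  simp only [dart, typ_neg, reflR_line]

variable {A : Atlas X}

theorem Atlas.Adj.symm {u v : Dart X} (h : A.Adj u v) : A.Adj v u := by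
  obtain ⟨τ, s, f, hf, h0, h1, h2, rfl, rfl⟩ := h
  refine ⟨_, _, _, A.reflect (A.frame hf 0 1), ?_, ?_, ?_, ?_, ?_⟩
  · simpa [reflR, fr] using h0
  · rw [sees_reflR, sees_fr]; simpa [reflR, fr] using h2
  · rw [sees_reflR, sees_fr]; simpa [reflR, fr] using h1
  · rw [dart_reflR (f := fun z => f (fr 0 1 z)), dart_fr]; simp [reflR, fr]
  · rw [dart_reflR (f := fun z => f (fr 0 1 z)), dart_fr]; simp [reflR, fr]

theorem Atlas.Adj.type {u v : Dart X} (h : A.Adj u v) : v.1 = !u.1 := by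
  obtain ⟨τ, s, f, hf, h0, h1, h2, rfl, rfl⟩ := h
  rfl

theorem Atlas.adj_of_chart {τ : Bool} {s : Set Pl} {f : Pl → X} (hf : A.Chart τ s f) {e : Pl}
    (he : e ∈ s) {k : Fin 6} (h1 : Sees s e k) (h2 : Sees s e (k + 1)) :
    A.Adj (dart τ f e k) (dart τ f e (k + 1)) := by
  refine ⟨_, _, _, A.frame hf e k, ?_, ?_, ?_, ?_, ?_⟩
  · simpa [fr] using he
  · rw [sees_fr]; simpa [fr_zero] using h1
  · rw [sees_fr]; simpa [fr_zero] using h2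
  · rw [dart_fr, fr_zero, add_zero]
  · rw [dart_fr, fr_zero]

theorem Atlas.isDart_of_chart {τ : Bool} {s : Set Pl} {f : Pl → X} (hf : A.Chart τ s f) {e : Pl}
    (he : e ∈ s) {k : Fin 6} (h1 : Sees s e k) : A.IsDart (f e) (dart τ f e k) := by
  refine ⟨_, _, _, A.frame hf e k, ?_, ?_, ?_, ?_⟩
  · simpa [fr] using he
  · rw [sees_fr]; simpa [fr_zero] using h1
  · simp [fr_zero]
  · rw [dart_fr, fr_zero, add_zero]

theorem Atlas.Imm.mono {τ : Bool} {s t : Set Pl} {f : Pl → X} (hf : A.Imm τ s f) (ht : IsHex t)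
    (hts : t ⊆ s) : A.Imm τ t f :=
  ⟨A.mono hf.1 ht hts, fun e he k =>
    ⟨fun h1 h2 => (hf.2 e (hts he) k).1 (h1.mono hts) (h2.mono hts),
      fun h1 h2 => (hf.2 e (hts he) k).2 (h1.mono hts) (h2.mono hts)⟩⟩

theorem Atlas.Imm.congr {τ : Bool} {s : Set Pl} {f g : Pl → X} (hf : A.Imm τ s f)
    (h : ∀ z ∈ s, g z = f z) : A.Imm τ s g := by
  refine ⟨A.congr hf.1 h, fun e he k => ⟨fun h1 h2 => ?_, fun h1 h2 => ?_⟩⟩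
  · rw [dart_congr h1 h, dart_congr h2 h]
    exact (hf.2 e he k).1 h1 h2
  · rw [dart_congr h1 h, dart_congr h2 h]
    exact (hf.2 e he k).2 h1 h2

theorem Atlas.Imm.frame {τ : Bool} {s : Set Pl} {f : Pl → X} (hf : A.Imm τ s f) (e : Pl)
    (k : Fin 6) : A.Imm (typ τ k) (fr e k ⁻¹' s) (fun z => f (fr e k z)) := by
  refine ⟨A.frame hf.1 e k, fun z hz j => ?_⟩
  simp only [sees_fr, dart_fr, ← add_assoc]
  exact hf.2 _ hz (k + j)

theorem Atlas.Imm.reflect {τ : Bool} {s : Set Pl} {f : Pl → X} (hf : A.Imm τ s f) :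
    A.Imm τ (reflR ⁻¹' s) (fun z => f (reflR z)) := by
  refine ⟨A.reflect hf.1, fun z hz j => ?_⟩
  have e2 : -(j + 2) + 2 = -j := by revert j; decide
  have e3 : -(j + 3) + 3 = -j := by revert j; decide
  simp only [sees_reflR, dart_reflR]
  refine ⟨fun h1 h2 h => ?_, fun h1 h2 h => ?_⟩
  · have := (hf.2 _ hz (-(j + 2))).1 h2
    rw [e2] at this
    exact this h1 h.symm
  · have := (hf.2 _ hz (-(j + 3))).2 h2
    rw [e3] at this
    exact this h1 h.symm

theorem Atlas.Imm.isHex {τ : Bool} {s : Set Pl} {f : Pl → X} (hf : A.Imm τ s f) : IsHex s :=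
  A.isHex hf.1

/-- There are no cycles of length four. -/
theorem Atlas.IsBuilding.unique_mid (hA : A.IsBuilding) {u v v' w : Dart X} (h1 : A.Adj u v)
    (h2 : A.Adj v w) (h3 : A.Adj u v') (h4 : A.Adj v' w) (h : u ≠ w) : v = v' :=
  (hA.noSquare h1 h2 h3 h4).resolve_left h

/-- Charts whose darts at `e` agree on the two edges of a chamber coincide on this chamber near `e`. -/
theorem Atlas.IsBuilding.agree_chamber (hA : A.IsBuilding) {τ : Bool} {s : Set Pl} {f g : Pl → X}
    (hf : A.Chart τ s f) (hg : A.Chart τ s g) {e : Pl} (he : e ∈ s) {k : Fin 6}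
    (h1 : Sees s e k) (h2 : Sees s e (k + 1)) (d1 : dart τ f e k = dart τ g e k)
    (d2 : dart τ f e (k + 1) = dart τ g e (k + 1)) :
    ∃ δ > 0, ∀ p q : ℝ, 0 ≤ p → p ≤ δ → 0 ≤ q → q ≤ δ →
      f (e + p • dr k + q • dr (k + 1)) = g (e + p • dr k + q • dr (k + 1)) := by
  refine hA.noDouble (A.frame hf e k) (A.frame hg e k) ?_ ?_ ?_ ?_ ?_
  · simpa [fr] using he
  · rw [sees_fr]; simpa [fr_zero] using h1
  · rw [sees_fr]; simpa [fr_zero] using h2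
  · rw [dart_fr, dart_fr, fr_zero, add_zero, d1]
  · rw [dart_fr, dart_fr, fr_zero, d2]

/-- Immersive charts which agree in two directions at an angle of `120°` agree in the direction
between them, since `F_x` has no cycles of length four. -/
theorem Atlas.IsBuilding.agree_mid (hA : A.IsBuilding) {τ : Bool} {s : Set Pl} {f g : Pl → X}
    (hf : A.Imm τ s f) (hg : A.Chart τ s g) {e : Pl} (he : e ∈ s) {k : Fin 6}
    (h1 : Sees s e k) (h2 : Sees s e (k + 1)) (h3 : Sees s e (k + 2))
    (d1 : dart τ f e k = dart τ g e k) (d3 : dart τ f e (k + 2) = dart τ g e (k + 2)) :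
    dart τ f e (k + 1) = dart τ g e (k + 1) := by
  have e2 : k + 1 + 1 = k + 2 := by rw [add_assoc]; rfl
  have a1 := A.adj_of_chart hf.1 he h1 h2
  have a2 := A.adj_of_chart hf.1 he h2 (e2 ▸ h3)
  have b1 := A.adj_of_chart hg he h1 h2
  have b2 := A.adj_of_chart hg he h2 (e2 ▸ h3)
  rw [e2] at a2 b2
  exact hA.unique_mid a1 a2 (d1 ▸ b1) (d3 ▸ b2) ((hf.2 e he k).1 h1 h3)

/-! ### Immersive curves -/

theorem isHex_hseg (c : ℝ) : IsHex (hseg c) := by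
  refine ⟨0, c, 0, 0, 0, c, ?_⟩
  ext z
  simp only [hseg, Set.mem_ofPred_eq]
  constructor
  · rintro ⟨h1, h2, h3⟩; refine ⟨⟨?_, ?_⟩, ⟨?_, ?_⟩, ?_, ?_⟩ <;> linarith
  · rintro ⟨⟨h1, h2⟩, ⟨h3, h4⟩, h5, h6⟩; refine ⟨?_, ?_, ?_⟩ <;> linarith

theorem mem_hseg {c r : ℝ} : ((r, 0) : Pl) ∈ hseg c ↔ 0 ≤ r ∧ r ≤ c := by simp [hseg]

theorem fr_smul_zero (e : Pl) (k : Fin 6) (r : ℝ) : fr e k (r, 0) = e + r • dr k := by simp [fr]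

/-- The inverse of `fr e k` is again of the same form. -/
theorem exists_fr_inv (e : Pl) (k : Fin 6) : ∃ e', (∀ z, fr e k (fr e' (-k) z) = z) ∧
    ∀ z, fr e' (-k) (fr e k z) = z := by
  refine ⟨fr 0 (-k) (-e), fun z => ?_, fun z => ?_⟩ <;>
  fin_cases k <;> (ext <;> simp [fr, dr, show (-1 : Fin 6) = 5 from rfl, show (-2 : Fin 6) = 4 from rfl, show (-3 : Fin 6) = 3 from rfl, show (-4 : Fin 6) = 2 from rfl, show (-5 : Fin 6) = 1 from rfl]) <;> ring

theorem Atlas.Imm.curve {τ : Bool} {s : Set Pl} {f : Pl → X} (hf : A.Imm τ s f) {e : Pl}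
    {k : Fin 6} {c : ℝ} (he : e ∈ s) (hc : e + c • dr k ∈ s) :
    A.ISeg (typ τ k) c (fun r => f (e + r • dr k)) := by
  refine ((hf.frame e k).mono (isHex_hseg c) ?_).congr ?_
  · rintro z ⟨h1, h2, h3⟩
    have : z = (z.1, 0) := by rw [← h3]
    rw [Set.mem_preimage, this, fr_smul_zero]
    exact hf.isHex.line k he hc h1 h2
  · rintro z ⟨h1, h2, h3⟩
    have : z = (z.1, 0) := by rw [← h3]
    rw [this, fr_smul_zero]

theorem Atlas.Imm.of_frame {τ : Bool} {s : Set Pl} {f : Pl → X} {e : Pl} {k : Fin 6}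
    (hf : A.Imm (typ τ k) (fr e k ⁻¹' s) (fun z => f (fr e k z))) : A.Imm τ s f := by
  obtain ⟨e', h1, h2⟩ := exists_fr_inv e k
  have := hf.frame e' (-k)
  rw [typ_typ, add_neg_cancel, typ_zero, ← Set.preimage_comp] at this
  simpa only [Function.comp_def, h1, Set.preimage_id'] using this

theorem sees_hseg {c : ℝ} {e : Pl} {k : Fin 6} (he : e ∈ hseg c) (h : Sees (hseg c) e k) :
    (k = 0 ∧ e.1 < c) ∨ (k = 3 ∧ 0 < e.1) := by
  obtain ⟨r, hr, h1, h2, h3⟩ := h.exists_mem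
  obtain ⟨g1, g2, g3⟩ := he
  fin_cases k <;> simp [dr] at h1 h2 h3 ⊢ <;> linarith

theorem sees_hseg_zero {c : ℝ} {r : ℝ} (h0 : 0 ≤ r) (h1 : r < c) : Sees (hseg c) (r, 0) 0 := by
  refine (isHex_hseg c).sees (r := c - r) (mem_hseg.2 ⟨h0, h1.le⟩) (by linarith) ?_
  simp only [dr_zero, hseg, Set.mem_ofPred_eq]
  simp; linarith

theorem sees_hseg_three {c : ℝ} {r : ℝ} (h0 : 0 < r) (h1 : r ≤ c) : Sees (hseg c) (r, 0) 3 := by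
  refine (isHex_hseg c).sees (r := r) (mem_hseg.2 ⟨h0.le, h1⟩) (by linarith) ?_
  simp only [dr_three, hseg, Set.mem_ofPred_eq]
  simp; linarith

/-- A chart on a segment is immersive if it is straight at the interior points. -/
theorem Atlas.ISeg.of_chart {τ : Bool} {c : ℝ} {γ : ℝ → X}
    (hγ : A.Chart τ (hseg c) (fun z => γ z.1))
    (h : ∀ r, 0 < r → r < c → ¬ A.Adj (cdart τ fun t => γ (r + t)) (cdart (!τ) fun t => γ (r - t))) :
    A.ISeg τ c γ := by
  have key : ∀ e : Pl, 0 < e.1 → e.1 < c → ¬ A.Adj (dart τ (fun z => γ z.1) e 0)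
      (dart τ (fun z => γ z.1) e 3) := by
    intro e h1 h2
    simpa [dart, dr_zero, dr_three, typ, ← sub_eq_add_neg] using h e.1 h1 h2
  refine ⟨hγ, fun e he k => ⟨fun h1 h2 => ?_, fun h1 h2 => ?_⟩⟩
  · rcases sees_hseg he h1 with ⟨rfl, -⟩ | ⟨rfl, -⟩ <;>
    rcases sees_hseg he h2 with ⟨h3, -⟩ | ⟨h3, -⟩ <;> exact absurd h3 (by decide)
  · rcases sees_hseg he h1 with ⟨rfl, h4⟩ | ⟨rfl, h4⟩ <;>
    rcases sees_hseg he h2 with ⟨h3, h5⟩ | ⟨h3, h5⟩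
    · exact absurd h3 (by decide)
    · exact key e h5 h4
    · exact fun hh => key e h4 h5 hh.symm
    · exact absurd h3 (by decide)

theorem Atlas.ISeg.congr {τ : Bool} {c : ℝ} {γ γ' : ℝ → X} (hγ : A.ISeg τ c γ)
    (h : ∀ r, 0 ≤ r → r ≤ c → γ' r = γ r) : A.ISeg τ c γ' :=
  Atlas.Imm.congr hγ fun _ hz => h _ hz.1 hz.2.1

theorem Atlas.ISeg.sub {τ : Bool} {c : ℝ} {γ : ℝ → X} (hγ : A.ISeg τ c γ) {a b : ℝ} (ha : 0 ≤ a)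
    (hb : 0 ≤ b) (hab : a + b ≤ c) : A.ISeg τ b (fun r => γ (a + r)) := by
  have := Atlas.Imm.curve (e := (a, 0)) (k := 0) (c := b) hγ (mem_hseg.2 ⟨ha, by linarith⟩)
    (by simpa [dr_zero, hseg] using ⟨by linarith, hab⟩)
  exact this.congr fun r _ _ => by simp [dr_zero]

theorem Atlas.ISeg.take {τ : Bool} {c : ℝ} {γ : ℝ → X} (hγ : A.ISeg τ c γ) {b : ℝ}
    (hb : 0 ≤ b) (hbc : b ≤ c) : A.ISeg τ b γ :=
  (hγ.sub le_rfl hb (by linarith)).congr fun r _ _ => by rw [zero_add]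

theorem Atlas.ISeg.rev {τ : Bool} {c : ℝ} {γ : ℝ → X} (hγ : A.ISeg τ c γ) (hc : 0 ≤ c) :
    A.ISeg (!τ) c (fun r => γ (c - r)) := by
  have := Atlas.Imm.curve (e := (c, 0)) (k := 3) (c := c) hγ (mem_hseg.2 ⟨hc, le_rfl⟩)
    (by simpa [dr_three, hseg] using hc)
  exact Atlas.ISeg.congr (τ := !τ) this fun r _ _ => by simp [dr_three, sub_eq_add_neg]

theorem Atlas.ISeg.straight {τ : Bool} {c : ℝ} {γ : ℝ → X} (hγ : A.ISeg τ c γ) {r : ℝ}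
    (h0 : 0 < r) (h1 : r < c) :
    ¬ A.Adj (cdart τ fun t => γ (r + t)) (cdart (!τ) fun t => γ (r - t)) := by
  have := (hγ.2 (r, 0) (mem_hseg.2 ⟨h0.le, h1.le⟩) 0).2 (sees_hseg_zero h0.le h1)
    (sees_hseg_three h0 h1.le)
  simpa [dart, dr_zero, dr_three, typ, ← sub_eq_add_neg] using this

theorem Atlas.ISeg.isDart {τ : Bool} {c : ℝ} {γ : ℝ → X} (hγ : A.ISeg τ c γ) (hc : 0 < c) :
    A.IsDart (γ 0) (cdart τ γ) := by
  have := A.isDart_of_chart hγ.1 (e := (0, 0)) (mem_hseg.2 ⟨le_rfl, hc.le⟩) (k := 0)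
    (sees_hseg_zero le_rfl hc)
  simpa [dart, dr_zero, typ] using this

theorem chart_curve {τ : Bool} {s : Set Pl} {f : Pl → X} (hf : A.Chart τ s f) {e : Pl}
    {k : Fin 6} {c : ℝ} (he : e ∈ s) (hc : e + c • dr k ∈ s) :
    A.Chart (typ τ k) (hseg c) (fun z => f (e + z.1 • dr k)) := by
  refine A.congr (A.mono (A.frame hf e k) (isHex_hseg c) ?_) ?_
  · rintro z ⟨h1, h2, h3⟩
    have : z = (z.1, 0) := by rw [← h3]
    rw [Set.mem_preimage, this, fr_smul_zero]
    exact (A.isHex hf).line k he hc h1 h2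
  · rintro z ⟨h1, h2, h3⟩
    have : z = (z.1, 0) := by rw [← h3]
    rw [this, fr_smul_zero]

/-- Charts on overlapping or abutting segments glue. -/
theorem chart_glue_curve {τ : Bool} {c a b : ℝ} {γ : ℝ → X} (ha : 0 ≤ a) (hab : a ≤ b) (hb : b ≤ c)
    (h1 : A.Chart τ (hseg b) fun z => γ z.1)
    (h2 : A.Chart τ (hseg (c - a)) fun z => γ (a + z.1)) : A.Chart τ (hseg c) fun z => γ z.1 := by
  have h3 : A.Chart τ {z | a ≤ z.1 ∧ z.1 ≤ c ∧ z.2 = 0} fun z => γ z.1 := by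
    have := A.frame h2 (-a, 0) 0
    rw [typ_zero] at this
    refine A.congr (A.mono this ?_ ?_) ?_
    · refine ⟨a, c, 0, 0, a, c, ?_⟩
      ext z
      simp only [Set.mem_ofPred_eq]
      constructor
      · rintro ⟨h1, h2, h3⟩; refine ⟨⟨?_, ?_⟩, ⟨?_, ?_⟩, ?_, ?_⟩ <;> linarith
      · rintro ⟨⟨h1, h2⟩, ⟨h3, h4⟩, h5, h6⟩; refine ⟨?_, ?_, ?_⟩ <;> linarith
    · rintro z ⟨h1, h2, h3⟩
      simp only [Set.mem_preimage, fr_std, hseg, Set.mem_ofPred_eq]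
      simp; refine ⟨?_, ?_, ?_⟩ <;> linarith
    · rintro _ -
      simp [fr_std]
  refine A.glue (ι := Bool) (fun i => if i then hseg b else {z | a ≤ z.1 ∧ z.1 ≤ c ∧ z.2 = 0})
    (isHex_hseg c) ?_ ?_
  · intro z
    simp only [Bool.exists_bool, if_true, Bool.false_eq_true, if_false]
    simp only [hseg, Set.mem_ofPred_eq]
    constructor
    · rintro ⟨g1, g2, g3⟩
      rcases le_total a z.1 with h | h
      · exact Or.inl ⟨h, g2, g3⟩
      · exact Or.inr ⟨g1, by linarith, g3⟩
    · rintro (⟨g1, g2, g3⟩ | ⟨g1, g2, g3⟩)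
      · exact ⟨by linarith, g2, g3⟩
      · exact ⟨g1, by linarith, g3⟩
  · rintro (_ | _)
    · exact h3
    · exact h1

/-- Immersive curves overlapping in a segment of positive length glue. -/
theorem Atlas.ISeg.glue {τ : Bool} {c a b : ℝ} {γ : ℝ → X} (ha : 0 ≤ a) (hab : a < b) (hb : b ≤ c)
    (h1 : A.ISeg τ b γ) (h2 : A.ISeg τ (c - a) fun r => γ (a + r)) : A.ISeg τ c γ := by
  refine Atlas.ISeg.of_chart (chart_glue_curve ha hab.le hb h1.1 h2.1) fun r hr hrc => ?_
  rcases lt_or_ge r b with h | h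
  · exact h1.straight hr h
  · have := h2.straight (r := r - a) (by linarith) (by linarith)
    simpa only [← add_assoc, add_sub_cancel, ← add_sub_assoc] using this

/-- A curve is immersive if it is so on both sides of a point where it is straight. -/
theorem Atlas.ISeg.concat {τ : Bool} {a b : ℝ} {γ : ℝ → X} (ha : 0 < a) (hb : 0 < b)
    (h1 : A.ISeg τ a γ) (h2 : A.ISeg τ b fun r => γ (a + r))
    (h : ¬ A.Adj (cdart τ fun t => γ (a + t)) (cdart (!τ) fun t => γ (a - t))) :
    A.ISeg τ (a + b) γ := by
  refine Atlas.ISeg.of_chart (chart_glue_curve ha.le le_rfl (by linarith) h1.1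
    (by simpa using h2.1)) fun r hr hrc => ?_
  rcases lt_trichotomy r a with h' | h' | h'
  · exact h1.straight hr h'
  · rw [h']; exact h
  · have := h2.straight (r := r - a) (by linarith) (by linarith)
    simpa only [← add_assoc, add_sub_cancel, ← add_sub_assoc] using this

theorem par_frame (e : Pl) (k : Fin 6) (a b : ℝ) : fr e k ⁻¹' (par e k a b) = par 0 0 a b := by
  obtain ⟨e', h1, h2⟩ := exists_fr_inv e k
  have h : ∀ p q : ℝ, fr e k (0 + p • dr 0 + q • dr (0 + 2)) = e + p • dr k + q • dr (k + 2) := by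
    intro p q
    rw [fr_line, fr_line, fr_zero, add_zero, zero_add]
  ext z
  constructor
  · rintro ⟨p, q, hp, hq, hz⟩
    refine ⟨p, q, hp, hq, ?_⟩
    rw [← h2 z, hz, ← h, h2]
  · rintro ⟨p, q, hp, hq, rfl⟩
    exact ⟨p, q, hp, hq, h p q⟩

theorem isHex_par (e : Pl) (k : Fin 6) (a b : ℝ) : IsHex (par e k a b) := by
  have h0 : IsHex (par 0 0 a b) := by
    refine ⟨-b, a, 0, b, 0, a, ?_⟩
    ext z
    simp only [par, Set.mem_ofPred_eq]
    constructor
    · rintro ⟨p, q, ⟨h1, h2⟩, ⟨h3, h4⟩, rfl⟩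
      simp [dr_zero, dr_two]
      refine ⟨⟨?_, ?_⟩, ⟨?_, ?_⟩, ?_, ?_⟩ <;> linarith
    · rintro ⟨⟨h1, h2⟩, ⟨h3, h4⟩, h5, h6⟩
      refine ⟨z.1 + z.2, z.2, ⟨h5, h6⟩, ⟨h3, h4⟩, ?_⟩
      ext <;> simp [dr_zero, dr_two]
  obtain ⟨e', h1, h2⟩ := exists_fr_inv e k
  have := h0.fr_preimage e' (-k)
  rw [← par_frame e k a b, ← Set.preimage_comp] at this
  simpa only [Function.comp_def, h1, Set.preimage_id'] using this

/-- The extension condition for obtuse corners, at an arbitrary place of the plane. -/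
theorem Atlas.IsBuilding.exists_par (hA : A.IsBuilding) {τ : Bool} (e : Pl) (k : Fin 6) {a b : ℝ}
    {γ₁ γ₂ : ℝ → X} (ha : 0 < a) (hb : 0 < b) (h1 : A.ISeg (typ τ k) a γ₁)
    (h2 : A.ISeg (typ τ k) b γ₂) (h0 : γ₁ 0 = γ₂ 0)
    (hne : cdart (typ τ k) γ₁ ≠ cdart (typ τ k) γ₂) :
    ∃ h, A.Imm τ (par e k a b) h ∧ (∀ r, 0 ≤ r → r ≤ a → h (e + r • dr k) = γ₁ r) ∧
      ∀ r, 0 ≤ r → r ≤ b → h (e + r • dr (k + 2)) = γ₂ r := by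
  obtain ⟨h, hh, g1, g2⟩ := hA.exObt ha hb h1 h2 h0 hne
  obtain ⟨e', i1, i2⟩ := exists_fr_inv e k
  have j : ∀ (z : ℝ) (j : Fin 6), fr e' (-k) (e + z • dr (k + j)) = z • dr j := by
    intro z j
    rw [← i2 (z • dr j)]
    congr 1
    have := fr_line e k 0 z j
    rw [zero_add, fr_zero] at this
    exact this.symm
  refine ⟨fun z => h (fr e' (-k) z), Atlas.Imm.of_frame (e := e) (k := k) ?_, ?_, ?_⟩
  · rw [par_frame]
    simpa only [i2] using hh
  · intro r hr hra
    have := j r 0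
    rw [add_zero] at this
    simp only [this, ← g1 r hr hra]
    simp [dr_zero]
  · intro r hr hra
    simp only [j, ← g2 r hr hra]
    simp [dr_two]

/-! ### Directions at a point and extension of curves -/

theorem Atlas.IsDart.of_adj {x : X} {u v : Dart X} (hu : A.IsDart x u) (h : A.Adj u v) :
    A.IsDart x v := by
  obtain ⟨τ, s, f, hf, h0, h1, h2, rfl, rfl⟩ := h
  obtain ⟨τ', s', f', hf', h0', h1', rfl, h⟩ := hu
  have := A.isDart_of_chart hf h0 h2
  have e := cdart_apply_zero h
  simp only [zero_smul, add_zero] at e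
  rwa [e] at this

/-- The hexagon through two darts, numbered from the first one; opposite darts of a hexagon are not
adjacent, since there are no cycles of length four. -/
theorem Atlas.IsBuilding.hexagon' (hA : A.IsBuilding) {x : X} {u v : Dart X} (hu : A.IsDart x u)
    (hv : A.IsDart x v) : ∃ c : Fin 6 → Dart X, Function.Injective c ∧
      (∀ k, A.Adj (c k) (c (k + 1))) ∧ (∀ k, A.IsDart x (c k)) ∧
      (∀ k, ¬ A.Adj (c k) (c (k + 3))) ∧ (∀ k, (c k).1 = typ u.1 k) ∧ c 0 = u ∧ ∃ j, c j = v := by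
  obtain ⟨c, hc, hadj, i, j, hi, hj⟩ := hA.hexagon hu hv
  have h0 : ∀ n : ℕ, A.IsDart x (c (i + (Fin.ofNat 6 n))) ∧
      (c (i + (Fin.ofNat 6 n))).1 = typ u.1 (Fin.ofNat 6 n) := by
    intro n
    induction n with
    | zero => exact ⟨by simpa [hi] using hu, by simp [hi, typ]⟩
    | succ n ih =>
      have e : Fin.ofNat 6 (n + 1) = Fin.ofNat 6 n + 1 := by
        ext; simp [Fin.ofNat, Fin.val_add]
      have := hadj (i + Fin.ofNat 6 n)
      rw [add_assoc] at this
      rw [e]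
      exact ⟨ih.1.of_adj this, by rw [this.type, ih.2, typ_succ]⟩
  have h1 : ∀ k : Fin 6, Fin.ofNat 6 k.val = k := by decide
  refine ⟨fun k => c (i + k), fun a b h => by simpa using hc h, fun k => ?_, fun k => ?_,
    fun k h => ?_, fun k => ?_, by simpa using hi, j - i, by simpa using hj⟩
  · have := hadj (i + k)
    rwa [add_assoc] at this
  · have := (h0 k.val).1
    rwa [h1] at this
  · have a1 := hadj (i + k)
    have a2 := hadj (i + k + 1)
    have a3 := hadj (i + k + 2)
    rw [add_assoc _ 1 1, show (1 : Fin 6) + 1 = 2 from rfl] at a2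
    rw [add_assoc _ 2 1, show (2 : Fin 6) + 1 = 3 from rfl] at a3
    simp only [← add_assoc] at h
    rcases hA.noSquare a1 a2 h a3.symm with h' | h'
    · have := hc h'
      simp at this
    · have := hc h'
      simp at this
  · have := (h0 k.val).2
    rwa [h1] at this

theorem Atlas.IsBuilding.exists_opposite (hA : A.IsBuilding) {x : X} {u : Dart X}
    (hu : A.IsDart x u) : ∃ v, A.IsDart x v ∧ v.1 = (!u.1) ∧ ¬ A.Adj u v := by
  obtain ⟨c, -, -, h1, h2, h3, h4, -⟩ := hA.hexagon' hu hu
  exact ⟨c 3, h1 3, h3 3, h4 ▸ h2 0⟩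

theorem Atlas.IsBuilding.exists_adj_ne (hA : A.IsBuilding) {x : X} {u v : Dart X}
    (hu : A.IsDart x u) : ∃ t, A.Adj u t ∧ t ≠ v := by
  obtain ⟨c, hc, h0, -, -, -, h4, -⟩ := hA.hexagon' hu hu
  by_cases h : c 1 = v
  · refine ⟨c 5, h4 ▸ (h0 5).symm, fun h' => ?_⟩
    exact absurd (hc (h.trans h'.symm)) (by decide)
  · exact ⟨c 1, h4 ▸ h0 0, h⟩

/-- If finitely many affine maps together send the points of a segment from `p` to the
corresponding points of another one, then a single one of them does. -/
theorem exists_affine_of_segment {K : Set (Pl →ᵃ[ℝ] Pl)} (hK : K.Finite) {p v w : Pl} {η : ℝ}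
    (hη : 0 < η) (h : ∀ t, 0 ≤ t → t ≤ η → ∃ k ∈ K, k (p + t • v) = p + t • w) :
    ∃ k ∈ K, k p = p ∧ k.linear v = w := by
  have h' : ∀ t : ℝ, ∃ k, t ∈ Set.Icc 0 η → k ∈ K ∧ k (p + t • v) = p + t • w := by
    intro t
    by_cases ht : t ∈ Set.Icc 0 η
    · obtain ⟨k, h1, h2⟩ := h t ht.1 ht.2
      exact ⟨k, fun _ => ⟨h1, h2⟩⟩
    · exact ⟨AffineMap.id ℝ Pl, fun h => absurd h ht⟩
  choose k hk using h'
  obtain ⟨a, ha, b, hb, hab, hkab⟩ := (Set.Icc_infinite hη).exists_ne_map_eq_of_mapsTo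
    (fun t ht => (hk t ht).1) hK
  have e : ∀ t : ℝ, k a (p + t • v) = t • (k a).linear v + k a p := by
    intro t
    have := (k a).map_vadd p (t • v)
    simpa [add_comm] using this
  have ea := (hk a ha).2
  have eb := (hk b hb).2
  rw [← hkab] at eb
  rw [e] at ea eb
  have hl : (k a).linear v = w := by
    have h1 : (a - b) • (k a).linear v = (a - b) • w := by
      rw [sub_smul, sub_smul]
      have := congrArg₂ (· - ·) ea eb
      simpa using this
    exact smul_right_injective _ (sub_ne_zero.2 hab) h1
  refine ⟨k a, (hk a ha).1, ?_, hl⟩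
  rw [hl, add_comm] at ea
  exact add_right_cancel ea

/-- A chart on a segment is immersive near its starting point: otherwise a chart on an
adjacent chamber would be folded along infinitely many lines, against the finiteness of
the relation between points of this chart. -/
theorem Atlas.IsBuilding.exists_iseg (hA : A.IsBuilding) {τ : Bool} {c : ℝ} {γ : ℝ → X}
    (hc : 0 < c) (hγ : A.Chart τ (hseg c) fun z => γ z.1) : ∃ δ > 0, δ ≤ c ∧ A.ISeg τ δ γ := by
  have hd : A.IsDart (γ 0) (cdart τ γ) := by
    have := A.isDart_of_chart hγ (e := (0, 0)) (mem_hseg.2 ⟨le_rfl, hc.le⟩) (k := 0)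
      (sees_hseg_zero le_rfl hc)
    simpa [dart, dr_zero, typ] using this
  obtain ⟨c', -, hadj, -, -, -, hc0, -⟩ := hA.hexagon' hd hd
  have h01 := hadj 0
  rw [hc0] at h01
  obtain ⟨τ', s, f, hf, h0, h1, h2, hu, -⟩ := h01
  obtain ⟨rfl, δ₀, hδ₀, hfγ⟩ := cdart_eq_iff.1 hu
  obtain ⟨ρ₁, hρ₁, hr1⟩ := eventually_nhdsGE_zero.1 h1
  obtain ⟨ρ₂, hρ₂, hr2⟩ := eventually_nhdsGE_zero.1 h2
  have hs := A.isHex hf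
  obtain ⟨ρ, hρ, hρc, hρδ, hρ1, hρ2⟩ : ∃ ρ > 0, ρ ≤ c ∧ ρ ≤ δ₀ ∧ ρ ≤ ρ₁ ∧ ρ ≤ ρ₂ :=
    ⟨min (min c δ₀) (min ρ₁ ρ₂), by positivity, by simp, by simp, by simp, by simp⟩
  have hm : ∀ p q : ℝ, 0 ≤ p → 0 ≤ q → p + q ≤ ρ → ((p, q) : Pl) ∈ s := by
    intro p q hp hq hpq
    have := hs.convex_chamber (e := 0) 0 h0 (hr1 ρ hρ.le hρ1)
      (hr2 ρ hρ.le hρ2) hp hq hpq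
    simpa [dr] using this
  have hγf : ∀ r, 0 ≤ r → r ≤ ρ → γ r = f (r, 0) := by
    intro r hr hrρ
    rw [hfγ r hr (by linarith)]
    simp [dr_zero]
  obtain ⟨K, hK, hKf⟩ := A.finRel hf
  -- Where the curve is not straight, two directions of the chart at `(r, 0)` that make an angle of
  -- `120°` have equal darts, since there are no cycles of length four.
  let Bad : Set ℝ := {r | 0 < r ∧ r < ρ ∧
    A.Adj (cdart τ fun t => γ (r + t)) (cdart (!τ) fun t => γ (r - t))}
  have hbad : ∀ r : ℝ, ∃ k : Pl →ᵃ[ℝ] Pl, r ∈ Bad → k ∈ K ∧ k (r, 0) = (r, 0) ∧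
      k.linear (1, 0) ≠ (1, 0) := by
    intro r
    by_cases hr : r ∈ Bad
    swap
    · exact ⟨AffineMap.id ℝ Pl, fun h => absurd h hr⟩
    obtain ⟨hr0, hrρ, hadj⟩ := hr
    have hrs : ((r, 0) : Pl) ∈ s := hm r 0 hr0.le le_rfl (by linarith)
    have see : ∀ k : Fin 6, ∀ t : ℝ, 0 < t → (r, 0) + t • dr k ∈ s → Sees s (r, 0) k :=
      fun k t ht h => hs.sees hrs ht h
    have s0 : Sees s (r, 0) 0 := see 0 (ρ - r) (by linarith) (by
      simpa [dr] using hm ρ 0 hρ.le le_rfl (by linarith))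
    have s1 : Sees s (r, 0) 1 := see 1 (ρ - r) (by linarith) (by
      simpa [dr] using hm r (ρ - r) hr0.le (by linarith) (by linarith))
    have s2 : Sees s (r, 0) 2 := see 2 r hr0 (by
      simpa [dr] using hm 0 r le_rfl hr0.le (by linarith))
    have s3 : Sees s (r, 0) 3 := see 3 r hr0 (by
      simpa [dr] using hm 0 0 le_rfl le_rfl (by linarith))
    have a01 := A.adj_of_chart hf hrs s0 s1
    have a12 := A.adj_of_chart hf hrs s1 s2
    have a23 := A.adj_of_chart hf hrs s2 s3
    have d0 : cdart τ (fun t => γ (r + t)) = dart τ f (r, 0) 0 :=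
      cdart_congr (ρ - r) (by linarith) fun t h0 h1 => by
        rw [hγf _ (by linarith) (by linarith)]; simp [dr_zero]
    have d3 : cdart (!τ) (fun t => γ (r - t)) = dart τ f (r, 0) 3 :=
      cdart_congr r hr0 fun t h0 h1 => by
        rw [hγf _ (by linarith) (by linarith)]; simp [dr_three, sub_eq_add_neg]
    rw [d0, d3] at hadj
    rcases hA.noSquare a01 a12 hadj a23.symm with h | h
    · obtain ⟨-, η, hη, he⟩ := cdart_eq_iff.1 h
      obtain ⟨k, hk, hk1, hk2⟩ := exists_affine_of_segment hK (p := (r, 0)) (v := dr 0)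
        (w := dr 2) (η := min η (min (ρ - r) r)) (lt_min hη (lt_min (by linarith) hr0))
        (fun t ht0 ht => by
          simp only [le_min_iff] at ht
          refine hKf _ ?_ _ ?_ (he t ht0 ht.1)
          · simpa [dr] using hm (r + t) 0 (by linarith) le_rfl (by linarith)
          · have := hm (r - t) t (by linarith) ht0 (by linarith)
            simpa [dr, sub_eq_add_neg] using this)
      refine ⟨k, fun _ => ⟨hk, hk1, fun h => ?_⟩⟩
      rw [dr_zero] at hk2
      rw [h] at hk2
      simp [dr_two] at hk2
    · obtain ⟨-, η, hη, he⟩ := cdart_eq_iff.1 h.symm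
      obtain ⟨k, hk, hk1, hk2⟩ := exists_affine_of_segment hK (p := (r, 0)) (v := dr 3)
        (w := dr 1) (η := min η (min (ρ - r) r)) (lt_min hη (lt_min (by linarith) hr0))
        (fun t ht0 ht => by
          simp only [le_min_iff] at ht
          refine hKf _ ?_ _ ?_ (he t ht0 ht.1)
          · have := hm (r - t) 0 (by linarith) le_rfl (by linarith)
            simpa [dr, sub_eq_add_neg] using this
          · simpa [dr] using hm r t (by linarith) ht0 (by linarith))
      refine ⟨k, fun _ => ⟨hk, hk1, fun h => ?_⟩⟩
      have e : dr 3 = -((1, 0) : Pl) := by simp [dr]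
      rw [e, map_neg, h] at hk2
      simp [dr_one] at hk2
  choose k hk using hbad
  -- The map `k r` fixes no other point of the line: it fixes `(r, 0)` and turns the line.
  have hfin : Bad.Finite := by
    refine Set.Finite.of_injOn (f := k) (fun r hr => (hk r hr).1) ?_ hK
    intro r hr r' hr' hrr
    by_contra hne
    refine (hk r hr).2.2 ?_
    have h1 := (hk r hr).2.1
    have h2 := (hk r' hr').2.1
    rw [← hrr] at h2
    have e := (k r).map_vadd (r', 0) ((r - r') • ((1, 0) : Pl))
    simp only [vadd_eq_add, map_smul] at e
    have e' : (r - r') • ((1, 0) : Pl) + (r', 0) = (r, 0) := by ext <;> simp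
    rw [e', h1, h2, ← e', add_right_cancel_iff] at e
    exact (smul_right_injective _ (sub_ne_zero.2 hne) e).symm
  have hop : Badᶜ ∈ 𝓝 (0 : ℝ) := hfin.isClosed.isOpen_compl.mem_nhds fun h => lt_irrefl _ h.1
  obtain ⟨ε, hε, hball⟩ := Metric.mem_nhds_iff.1 hop
  refine ⟨min ρ (ε / 2), by positivity, (min_le_left _ _).trans hρc, ?_⟩
  refine Atlas.ISeg.of_chart (A.mono hγ (isHex_hseg _) ?_) fun r hr0 hr h => ?_
  · rintro z ⟨h1, h2, h3⟩
    exact ⟨h1, h2.trans ((min_le_left _ _).trans hρc), h3⟩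
  · rw [lt_min_iff] at hr
    have : r ∈ Metric.ball (0 : ℝ) ε := by
      rw [Metric.mem_ball, Real.dist_eq, sub_zero, abs_of_pos hr0]; linarith
    exact hball this ⟨hr0, hr.1, h⟩

theorem Atlas.IsBuilding.extend (hA : A.IsBuilding) {τ : Bool} {t t' : ℝ} {γ : ℝ → X}
    (ht : 0 < t) (htt' : t < t') (hγ : A.ISeg τ t γ) :
    ∃ γ', A.ISeg τ t' γ' ∧ ∀ r, 0 ≤ r → r ≤ t → γ' r = γ r := by
  have hd := (hγ.rev ht.le).isDart ht
  simp only [sub_zero] at hd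
  obtain ⟨v, h1, h2, h3⟩ := hA.exists_opposite hd
  have h2' : v.1 = τ := by rw [h2]; simp [cdart]
  obtain ⟨γ', h4, h5, -⟩ := hA.exSeg ht htt' hγ h1 h2' h3
  exact ⟨γ', h4, h5⟩

/-- An immersive curve extends to an infinite one. -/
theorem Atlas.IsBuilding.extend_ray (hA : A.IsBuilding) {τ : Bool} {t : ℝ} {γ : ℝ → X}
    (ht : 0 < t) (hγ : A.ISeg τ t γ) :
    ∃ γ', (∀ T, 0 ≤ T → A.ISeg τ T γ') ∧ ∀ r, 0 ≤ r → r ≤ t → γ' r = γ r := by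
  have step : ∀ (n : ℕ) (σ : {σ : ℝ → X // A.ISeg τ (t + n) σ}),
      ∃ σ' : {σ : ℝ → X // A.ISeg τ (t + (n + 1 : ℕ)) σ},
        ∀ r, 0 ≤ r → r ≤ t + n → σ'.1 r = σ.1 r := by
    intro n σ
    obtain ⟨σ', h1, h2⟩ := hA.extend (t' := t + (n + 1 : ℕ)) (by positivity) (by simp) σ.2
    exact ⟨⟨σ', h1⟩, h2⟩
  choose nxt hnxt using step
  let sq : (n : ℕ) → {σ : ℝ → X // A.ISeg τ (t + n) σ} :=
    fun n => Nat.rec ⟨γ, by simpa using hγ⟩ nxt n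
  have hsq : ∀ n m : ℕ, n ≤ m → ∀ r, 0 ≤ r → r ≤ t + n → (sq m).1 r = (sq n).1 r := by
    intro n m hnm
    induction m, hnm using Nat.le_induction with
    | base => intros; rfl
    | succ m hnm ih =>
      intro r h0 h1
      rw [← ih r h0 h1]
      have : (n : ℝ) ≤ m := by exact_mod_cast hnm
      exact hnxt m (sq m) r h0 (by linarith)
  refine ⟨fun r => (sq ⌈r⌉₊).1 r, fun T hT => ?_, fun r h0 h1 => ?_⟩
  · have hT' := Nat.le_ceil T
    refine ((sq ⌈T⌉₊).2.take hT (by linarith)).congr fun r h0 h1 => ?_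
    exact (hsq _ _ (Nat.ceil_le_ceil h1) r h0 (by have := Nat.le_ceil r; linarith)).symm
  · exact hsq 0 _ (Nat.zero_le _) r h0 (by simpa using h1)

/-- Every dart is the direction of an infinite immersive curve. -/
theorem Atlas.IsBuilding.exists_ray (hA : A.IsBuilding) {x : X} {u : Dart X} (hu : A.IsDart x u) :
    ∃ γ, (∀ T, 0 ≤ T → A.ISeg u.1 T γ) ∧ γ 0 = x ∧ cdart u.1 γ = u := by
  obtain ⟨τ, s, f, hf, h0, h1, rfl, rfl⟩ := hu
  obtain ⟨c, hc, hcs⟩ := h1.exists_mem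
  obtain ⟨δ, hδ, -, hγ⟩ := hA.exists_iseg (γ := fun r => f (0 + r • dr 0)) hc (chart_curve hf h0 hcs)
  obtain ⟨γ', h2, h3⟩ := hA.extend_ray hδ hγ
  refine ⟨γ', h2, ?_, ?_⟩
  · rw [h3 0 le_rfl hδ.le]; simp
  · exact cdart_congr δ hδ h3

/-! ### Propagation of coincidence along a line -/

theorem eventually_nhdsWithin_pl {D : Set Pl} {e : Pl} {P : Pl → Prop} :
    (∀ᶠ z in 𝓝[D] e, P z) ↔
      ∃ ε > 0, ∀ z ∈ D, |z.1 - e.1| < ε → |z.2 - e.2| < ε → P z := by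
  rw [eventually_nhdsWithin_iff, Metric.eventually_nhds_iff]
  simp only [Prod.dist_eq, Real.dist_eq, max_lt_iff]
  constructor
  · rintro ⟨ε, hε, h⟩
    exact ⟨ε, hε, fun z hz h1 h2 => h ⟨h1, h2⟩ hz⟩
  · rintro ⟨ε, hε, h⟩
    exact ⟨ε, hε, fun z h1 hz => h z hz h1.1 h1.2⟩

theorem chamber_coord_lt {e z : Pl} {k : Fin 6} {p q ε : ℝ} (hp : 0 ≤ p) (hq : 0 ≤ q)
    (hz : z = e + p • dr k + q • dr (k + 1)) (h1 : |z.1 - e.1| < ε) (h2 : |z.2 - e.2| < ε) :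
    p < ε ∧ q < ε := by
  subst hz
  rw [abs_lt] at h1 h2
  fin_cases k <;> simp [dr] at h1 h2 <;> constructor <;> linarith

/-- Coincidence on a chamber at `e` gives coincidence near `e` on regions within this chamber. -/
theorem near_of_chamber {D : Set Pl} {f g : Pl → X} {e : Pl} {k : Fin 6} {δ : ℝ} (hδ : 0 < δ)
    (hfg : ∀ p q : ℝ, 0 ≤ p → p ≤ δ → 0 ≤ q → q ≤ δ →
      f (e + p • dr k + q • dr (k + 1)) = g (e + p • dr k + q • dr (k + 1)))
    (hD : ∀ z ∈ D, ∃ p q : ℝ, 0 ≤ p ∧ 0 ≤ q ∧ z = e + p • dr k + q • dr (k + 1)) :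
    ∀ᶠ z in 𝓝[D] e, f z = g z := by
  rw [eventually_nhdsWithin_pl]
  refine ⟨δ, hδ, fun z hz h1 h2 => ?_⟩
  obtain ⟨p, q, hp, hq, hz⟩ := hD z hz
  obtain ⟨g1, g2⟩ := chamber_coord_lt hp hq hz h1 h2
  rw [hz]
  exact hfg p q hp g1.le hq g2.le

/-- At a corner of angle `60°`, charts coincide if they do so along the two sides. -/
theorem Atlas.IsBuilding.near_of_corner60 (hA : A.IsBuilding) {τ : Bool} {D : Set Pl}
    {f g : Pl → X} (hf : A.Chart τ D f) (hg : A.Chart τ D g) {e : Pl} (he : e ∈ D) {k : Fin 6}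
    (h1 : Sees D e k) (h2 : Sees D e (k + 1)) (d1 : dart τ f e k = dart τ g e k)
    (d2 : dart τ f e (k + 1) = dart τ g e (k + 1))
    (hD : ∀ z ∈ D, ∃ p q : ℝ, 0 ≤ p ∧ 0 ≤ q ∧ z = e + p • dr k + q • dr (k + 1)) :
    ∀ᶠ z in 𝓝[D] e, f z = g z := by
  obtain ⟨δ, hδ, h⟩ := hA.agree_chamber hf hg he h1 h2 d1 d2
  exact near_of_chamber hδ h hD

/-- At a corner of angle `120°`, an immersive chart coincides with another chart if it does so along the
two sides. -/
theorem Atlas.IsBuilding.near_of_corner120 (hA : A.IsBuilding) {τ : Bool} {D : Set Pl}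
    {f g : Pl → X} (hf : A.Imm τ D f) (hg : A.Chart τ D g) {e : Pl} (he : e ∈ D) {k : Fin 6}
    (h1 : Sees D e k) (h2 : Sees D e (k + 1)) (h3 : Sees D e (k + 2))
    (d1 : dart τ f e k = dart τ g e k) (d3 : dart τ f e (k + 2) = dart τ g e (k + 2))
    (hD : ∀ z ∈ D, ∃ p q : ℝ, 0 ≤ p ∧ 0 ≤ q ∧ (z = e + p • dr k + q • dr (k + 1) ∨
      z = e + p • dr (k + 1) + q • dr (k + 2))) :
    ∀ᶠ z in 𝓝[D] e, f z = g z := by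
  have d2 := hA.agree_mid hf hg he h1 h2 h3 d1 d3
  obtain ⟨δ, hδ, h⟩ := hA.agree_chamber hf.1 hg he h1 h2 d1 d2
  have e2 : k + 1 + 1 = k + 2 := by rw [add_assoc]; rfl
  obtain ⟨δ', hδ', h'⟩ := hA.agree_chamber hf.1 hg he h2 (e2 ▸ h3) d2 (e2 ▸ d3)
  have n1 := near_of_chamber (D := {z | ∃ p q : ℝ, 0 ≤ p ∧ 0 ≤ q ∧
    z = e + p • dr k + q • dr (k + 1)}) hδ h fun z hz => hz
  have n2 := near_of_chamber (D := {z | ∃ p q : ℝ, 0 ≤ p ∧ 0 ≤ q ∧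
    z = e + p • dr (k + 1) + q • dr (k + 1 + 1)}) hδ' h' fun z hz => hz
  rw [eventually_nhdsWithin_iff] at n1 n2 ⊢
  filter_upwards [n1, n2] with z m1 m2 hz
  obtain ⟨p, q, hp, hq, hz | hz⟩ := hD z hz
  · exact m1 ⟨p, q, hp, hq, hz⟩
  · exact m2 ⟨p, q, hp, hq, by rw [e2]; exact hz⟩

/-- The set on which two charts coincide is closed. -/
theorem isClosed_eqLocus {τ : Bool} {D : Set Pl} {f g : Pl → X} (hf : A.Chart τ D f)
    (hg : A.Chart τ D g) : IsClosed {z | z ∈ D ∧ f z = g z} := by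
  obtain ⟨T, hT, hT', h⟩ := A.eqHex hf hg
  have : {z | z ∈ D ∧ f z = g z} = ⋃ t ∈ T, t := by
    ext z; simpa using h z
  rw [this]
  exact hT.isClosed_biUnion fun t ht => (hT' t ht).isClosed

/-- Let `f`, `g` be immersive charts on a region with a side `[0, ℓ]` on the line `z.2 = 0`, at
whose right end the region has an angle of `60°`. If `f` and `g` coincide on this side, and near
its left end, then they coincide near all of its points. At a limit `(r, 0)` of points where
they coincide nearby, one of the finitely many hexagonal regions forming the locus of coincidence
reaches above these points for infinitely many of them, so that it contains a piece of the chamber to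
the left of `(r, 0)`; the other chambers follow as there are no cycles of length four. -/
theorem Atlas.IsBuilding.propagate (hA : A.IsBuilding) {τ : Bool} {D : Set Pl} {f g : Pl → X}
    {ℓ : ℝ} (hf : A.Imm τ D f) (hg : A.Imm τ D g)
    (hD : ∀ z ∈ D, 0 ≤ z.2 ∧ z.1 + z.2 ≤ ℓ)
    (hbase : ∀ r, 0 ≤ r → r ≤ ℓ → ((r, 0) : Pl) ∈ D)
    (heq : ∀ r, 0 ≤ r → r ≤ ℓ → f (r, 0) = g (r, 0)) (hthick : ∃ z ∈ D, 0 < z.2)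
    (h0 : ∀ᶠ z in 𝓝[D] (0 : Pl), f z = g z) :
    ∀ r, 0 ≤ r → r ≤ ℓ → ∀ᶠ z in 𝓝[D] ((r, 0) : Pl), f z = g z := by
  obtain ⟨w, hwD, hw⟩ := hthick
  have hDm : ∀ p q : ℝ, 0 ≤ p → 0 ≤ q → q ≤ w.2 → p + q ≤ ℓ → ((p, q) : Pl) ∈ D := by
    intro p q hp hq hqw hpq
    have hl : 0 ≤ ℓ := by linarith
    have m1 := hbase 0 le_rfl hl
    have m2 := hbase ℓ hl le_rfl
    obtain ⟨a, a', b, b', c, c', rfl⟩ := hf.isHex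
    simp only [Set.mem_ofPred_eq] at m1 m2 hwD ⊢
    refine ⟨⟨?_, ?_⟩, ⟨?_, ?_⟩, ?_, ?_⟩ <;> linarith
  have hDx := hf.isHex
  refine real_induction (fun _ => h0) ?_ ?_
  · intro r hr0 hrl hP
    obtain ⟨ε, hε, h⟩ := eventually_nhdsWithin_pl.1 (hP r hr0 le_rfl)
    refine ⟨ε / 2, by positivity, fun r' h1 h2 h3 => ?_⟩
    refine eventually_nhdsWithin_pl.2 ⟨ε / 2, by positivity, fun z hz g1 g2 => ?_⟩
    refine h z hz ?_ (by simp only at g2 ⊢; linarith)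
    simp only at g1 ⊢
    rw [abs_lt] at g1 ⊢
    constructor <;> linarith
  · intro r hr0 hrl hP
    obtain ⟨T, hT, hT', hTeq⟩ := A.eqHex hf.1 hg.1
    have hex : ∀ r', 0 < r' → r' < r → ∃ t ∈ T, ∃ h, 0 < h ∧ h < r - r' ∧
        ((r' - h, h) : Pl) ∈ t := by
      intro r' g0 g1
      obtain ⟨ε, hε, h⟩ := eventually_nhdsWithin_pl.1 (hP r' g0.le g1)
      obtain ⟨η, hη, e1, e2, e3, e4⟩ : ∃ η > 0, η < ε ∧ η < r - r' ∧ η < r' ∧ η < w.2 := by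
        obtain ⟨η, h1, h2⟩ := exists_between (show (0 : ℝ) < min (min ε (r - r')) (min r' w.2) from
          lt_min (lt_min hε (by linarith)) (lt_min g0 hw))
        simp only [lt_min_iff] at h2
        exact ⟨η, h1, h2.1.1, h2.1.2, h2.2.1, h2.2.2⟩
      have hmem := hDm (r' - η) η (by linarith) hη.le e4.le (by linarith)
      have hv := h _ hmem (by simp [abs_of_pos hη, e1]) (by simp [abs_of_pos hη, e1])
      obtain ⟨t, ht, ht'⟩ := (hTeq _).1 ⟨hmem, hv⟩
      exact ⟨t, ht, η, hη, e2, ht'⟩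
    -- one region `t` serves for points arbitrarily close to `r`, hence contains `(r, 0)`
    obtain ⟨t, ht, hfr⟩ : ∃ t ∈ T, ∃ᶠ r' in 𝓝[<] r, ∃ h, 0 < h ∧ h < r - r' ∧
        ((r' - h, h) : Pl) ∈ t := by
      by_contra hcon
      push Not at hcon
      have h1 := (Filter.eventually_all_finite hT).2 hcon
      have h2 : ∀ᶠ r' in 𝓝[<] r, r' ∈ Set.Ioo 0 r := Ioo_mem_nhdsLT hr0
      obtain ⟨r', h3, h4⟩ := (h1.and h2).exists
      obtain ⟨t, ht, h, h5, h6, h7⟩ := hex r' h4.1 h4.2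
      exact h3 t ht h h5 h6 h7
    have hrt : ((r, 0) : Pl) ∈ t := by
      by_contra hcon
      have := (hT' t ht).isClosed.isOpen_compl.mem_nhds hcon
      rw [← nhdsWithin_univ, ← Filter.eventually_mem_set, eventually_nhdsWithin_pl] at this
      obtain ⟨ε, hε, hbox⟩ := this
      have h2 : ∀ᶠ r' in 𝓝[<] r, r' ∈ Set.Ioo (r - ε / 2) r := Ioo_mem_nhdsLT (by linarith)
      obtain ⟨r', ⟨h, h3, h4, h5⟩, h6, h7⟩ := (hfr.and_eventually h2).exists
      refine absurd h5 (hbox _ trivial ?_ ?_) <;> simp only [abs_lt] <;> constructor <;> linarith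
    obtain ⟨r', h, h1, h2, h3⟩ := hfr.exists
    -- `(r' - h, h) = (r, 0) + h • dr 2 + (r - r') • dr 3`
    have hch : ∀ p q : ℝ, 0 ≤ p → p ≤ h → 0 ≤ q → q ≤ h →
        f ((r, 0) + p • dr 2 + q • dr 3) = g ((r, 0) + p • dr 2 + q • dr 3) := by
      intro p q hp hph hq hqh
      refine ((hTeq _).2 ⟨t, ht, ?_⟩).2
      refine (hT' t ht).acute_hull (p := h) (q := r - r') 2 hrt ?_ hp hph hq (by linarith)
      convert h3 using 1
      ext <;> simp [dr]
      ring
    have hn23 := near_of_chamber (D := {z | ∃ p q : ℝ, 0 ≤ p ∧ 0 ≤ q ∧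
      z = (r, 0) + p • dr 2 + q • dr (2 + 1)}) h1 hch fun z hz => hz
    rcases hrl.eq_or_lt with hl | hl
    · refine near_of_chamber h1 hch fun z hz => ?_
      obtain ⟨g1, g2⟩ := hD z hz
      refine ⟨z.2, r - z.1 - z.2, g1, by linarith, ?_⟩
      ext <;> simp [dr]
      ring
    · have hrD := hbase r hr0.le hrl
      have s0 : Sees D (r, 0) 0 := hDx.sees hrD (r := ℓ - r) (by linarith) (by
        simpa [dr] using hbase ℓ (by linarith) le_rfl)
      have s1 : Sees D (r, 0) 1 := hDx.sees hrD (r := min w.2 (ℓ - r))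
        (lt_min hw (by linarith)) (by
        have := hDm r (min w.2 (ℓ - r)) hr0.le (le_min hw.le (by linarith)) (min_le_left _ _)
          (by have := min_le_right w.2 (ℓ - r); linarith)
        simpa [dr] using this)
      have s2 : Sees D (r, 0) 2 := hDx.sees hrD (r := min w.2 r)
        (lt_min hw (by linarith)) (by
        have := hDm (r - min w.2 r) (min w.2 r) (by have := min_le_right w.2 r; linarith)
          (le_min hw.le hr0.le) (min_le_left _ _) (by linarith)
        simpa [dr, sub_eq_add_neg] using this)
      have d0 : dart τ f (r, 0) 0 = dart τ g (r, 0) 0 := cdart_congr (ℓ - r) (by linarith)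
        fun t h0 h1 => by
          have := heq (r + t) (by linarith) (by linarith)
          simpa [dr] using this
      have d2 : dart τ f (r, 0) 2 = dart τ g (r, 0) 2 := cdart_congr h h1
        fun t g0 g1 => by
          have := hch t 0 g0 g1 le_rfl h1.le
          simpa using this
      have d1 := hA.agree_mid (k := 0) hf hg.1 hrD s0 s1 s2 d0 d2
      obtain ⟨δ₁, hδ₁, c01⟩ := hA.agree_chamber (k := 0) hf.1 hg.1 hrD s0 s1 d0 d1
      obtain ⟨δ₂, hδ₂, c12⟩ := hA.agree_chamber (k := 1) hf.1 hg.1 hrD s1 s2 d1 d2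
      have hn01 := near_of_chamber (D := {z | ∃ p q : ℝ, 0 ≤ p ∧ 0 ≤ q ∧
        z = (r, 0) + p • dr 0 + q • dr (0 + 1)}) hδ₁ c01 fun z hz => hz
      have hn12 := near_of_chamber (D := {z | ∃ p q : ℝ, 0 ≤ p ∧ 0 ≤ q ∧
        z = (r, 0) + p • dr 1 + q • dr (1 + 1)}) hδ₂ c12 fun z hz => hz
      rw [eventually_nhdsWithin_iff] at hn01 hn12 hn23 ⊢
      filter_upwards [hn01, hn12, hn23] with z m1 m2 m3 hz
      obtain ⟨g1, g2⟩ := hD z hz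
      rcases le_total r z.1 with c1 | c1
      · refine m1 ⟨z.1 - r, z.2, by linarith, g1, ?_⟩
        ext <;> simp [dr]
      · rcases le_total r (z.1 + z.2) with c2 | c2
        · refine m2 ⟨z.1 + z.2 - r, r - z.1, by linarith, by linarith, ?_⟩
          ext <;> simp [dr]
        · refine m3 ⟨z.2, r - z.1 - z.2, g1, by linarith, ?_⟩
          ext <;> simp [dr]
          ring

theorem continuous_fr (e : Pl) (k : Fin 6) : Continuous (fr e k) := by
  unfold fr; fun_prop

theorem continuous_reflR : Continuous reflR := by
  unfold reflR; fun_prop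

theorem eventually_fr {D : Set Pl} {e : Pl} {k : Fin 6} {z : Pl} {P : Pl → Prop} :
    (∀ᶠ w in 𝓝[fr e k ⁻¹' D] z, P (fr e k w)) ↔ ∀ᶠ w in 𝓝[D] (fr e k z), P w := by
  obtain ⟨e', h1, h2⟩ := exists_fr_inv e k
  constructor
  · intro h
    have ht : Filter.Tendsto (fr e' (-k)) (𝓝[D] (fr e k z)) (𝓝[fr e k ⁻¹' D] z) := by
      have := (continuous_fr e' (-k)).continuousWithinAt.tendsto_nhdsWithin
        (s := D) (x := fr e k z) (t := fr e k ⁻¹' D) fun w hw => by simpa [h1] using hw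
      rwa [h2] at this
    filter_upwards [ht.eventually h] with w hw
    rwa [h1] at hw
  · intro h
    have ht : Filter.Tendsto (fr e k) (𝓝[fr e k ⁻¹' D] z) (𝓝[D] (fr e k z)) :=
      (continuous_fr e k).continuousWithinAt.tendsto_nhdsWithin fun w hw => hw
    exact ht.eventually h

theorem reflR_reflR (z : Pl) : reflR (reflR z) = z := by ext <;> simp [reflR]

theorem eventually_reflR {D : Set Pl} {z : Pl} {P : Pl → Prop} :
    (∀ᶠ w in 𝓝[reflR ⁻¹' D] z, P (reflR w)) ↔ ∀ᶠ w in 𝓝[D] (reflR z), P w := by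
  constructor
  · intro h
    have ht : Filter.Tendsto reflR (𝓝[D] (reflR z)) (𝓝[reflR ⁻¹' D] z) := by
      have := continuous_reflR.continuousWithinAt.tendsto_nhdsWithin
        (s := D) (x := reflR z) (t := reflR ⁻¹' D) fun w hw => by simpa [reflR_reflR] using hw
      rwa [reflR_reflR] at this
    filter_upwards [ht.eventually h] with w hw
    rwa [reflR_reflR] at hw
  · intro h
    have ht : Filter.Tendsto reflR (𝓝[reflR ⁻¹' D] z) (𝓝[D] (reflR z)) :=
      continuous_reflR.continuousWithinAt.tendsto_nhdsWithin fun w hw => hw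
    exact ht.eventually h

theorem Atlas.IsBuilding.propagate_right (hA : A.IsBuilding) {τ : Bool} {D : Set Pl} {f g : Pl → X}
    {ℓ : ℝ} {e : Pl} (hf : A.Imm τ D f) (hg : A.Imm τ D g)
    (hD : ∀ z ∈ D, e.2 ≤ z.2 ∧ z.1 + z.2 ≤ e.1 + e.2 + ℓ)
    (hbase : ∀ r, 0 ≤ r → r ≤ ℓ → ((e.1 + r, e.2) : Pl) ∈ D)
    (heq : ∀ r, 0 ≤ r → r ≤ ℓ → f (e.1 + r, e.2) = g (e.1 + r, e.2)) (hthick : ∃ z ∈ D, e.2 < z.2)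
    (h0 : ∀ᶠ z in 𝓝[D] e, f z = g z) :
    ∀ r, 0 ≤ r → r ≤ ℓ → ∀ᶠ z in 𝓝[D] ((e.1 + r, e.2) : Pl), f z = g z := by
  have he : ∀ r : ℝ, fr e 0 (r, 0) = (e.1 + r, e.2) := fun r => by
    rw [fr_std]; ext <;> simp
  have := hA.propagate (hf.frame e 0) (hg.frame e 0) (ℓ := ℓ) ?_ ?_ ?_ ?_ ?_
  · intro r h1 h2
    have := this r h1 h2
    rw [eventually_fr (P := fun z => f z = g z)] at this
    rwa [he] at this
  · intro z hz
    have := hD _ hz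
    simp only [fr_std, Prod.fst_add, Prod.snd_add] at this
    constructor <;> linarith
  · intro r h1 h2
    rw [Set.mem_preimage, he]; exact hbase r h1 h2
  · intro r h1 h2
    simp only [he]; exact heq r h1 h2
  · obtain ⟨z, hz, hz'⟩ := hthick
    refine ⟨z - e, ?_, by simpa using hz'⟩
    rw [Set.mem_preimage, fr_std]; simpa using hz
  · rw [eventually_fr (P := fun z => f z = g z), fr_zero]; exact h0

/-- The mirror image of `propagate_right`: the coincidence spreads to the left. -/
theorem Atlas.IsBuilding.propagate_left (hA : A.IsBuilding) {τ : Bool} {D : Set Pl} {f g : Pl → X}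
    {ℓ : ℝ} {e : Pl} (hf : A.Imm τ D f) (hg : A.Imm τ D g)
    (hD : ∀ z ∈ D, e.2 ≤ z.2 ∧ e.1 - ℓ ≤ z.1)
    (hbase : ∀ r, 0 ≤ r → r ≤ ℓ → ((e.1 - r, e.2) : Pl) ∈ D)
    (heq : ∀ r, 0 ≤ r → r ≤ ℓ → f (e.1 - r, e.2) = g (e.1 - r, e.2)) (hthick : ∃ z ∈ D, e.2 < z.2)
    (h0 : ∀ᶠ z in 𝓝[D] e, f z = g z) :
    ∀ r, 0 ≤ r → r ≤ ℓ → ∀ᶠ z in 𝓝[D] ((e.1 - r, e.2) : Pl), f z = g z := by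
  have hz : ∀ z : Pl, fr e 3 (reflR z) = (e.1 - z.1 - z.2, e.2 + z.2) := fun z => by
    ext <;> simp [fr, reflR, dr]
    ring
  have he : ∀ r : ℝ, fr e 3 (reflR (r, 0)) = (e.1 - r, e.2) := fun r => by
    rw [hz]; simp
  have := hA.propagate (hf.frame e 3).reflect (hg.frame e 3).reflect (ℓ := ℓ) ?_ ?_ ?_ ?_ ?_
  · intro r h1 h2
    have := this r h1 h2
    rw [eventually_reflR (P := fun z => f (fr e 3 z) = g (fr e 3 z)),
      eventually_fr (P := fun z => f z = g z), he] at this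
    exact this
  · intro z hzD
    have := hD _ hzD
    rw [hz] at this
    simp only at this
    constructor <;> linarith
  · intro r h1 h2
    rw [Set.mem_preimage, Set.mem_preimage, he]; exact hbase r h1 h2
  · intro r h1 h2
    simp only [he]; exact heq r h1 h2
  · obtain ⟨z, hzD, hz'⟩ := hthick
    refine ⟨(e.1 + e.2 - z.1 - z.2, z.2 - e.2), ?_, by simpa using hz'⟩
    rw [Set.mem_preimage, Set.mem_preimage, hz]
    convert hzD using 1
    ext <;> simp
    ring
  · rw [eventually_reflR (P := fun z => f (fr e 3 z) = g (fr e 3 z)),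
      eventually_fr (P := fun z => f z = g z)]
    have : fr e 3 (reflR 0) = e := (he 0).trans (by simp)
    rw [this]; exact h0

/-- Two functions coinciding near the points of one side of a compact region coincide on a strip
along this side. -/
theorem exists_strip {D : Set Pl} (hD : IsHex D) {f g : Pl → X} {c : ℝ} (hc : ∀ z ∈ D, c ≤ z.2)
    (h : ∀ z ∈ D, z.2 = c → ∀ᶠ w in 𝓝[D] z, f w = g w) :
    ∃ η > 0, ∀ z ∈ D, z.2 ≤ c + η → f z = g z := by
  let O : Set Pl := {z | ∀ᶠ w in 𝓝 z, w ∈ D → f w = g w}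
  have hO : IsOpen O := isOpen_setOfPred_eventually_nhds
  have hK : IsCompact (D ∩ Oᶜ) := hD.isCompact.inter_right hO.isClosed_compl
  have hDO : ∀ z ∈ D, z ∈ O → f z = g z := fun z hz hzO => Filter.Eventually.self_of_nhds hzO hz
  rcases (D ∩ Oᶜ).eq_empty_or_nonempty with he | hne
  · refine ⟨1, one_pos, fun z hz _ => hDO z hz ?_⟩
    by_contra hcon
    have : z ∈ D ∩ Oᶜ := ⟨hz, hcon⟩
    rw [he] at this; exact this
  · obtain ⟨w, hw, hmin⟩ := hK.exists_isMinOn hne continuous_snd.continuousOn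
    have hwc : c < w.2 := by
      refine lt_of_le_of_ne (hc w hw.1) fun hcon => hw.2 ?_
      have := h w hw.1 hcon.symm
      rwa [eventually_nhdsWithin_iff] at this
    refine ⟨(w.2 - c) / 2, by linarith, fun z hz hz' => hDO z hz ?_⟩
    by_contra hcon
    have : w.2 ≤ z.2 := hmin ⟨hz, hcon⟩
    linarith

/-- An immersive parallelogram is determined by its two sides at an obtuse corner. -/
theorem Atlas.IsBuilding.par_unique (hA : A.IsBuilding) {τ : Bool} {a b : ℝ} {f g : Pl → X}
    (hf : A.Imm τ (par 0 0 a b) f) (hg : A.Imm τ (par 0 0 a b) g) (ha : 0 < a)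
    (h1 : ∀ r, 0 ≤ r → r ≤ a → f (r, 0) = g (r, 0))
    (h2 : ∀ r, 0 ≤ r → r ≤ b → f (-r, r) = g (-r, r)) :
    ∀ z ∈ par 0 0 a b, f z = g z := by
  have hmem : ∀ z : Pl, z ∈ par 0 0 a b ↔ (0 ≤ z.2 ∧ z.2 ≤ b) ∧ 0 ≤ z.1 + z.2 ∧ z.1 + z.2 ≤ a := by
    intro z
    constructor
    · rintro ⟨p, q, ⟨h1, h2⟩, ⟨h3, h4⟩, rfl⟩
      simp [dr_zero, dr_two]
      refine ⟨⟨?_, ?_⟩, ?_, ?_⟩ <;> linarith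
    · rintro ⟨⟨h3, h4⟩, h5, h6⟩
      refine ⟨z.1 + z.2, z.2, ⟨h5, h6⟩, ⟨h3, h4⟩, ?_⟩
      ext <;> simp [dr_zero, dr_two]
  have hex := isHex_par 0 0 a b
  suffices key : ∀ t, 0 ≤ t → t ≤ b → ∀ z ∈ par 0 0 a b, z.2 = t → f z = g z from
    fun z hz => key z.2 ((hmem z).1 hz).1.1 ((hmem z).1 hz).1.2 z hz rfl
  refine real_induction ?_ ?_ ?_
  · intro hb z hz hz2
    obtain ⟨-, h3, h4⟩ := (hmem z).1 hz
    have e : z = (z.1, 0) := by rw [← hz2]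
    rw [hz2, add_zero] at h3 h4
    rw [e]; exact h1 _ h3 h4
  · intro t ht htb hP
    have hP' : ∀ z ∈ par 0 0 a b, z.2 = t → f z = g z := hP t ht le_rfl
    let D : Set Pl := par 0 0 a b ∩ {z | (-b ≤ z.1 ∧ z.1 ≤ a) ∧ (t ≤ z.2 ∧ z.2 ≤ b) ∧
      (0 ≤ z.1 + z.2 ∧ z.1 + z.2 ≤ a)}
    have hDmem : ∀ z : Pl, z ∈ D ↔ (t ≤ z.2 ∧ z.2 ≤ b) ∧ 0 ≤ z.1 + z.2 ∧ z.1 + z.2 ≤ a := by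
      intro z
      simp only [D, Set.mem_inter_iff, hmem, Set.mem_ofPred_eq]
      constructor
      · tauto
      · rintro ⟨⟨h1, h2⟩, h3, h4⟩
        refine ⟨⟨⟨?_, ?_⟩, ?_, ?_⟩, ⟨?_, ?_⟩, ⟨?_, ?_⟩, ?_, ?_⟩ <;> linarith
    have hDx : IsHex D := hex.inter (isHex_mk _ _ _ _ _ _)
    have hDf := hf.mono hDx Set.inter_subset_left
    have hDg := hg.mono hDx Set.inter_subset_left
    have he : ((-t, t) : Pl) ∈ D := (hDmem _).2 ⟨⟨le_rfl, htb.le⟩, by simp, by simpa using ha.le⟩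
    have s0 : Sees D (-t, t) 0 := hDx.sees he ha ((hDmem _).2 (by
      simp [dr]; exact ⟨htb.le, ha.le⟩))
    have s1 : Sees D (-t, t) 1 := hDx.sees he (r := min a (b - t)) (lt_min ha (by linarith))
      ((hDmem _).2 (by
        have m1 := min_le_left a (b - t)
        have m2 := min_le_right a (b - t)
        have m3 : 0 < min a (b - t) := lt_min ha (by linarith)
        rw [show ((-t, t) : Pl) + min a (b - t) • dr 1 = (-t, t + min a (b - t)) by
          ext <;> simp [dr]]
        refine ⟨⟨?_, ?_⟩, ?_, ?_⟩ <;> simp only <;> linarith))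
    have s2 : Sees D (-t, t) 2 := hDx.sees he (r := b - t) (by linarith) ((hDmem _).2 (by
      rw [show ((-t, t) : Pl) + (b - t) • dr 2 = (-b, b) by
        ext <;> simp [dr]; ring]
      refine ⟨⟨?_, ?_⟩, ?_, ?_⟩ <;> simp only <;> linarith))
    have d0 : dart τ f (-t, t) 0 = dart τ g (-t, t) 0 := cdart_congr a ha fun r hr hra =>
      hP' _ ((hmem _).2 (by simp [dr]; refine ⟨⟨ht, htb.le⟩, hr, hra⟩)) (by simp [dr])
    have d2 : dart τ f (-t, t) 2 = dart τ g (-t, t) 2 := cdart_congr (b - t) (by linarith)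
      fun r hr hra => by
        have := h2 (t + r) (by linarith) (by linarith)
        simpa [dr, add_comm] using this
    have hn := hA.near_of_corner120 (k := 0) hDf hDg.1 he s0 s1 s2 d0 d2 (by
      intro z hz
      obtain ⟨⟨g1, g2⟩, g3, g4⟩ := (hDmem z).1 hz
      rcases le_total (-t) z.1 with h | h
      · exact ⟨z.1 + t, z.2 - t, by linarith, by linarith, Or.inl (by ext <;> simp [dr])⟩
      · exact ⟨z.1 + z.2, -t - z.1, by linarith, by linarith, Or.inr (by
          ext <;> simp [dr]; ring)⟩)
    have hpr := hA.propagate_right (e := (-t, t)) (ℓ := a) hDf hDg (fun z hz => by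
        obtain ⟨⟨g1, g2⟩, g3, g4⟩ := (hDmem z).1 hz
        exact ⟨g1, by simpa using g4⟩)
      (fun r hr hra => (hDmem _).2 (by simp; exact ⟨htb.le, hr, hra⟩))
      (fun r hr hra => hP' _ ((hmem _).2 (by simp; exact ⟨⟨ht, htb.le⟩, hr, hra⟩)) rfl)
      ⟨(-b, b), (hDmem _).2 (by simp; exact ⟨htb.le, ha.le⟩), htb⟩ hn
    obtain ⟨η, hη, hs⟩ := exists_strip hDx (f := f) (g := g) (c := t)
      (fun z hz => ((hDmem z).1 hz).1.1) (fun z hz hzt => by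
        obtain ⟨⟨g1, g2⟩, g3, g4⟩ := (hDmem z).1 hz
        have := hpr (z.1 + t) (by linarith) (by linarith)
        have e : z = (-t + (z.1 + t), t) := by ext <;> simp [hzt]
        rw [e]; exact this)
    refine ⟨η, hη, fun r' g1 g2 g3 z hz hzr => hs z ((hDmem z).2 ?_) (by linarith)⟩
    obtain ⟨⟨i1, i2⟩, i3, i4⟩ := (hmem z).1 hz
    exact ⟨⟨by linarith, i2⟩, i3, i4⟩
  · intro t ht htb hP z hz hzt
    have hcl := isClosed_eqLocus hf.1 hg.1
    have hlim : Filter.Tendsto (fun r : ℝ => z + r • dr 5) (𝓝[>] 0) (𝓝 z) := by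
      have : Continuous fun r : ℝ => z + r • dr 5 := by fun_prop
      have h := this.tendsto 0
      simp only [zero_smul, add_zero] at h
      exact h.mono_left nhdsWithin_le_nhds
    refine (hcl.mem_of_tendsto hlim ?_).2
    have : ∀ᶠ r in 𝓝[>] (0 : ℝ), r ∈ Set.Ioo 0 t := Ioo_mem_nhdsGT ht
    filter_upwards [this] with r hr
    obtain ⟨⟨i1, i2⟩, i3, i4⟩ := (hmem z).1 hz
    have hm : z + r • dr 5 ∈ par 0 0 a b := (hmem _).2 (by
      simp [dr]; refine ⟨⟨by linarith [hr.2], by linarith [hr.1]⟩, by linarith, by linarith⟩)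
    refine ⟨hm, hP (t - r) (by linarith [hr.2]) (by linarith [hr.1]) _ hm ?_⟩
    simp [dr, hzt]; ring

/-! ### Points joined by an immersive chart -/

/-- The two points lie in the image of an immersive chart. -/
def Atlas.Joined (A : Atlas X) (x y : X) : Prop :=
  ∃ τ s f, A.Imm τ s f ∧ ∃ z ∈ s, ∃ w ∈ s, f z = x ∧ f w = y

/-- The parallelogram with acute corner at the origin and sides of lengths `b`, `a` in the
directions `dr 0`, `dr 1`. -/
def rect (b a : ℝ) : Set Pl := {z | (0 ≤ z.1 ∧ z.1 ≤ b) ∧ (0 ≤ z.2 ∧ z.2 ≤ a)}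

theorem isHex_rect (b a : ℝ) : IsHex (rect b a) := by
  refine ⟨0, b, 0, a, 0, a + b, ?_⟩
  ext z
  simp only [rect, Set.mem_ofPred_eq]
  constructor
  · rintro ⟨⟨h1, h2⟩, h3, h4⟩; refine ⟨⟨?_, ?_⟩, ⟨?_, ?_⟩, ?_, ?_⟩ <;> linarith
  · rintro ⟨h1, h2, h3⟩; exact ⟨h1, h2⟩

theorem mem_rect {b a u w : ℝ} : ((u, w) : Pl) ∈ rect b a ↔ (0 ≤ u ∧ u ≤ b) ∧ (0 ≤ w ∧ w ≤ a) :=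
  Iff.rfl

theorem mem_par_zero {a b : ℝ} {z : Pl} : z ∈ par 0 0 a b ↔
    (0 ≤ z.2 ∧ z.2 ≤ b) ∧ 0 ≤ z.1 + z.2 ∧ z.1 + z.2 ≤ a := by
  constructor
  · rintro ⟨p, q, ⟨h1, h2⟩, ⟨h3, h4⟩, rfl⟩
    simp [dr_zero, dr_two]
    refine ⟨⟨?_, ?_⟩, ?_, ?_⟩ <;> linarith
  · rintro ⟨⟨h3, h4⟩, h5, h6⟩
    refine ⟨z.1 + z.2, z.2, ⟨h5, h6⟩, ⟨h3, h4⟩, ?_⟩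
    ext <;> simp [dr_zero, dr_two]

theorem Atlas.ISeg.joined {τ : Bool} {c r r' : ℝ} {γ : ℝ → X} (h : A.ISeg τ c γ) (h1 : 0 ≤ r)
    (h2 : r ≤ c) (h3 : 0 ≤ r') (h4 : r' ≤ c) : A.Joined (γ r) (γ r') :=
  ⟨τ, _, _, h, (r, 0), mem_hseg.2 ⟨h1, h2⟩, (r', 0), mem_hseg.2 ⟨h3, h4⟩, rfl, rfl⟩

/-- Immersive curves meeting at a straight angle concatenate. -/
theorem exists_concat {τ : Bool} {a b : ℝ} {α β : ℝ → X} (ha : 0 < a) (hb : 0 < b)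
    (h1 : A.ISeg τ a α) (h2 : A.ISeg τ b β) (h0 : α a = β 0)
    (h : ¬ A.Adj (cdart τ β) (cdart (!τ) fun t => α (a - t))) :
    ∃ γ, A.ISeg τ (a + b) γ ∧ (∀ r, r ≤ a → γ r = α r) ∧ ∀ r, 0 ≤ r → γ (a + r) = β r := by
  let γ : ℝ → X := fun r => if r ≤ a then α r else β (r - a)
  have g1 : ∀ r, r ≤ a → γ r = α r := fun r hr => if_pos hr
  have g2 : ∀ r, 0 ≤ r → γ (a + r) = β r := by
    intro r hr
    rcases hr.eq_or_lt with rfl | hr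
    · rw [add_zero, g1 a le_rfl, h0]
    · simp only [γ]
      rw [if_neg (by linarith), add_sub_cancel_left]
  refine ⟨γ, Atlas.ISeg.concat ha hb (h1.congr fun r _ hr => g1 r hr)
    (h2.congr fun r hr _ => g2 r hr) ?_, g1, g2⟩
  rw [cdart_congr (τ := τ) (γ' := β) 1 one_pos fun r hr _ => g2 r hr,
    cdart_congr (τ := !τ) (γ' := fun t => α (a - t)) 1 one_pos fun r hr _ => g1 _ (by linarith)]
  exact h

/-- The endpoints of two curves of the same parity in different directions lie in the parallelogram
spanned by the curves. -/
theorem Atlas.IsBuilding.joined_of_obtuse (hA : A.IsBuilding) {τ : Bool} {a b : ℝ} {α β : ℝ → X}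
    (ha : 0 < a) (hb : 0 < b) (h1 : A.ISeg τ a α) (h2 : A.ISeg τ b β) (h0 : α 0 = β 0)
    (h : cdart τ α ≠ cdart τ β) : A.Joined (α a) (β b) := by
  obtain ⟨f, hf, g1, g2⟩ := hA.exObt ha hb h1 h2 h0 h
  refine ⟨τ, _, f, hf, (a, 0), mem_par_zero.2 ?_, (-b, b), mem_par_zero.2 ?_,
    g1 a ha.le le_rfl, g2 b hb.le le_rfl⟩ <;> simp [ha.le, hb.le]

/-- If a curve leaves the acute corner of an immersive parallelogram straight on from the side of the
opposite parity, then its endpoint is joined to the opposite corner: the side and the curve together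
form a curve, which spans an obtuse angle with the side parallel to the other one. -/
theorem Atlas.IsBuilding.joined_straight (hA : A.IsBuilding) {τ : Bool} {a b c : ℝ} {f : Pl → X}
    {σ : ℝ → X} (ha : 0 < a) (hb : 0 < b) (hc : 0 < c) (hf : A.Imm τ (rect b a) f)
    (hσ : A.ISeg τ c σ) (h0 : σ 0 = f 0) (h : ¬ A.Adj (dart τ f 0 1) (cdart τ σ)) :
    A.Joined (f (b, a)) (σ c) := by
  have hm : ((0, a) : Pl) ∈ rect b a := mem_rect.2 ⟨⟨le_rfl, hb.le⟩, ha.le, le_rfl⟩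
  have e0 : ((0, a) : Pl) + b • dr 0 = (b, a) := by ext <;> simp [dr]
  have e4 : ((0, a) : Pl) + a • dr 4 = (0, 0) := by ext <;> simp [dr]
  have m0 : ((0, a) : Pl) + b • dr 0 ∈ rect b a := by
    rw [e0]; exact mem_rect.2 ⟨⟨hb.le, le_rfl⟩, ha.le, le_rfl⟩
  have m4 : ((0, a) : Pl) + a • dr 4 ∈ rect b a := by
    rw [e4]; exact mem_rect.2 ⟨⟨le_rfl, hb.le⟩, le_rfl, ha.le⟩
  have c0 := hf.curve hm m0
  have c4 := hf.curve hm m4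
  obtain ⟨γ, hγ, g1, g2⟩ := exists_concat (τ := τ) ha hc c4 hσ (by
      simp only [e4]; exact h0.symm) (by
    intro hcon
    refine h ?_
    convert hcon.symm using 1
    refine cdart_congr a ha fun r h1 h2 => ?_
    congr 1
    ext <;> simp [dr])
  have hne := (hf.2 _ hm 4).1 ((isHex_rect b a).sees hm ha m4) ((isHex_rect b a).sees hm hb m0)
  have := hA.joined_of_obtuse (τ := τ) hb (by linarith) c0 hγ (by
    rw [g1 0 ha.le]; simp) (by
    intro hcon
    refine hne ?_
    refine Eq.trans ?_ hcon.symm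
    exact cdart_congr a ha fun r _ h2 => (g1 r h2).symm)
  rwa [g2 c hc.le, e0] at this

/-- Two immersive charts, on a parallelogram `rect b a` with acute corner `0` and on a parallelogram
with obtuse corner `0`, share the side from `0` in the direction `dr 0`. They coincide on a strip of
some maximal width `δ` along this side; beyond this strip they are replaced by a parallelogram on
the segment at height `δ`. If `δ` is not bounded by the sizes of the regions, then the second chart
leaves the new parallelogram at a straight angle: otherwise propagation along the segment, from the
left for the second chart and from the right for the first, would enlarge the strip. -/
theorem Atlas.IsBuilding.branch (hA : A.IsBuilding) {τ : Bool} {a b c M : ℝ} {f g : Pl → X}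
    (ha : 0 < a) (hb : 0 < b) (hc : 0 < c) (hf : A.Imm τ (rect b a) f)
    (hg : A.Imm τ (par 0 0 b c) g) (hfg : ∀ r, 0 ≤ r → r ≤ b → f (r, 0) = g (r, 0))
    (hM : M = min a (min c (b / 2))) :
    ∃ δ f', 0 ≤ δ ∧ δ ≤ M ∧ A.Imm τ (rect (b + δ) (a - δ)) f' ∧ f' (b + δ, a - δ) = f (b, a) ∧
      (∀ r, 0 ≤ r → r ≤ b → f' (r, 0) = g (r - δ, δ)) ∧
      (δ = M ∨ ¬ A.Adj (dart τ f' 0 1) (dart τ g (-δ, δ) 2)) := by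
  have hMa : M ≤ a := hM ▸ min_le_left _ _
  have hMc : M ≤ c := hM ▸ (min_le_right _ _).trans (min_le_left _ _)
  have hMb : M ≤ b / 2 := hM ▸ (min_le_right _ _).trans (min_le_right _ _)
  have hM0 : 0 < M := hM ▸ lt_min ha (lt_min hc (by linarith))
  -- the part of the common region of the two charts in which the strip is sought
  let O : Set Pl := {z | (0 ≤ z.1 ∧ z.1 ≤ b) ∧ (0 ≤ z.2 ∧ z.2 ≤ M) ∧ (0 ≤ z.1 + z.2 ∧ z.1 + z.2 ≤ b)}
  have hOx : IsHex O := isHex_mk _ _ _ _ _ _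
  have hOf : O ⊆ rect b a := fun z hz => ⟨hz.1, hz.2.1.1, hz.2.1.2.trans hMa⟩
  have hOg : O ⊆ par 0 0 b c := fun z hz =>
    mem_par_zero.2 ⟨⟨hz.2.1.1, hz.2.1.2.trans hMc⟩, hz.2.2⟩
  let S : Set ℝ := {δ | 0 ≤ δ ∧ δ ≤ M ∧ ∀ z ∈ O, z.2 ≤ δ → f z = g z}
  have hS0 : (0 : ℝ) ∈ S := by
    refine ⟨le_rfl, hM0.le, fun z hz h => ?_⟩
    have e : z = (z.1, 0) := by ext <;> simp [le_antisymm h hz.2.1.1]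
    rw [e]; exact hfg _ hz.1.1 hz.1.2
  have hSb : BddAbove S := ⟨M, fun x hx => hx.2.1⟩
  have hS : sSup S ∈ S := by
    refine ⟨le_csSup hSb hS0, csSup_le ⟨0, hS0⟩ fun x hx => hx.2.1, fun z hz h => ?_⟩
    have hlt : ∀ w ∈ O, w.2 < sSup S → f w = g w := by
      intro w hw h
      obtain ⟨δ, h1, h2⟩ := exists_lt_of_lt_csSup ⟨0, hS0⟩ h
      exact h1.2.2 w hw h2.le
    rcases h.lt_or_eq with h | h
    · exact hlt z hz h
    rcases hz.2.1.1.eq_or_lt with h0 | h0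
    · exact hS0.2.2 z hz h0.symm.le
    have hcl := isClosed_eqLocus (A.mono hf.1 hOx hOf) (A.mono hg.1 hOx hOg)
    have hlim : Filter.Tendsto (fun r : ℝ => z + r • dr 5) (𝓝[>] 0) (𝓝 z) := by
      have : Continuous fun r : ℝ => z + r • dr 5 := by fun_prop
      have h := this.tendsto 0
      simp only [zero_smul, add_zero] at h
      exact h.mono_left nhdsWithin_le_nhds
    refine (hcl.mem_of_tendsto hlim ?_).2
    have : ∀ᶠ r in 𝓝[>] (0 : ℝ), r ∈ Set.Ioo 0 z.2 := Ioo_mem_nhdsGT h0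
    filter_upwards [this] with r hr
    obtain ⟨⟨i1, i2⟩, ⟨i3, i4⟩, i5, i6⟩ := hz
    have e : z + r • dr 5 = (z.1 + r, z.2 - r) := by ext <;> simp [dr, sub_eq_add_neg]
    rw [e]
    have hm : ((z.1 + r, z.2 - r) : Pl) ∈ O := by
      refine ⟨⟨?_, ?_⟩, ⟨?_, ?_⟩, ?_, ?_⟩ <;> simp only <;> linarith [hr.1, hr.2]
    exact ⟨hm, hlt _ hm (by simp only; linarith [hr.1])⟩
  obtain ⟨δ, hδdef⟩ : ∃ δ, δ = sSup S := ⟨_, rfl⟩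
  rw [← hδdef] at hS
  obtain ⟨hδ0, hδM, hδ⟩ := hS
  -- the segment at height `δ`
  let γ : ℝ → X := fun r => if δ ≤ r then f (r - δ, δ) else g (r - δ, δ)
  have γf : ∀ r, δ ≤ r → γ r = f (r - δ, δ) := fun r hr => if_pos hr
  have γg : ∀ r, r ≤ b → γ r = g (r - δ, δ) := by
    intro r hr
    by_cases h : δ ≤ r
    · rw [γf r h]
      refine hδ _ ?_ le_rfl
      refine ⟨⟨?_, ?_⟩, ⟨?_, ?_⟩, ?_, ?_⟩ <;> simp only <;> linarith
    · exact if_neg h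
  have hγ : A.ISeg τ (b + δ) γ := by
    refine Atlas.ISeg.glue (a := δ) (b := b) hδ0 (by linarith) (by linarith) ?_ ?_
    · have := hg.curve (e := (-δ, δ)) (k := 0) (c := b) (mem_par_zero.2 (by
        simp; refine ⟨⟨?_, ?_⟩, ?_⟩ <;> linarith)) (mem_par_zero.2 (by
        simp [dr]; refine ⟨⟨?_, ?_⟩, ?_⟩ <;> linarith))
      refine this.congr fun r h1 h2 => ?_
      rw [γg r h2]; congr 1; ext <;> simp [dr]; ring
    · have := hf.curve (e := (0, δ)) (k := 0) (c := b) (mem_rect.2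
        (by refine ⟨⟨?_, ?_⟩, ?_, ?_⟩ <;> linarith)) (by
        have e : ((0, δ) : Pl) + b • dr 0 = (b, δ) := by ext <;> simp [dr]
        rw [e]; refine mem_rect.2 (by refine ⟨⟨?_, ?_⟩, ?_, ?_⟩ <;> linarith))
      rw [add_sub_cancel_right]
      refine this.congr fun r h1 h2 => ?_
      rw [γf _ (by linarith)]; congr 1; ext <;> simp [dr]
  have hgm : ((-δ, δ) : Pl) ∈ par 0 0 b c :=
    mem_par_zero.2 (by simp; refine ⟨⟨?_, ?_⟩, ?_⟩ <;> linarith)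
  rcases (hδM.trans hMa).eq_or_lt with hδa | hδa
  · refine ⟨δ, fun z => γ z.1, hδ0, hδM, ?_, ?_, fun r h1 h2 => γg r h2, Or.inl (by linarith)⟩
    · refine Atlas.Imm.mono hγ (isHex_rect _ _) ?_
      rintro z ⟨⟨h1, h2⟩, h3, h4⟩
      exact ⟨h1, h2, by linarith⟩
    · simp only
      rw [γf _ (by linarith), add_sub_cancel_right, hδa]
  -- the parallelogram on this segment
  have hbδ : ((b, δ) : Pl) ∈ rect b a := mem_rect.2 ⟨⟨hb.le, le_rfl⟩, hδ0, hδa.le⟩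
  have ebd1 : ((b, δ) : Pl) + (a - δ) • dr 1 = (b, a) := by ext <;> simp [dr]
  have ebd3 : ((b, δ) : Pl) + b • dr 3 = (0, δ) := by ext <;> simp [dr]
  have mbd1 : ((b, δ) : Pl) + (a - δ) • dr 1 ∈ rect b a := by
    rw [ebd1]; exact mem_rect.2 ⟨⟨hb.le, le_rfl⟩, ha.le, le_rfl⟩
  have mbd3 : ((b, δ) : Pl) + b • dr 3 ∈ rect b a := by
    rw [ebd3]; exact mem_rect.2 ⟨⟨le_rfl, hb.le⟩, hδ0, hδa.le⟩
  have sbd1 := (isHex_rect b a).sees hbδ (by linarith) mbd1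
  have sbd3 := (isHex_rect b a).sees hbδ hb mbd3
  have γ3 : ∀ r, r ≤ b → γ (b + δ - r) = f ((b, δ) + r • dr 3) := by
    intro r hr
    rw [γf _ (by linarith)]; congr 1; ext <;> simp [dr]; ring
  obtain ⟨f', hf', k1, k2⟩ := hA.exists_par (τ := τ) (b + δ, 0) 1 (a := a - δ) (b := b + δ)
    (by linarith) (by linarith) (hf.curve hbδ mbd1) (hγ.rev (by linarith)) (by
      rw [γ3 0 hb.le]; simp) (by
      intro hcon
      refine (hf.2 _ hbδ 1).1 sbd1 sbd3 (Eq.trans hcon ?_)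
      exact cdart_congr b hb fun r _ h2 => γ3 r h2)
  have k2' : ∀ r, 0 ≤ r → r ≤ b + δ → f' (r, 0) = γ r := by
    intro r h1 h2
    have := k2 (b + δ - r) (by linarith) (by linarith)
    rw [sub_sub_cancel] at this
    rw [← this]; congr 1; ext <;> simp [dr]
  have hf'' : A.Imm τ (rect (b + δ) (a - δ)) f' := by
    refine hf'.mono (isHex_rect _ _) ?_
    rintro z ⟨⟨h1, h2⟩, h3, h4⟩
    refine ⟨z.2, b + δ - z.1, ⟨h3, h4⟩, ⟨by linarith, by linarith⟩, ?_⟩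
    ext <;> simp [dr]
  have hf'g : ∀ r, 0 ≤ r → r ≤ b → f' (r, 0) = g (r - δ, δ) := fun r h1 h2 => by
    rw [k2' r h1 (by linarith), γg r h2]
  refine ⟨δ, f', hδ0, hδM, hf'', ?_, hf'g, ?_⟩
  · have := k1 (a - δ) (by linarith) le_rfl
    rw [ebd1] at this
    rw [← this]; congr 1; ext <;> simp [dr]
  rw [or_iff_not_imp_left]
  intro hne hadj
  have hδM' : δ < M := lt_of_le_of_ne hδM hne
  -- `F₂` is the new parallelogram in the coordinates of the two given charts
  let F₂ : Pl → X := fun z => f' (fr (δ, -δ) 0 z)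
  have eF : ∀ u w : ℝ, F₂ (u, w) = f' (u + δ, w - δ) := fun u w => by
    simp only [F₂, fr_std]; congr 1; ext <;> simp <;> ring
  have hF : A.Imm τ (fr (δ, -δ) 0 ⁻¹' rect (b + δ) (a - δ)) F₂ := hf''.frame _ 0
  have hFm : ∀ u w : ℝ, (u, w) ∈ fr (δ, -δ) 0 ⁻¹' rect (b + δ) (a - δ) ↔
      (-δ ≤ u ∧ u ≤ b) ∧ (δ ≤ w ∧ w ≤ a) := by
    intro u w
    rw [Set.mem_preimage, fr_std]
    simp only [rect, Set.mem_ofPred_eq, Prod.fst_add, Prod.snd_add]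
    constructor
    · rintro ⟨⟨h1, h2⟩, h3, h4⟩; refine ⟨⟨?_, ?_⟩, ?_, ?_⟩ <;> linarith
    · rintro ⟨⟨h1, h2⟩, h3, h4⟩; refine ⟨⟨?_, ?_⟩, ?_, ?_⟩ <;> linarith
  have hF1 : dart τ F₂ (-δ, δ) 1 = dart τ f' 0 1 := by
    have := dart_fr (τ := τ) (f := f') (e := (δ, -δ)) (k := 0) (z := (-δ, δ)) (j := 1)
    rw [typ_zero, zero_add] at this
    rw [show fr (δ, -δ) 0 (-δ, δ) = 0 by rw [fr_std]; ext <;> simp] at this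
    exact this
  -- coincidence of `F₂` and `g`, from the left
  let D₁ : Set Pl := {z | (-δ ≤ z.1 ∧ z.1 ≤ b) ∧ (δ ≤ z.2 ∧ z.2 ≤ M) ∧
    (0 ≤ z.1 + z.2 ∧ z.1 + z.2 ≤ b)}
  have hD₁x : IsHex D₁ := isHex_mk _ _ _ _ _ _
  have hD₁F := hF.mono hD₁x fun z hz => (hFm z.1 z.2).2 ⟨hz.1, hz.2.1.1, hz.2.1.2.trans hMa⟩
  have hD₁g := hg.mono hD₁x fun z hz =>
    mem_par_zero.2 ⟨⟨hδ0.trans hz.2.1.1, hz.2.1.2.trans hMc⟩, hz.2.2⟩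
  have hD₁m : ∀ u w : ℝ, ((u, w) : Pl) ∈ D₁ ↔ (-δ ≤ u ∧ u ≤ b) ∧ (δ ≤ w ∧ w ≤ M) ∧
    (0 ≤ u + w ∧ u + w ≤ b) := fun _ _ => Iff.rfl
  have hy₁ : ((-δ, δ) : Pl) ∈ D₁ := by
    rw [hD₁m]; refine ⟨⟨?_, ?_⟩, ⟨?_, ?_⟩, ?_, ?_⟩ <;> linarith
  have ey0 : ((-δ, δ) : Pl) + b • dr 0 = (b - δ, δ) := by ext <;> simp [dr]; ring
  have ey1 : ((-δ, δ) : Pl) + (M - δ) • dr 1 = (-δ, M) := by ext <;> simp [dr]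
  have s0 : Sees D₁ (-δ, δ) 0 := hD₁x.sees hy₁ hb (by
    rw [ey0, hD₁m]; refine ⟨⟨?_, ?_⟩, ⟨?_, ?_⟩, ?_, ?_⟩ <;> linarith)
  have s1 : Sees D₁ (-δ, δ) 1 := hD₁x.sees hy₁ (r := M - δ) (by linarith) (by
    rw [ey1, hD₁m]; refine ⟨⟨?_, ?_⟩, ⟨?_, ?_⟩, ?_, ?_⟩ <;> linarith)
  have sg0 : Sees (par 0 0 b c) (-δ, δ) 0 := (isHex_par _ _ _ _).sees hgm hb (by
    rw [ey0, mem_par_zero]; refine ⟨⟨?_, ?_⟩, ?_, ?_⟩ <;> simp only <;> linarith)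
  have sg1 : Sees (par 0 0 b c) (-δ, δ) 1 := (isHex_par _ _ _ _).sees hgm
    (r := M - δ) (by linarith) (by
    rw [ey1, mem_par_zero]; refine ⟨⟨?_, ?_⟩, ?_, ?_⟩ <;> simp only <;> linarith)
  have sg2 : Sees (par 0 0 b c) (-δ, δ) 2 := (isHex_par _ _ _ _).sees hgm
    (r := M - δ) (by linarith) (by
    rw [show ((-δ, δ) : Pl) + (M - δ) • dr 2 = (-M, M) by
      ext <;> simp [dr]; ring, mem_par_zero]
    refine ⟨⟨?_, ?_⟩, ?_, ?_⟩ <;> simp only <;> linarith)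
  have d0 : dart τ F₂ (-δ, δ) 0 = dart τ g (-δ, δ) 0 := cdart_congr b hb fun r h1 h2 => by
    have e : ((-δ, δ) : Pl) + r • dr 0 = (r - δ, δ) := by ext <;> simp [dr]; ring
    rw [e, eF, sub_self, sub_add_cancel, hf'g r h1 h2]
  have d1 : dart τ F₂ (-δ, δ) 1 = dart τ g (-δ, δ) 1 := by
    have a1 := A.adj_of_chart hD₁F.1 hy₁ s0 s1
    rw [d0] at a1
    rw [← hF1] at hadj
    exact hA.unique_mid a1 hadj (A.adj_of_chart hg.1 hgm sg0 sg1)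
      (A.adj_of_chart hg.1 hgm sg1 sg2) ((hg.2 _ hgm 0).1 sg0 sg2)
  have n1 := hA.near_of_corner60 (k := 0) hD₁F.1 hD₁g.1 hy₁ s0 s1 d0 d1 (by
    rintro ⟨u, w⟩ hz
    obtain ⟨⟨h1, h2⟩, ⟨h3, h4⟩, h5, h6⟩ := (hD₁m u w).1 hz
    refine ⟨u + δ, w - δ, by linarith, by linarith, ?_⟩
    ext <;> simp [dr])
  have p1 := hA.propagate_right (e := (-δ, δ)) (ℓ := b) hD₁F hD₁g
    (fun z hz => ⟨hz.2.1.1, by simpa using hz.2.2.2⟩)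
    (fun r h1 h2 => by
      simp only [hD₁m]; refine ⟨⟨?_, ?_⟩, ⟨?_, ?_⟩, ?_, ?_⟩ <;> linarith)
    (fun r h1 h2 => by
      simp only [eF]; rw [sub_self, hf'g _ (by linarith) (by linarith)]; congr 1; ext <;> simp; ring)
    ⟨(-δ, M), by rw [hD₁m]; refine ⟨⟨?_, ?_⟩, ⟨?_, ?_⟩, ?_, ?_⟩ <;> linarith, hδM'⟩ n1
  -- coincidence of `F₂` and `f`, from the right
  let D₂ : Set Pl := {z | (0 ≤ z.1 ∧ z.1 ≤ b) ∧ (δ ≤ z.2 ∧ z.2 ≤ a) ∧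
    (0 ≤ z.1 + z.2 ∧ z.1 + z.2 ≤ b + a)}
  have hD₂x : IsHex D₂ := isHex_mk _ _ _ _ _ _
  have hD₂m : ∀ u w : ℝ, ((u, w) : Pl) ∈ D₂ ↔ (0 ≤ u ∧ u ≤ b) ∧ (δ ≤ w ∧ w ≤ a) ∧
    (0 ≤ u + w ∧ u + w ≤ b + a) := fun _ _ => Iff.rfl
  have hD₂F := hF.mono hD₂x fun z hz => (hFm z.1 z.2).2 ⟨⟨by linarith [hz.1.1], hz.1.2⟩, hz.2.1⟩
  have hD₂f := hf.mono hD₂x fun z hz => ⟨hz.1, hδ0.trans hz.2.1.1, hz.2.1.2⟩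
  have hy₂ : ((b, δ) : Pl) ∈ D₂ := by
    rw [hD₂m]; refine ⟨⟨?_, ?_⟩, ⟨?_, ?_⟩, ?_, ?_⟩ <;> linarith
  have t1 : Sees D₂ (b, δ) 1 := hD₂x.sees hy₂ (r := a - δ) (by linarith) (by
    rw [ebd1, hD₂m]; refine ⟨⟨?_, ?_⟩, ⟨?_, ?_⟩, ?_, ?_⟩ <;> linarith)
  have t2 : Sees D₂ (b, δ) 2 := hD₂x.sees hy₂ (r := M - δ) (by linarith) (by
    rw [show ((b, δ) : Pl) + (M - δ) • dr 2 = (b - (M - δ), M) by ext <;> simp [dr]; ring, hD₂m]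
    refine ⟨⟨?_, ?_⟩, ⟨?_, ?_⟩, ?_, ?_⟩ <;> linarith)
  have t3 : Sees D₂ (b, δ) 3 := hD₂x.sees hy₂ hb (by
    rw [ebd3, hD₂m]; refine ⟨⟨?_, ?_⟩, ⟨?_, ?_⟩, ?_, ?_⟩ <;> linarith)
  have F₂f : ∀ r, 0 ≤ r → r ≤ b → F₂ (b - r, δ) = f (b - r, δ) := by
    intro r h1 h2
    rw [eF, sub_self, k2' _ (by linarith) (by linarith), γf _ (by linarith), add_sub_cancel_right]
  have e1 : dart τ F₂ (b, δ) 1 = dart τ f (b, δ) 1 :=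
    cdart_congr (a - δ) (by linarith) fun r h1 h2 => by
      have := k1 r h1 h2
      rw [← this]
      have e : ((b, δ) : Pl) + r • dr 1 = (b, δ + r) := by ext <;> simp [dr]
      rw [e, eF]; congr 1; ext <;> simp [dr]
  have e3 : dart τ F₂ (b, δ) 3 = dart τ f (b, δ) 3 := cdart_congr b hb fun r h1 h2 => by
    have e : ((b, δ) : Pl) + r • dr 3 = (b - r, δ) := by ext <;> simp [dr]; ring
    rw [e, F₂f r h1 h2]
  have n2 := hA.near_of_corner120 (k := 1) hD₂F hD₂f.1 hy₂ t1 t2 t3 e1 e3 (by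
    rintro ⟨u, w⟩ hz
    obtain ⟨⟨h1, h2⟩, ⟨h3, h4⟩, h5, h6⟩ := (hD₂m u w).1 hz
    rcases le_total (b + δ) (u + w) with h | h
    · refine ⟨u + w - b - δ, b - u, by linarith, by linarith, Or.inl ?_⟩
      ext <;> simp [dr]
    · refine ⟨w - δ, b + δ - u - w, by linarith, by linarith, Or.inr ?_⟩
      ext <;> simp [dr]; ring)
  have p2 := hA.propagate_left (e := (b, δ)) (ℓ := b) hD₂F hD₂f
    (fun z hz => ⟨hz.2.1.1, by simpa using hz.1.1⟩)
    (fun r h1 h2 => by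
      simp only [hD₂m]; refine ⟨⟨?_, ?_⟩, ⟨?_, ?_⟩, ?_, ?_⟩ <;> linarith)
    F₂f ⟨(b, a), by rw [hD₂m]; refine ⟨⟨?_, ?_⟩, ⟨?_, ?_⟩, ?_, ?_⟩ <;> linarith, hδa⟩ n2
  -- the strip is wider than `δ`
  let D₃ : Set Pl := {z | (0 ≤ z.1 ∧ z.1 ≤ b) ∧ (δ ≤ z.2 ∧ z.2 ≤ M) ∧
    (0 ≤ z.1 + z.2 ∧ z.1 + z.2 ≤ b)}
  obtain ⟨η, hη, hs⟩ := exists_strip (D := D₃) (isHex_mk _ _ _ _ _ _) (f := f) (g := g) (c := δ)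
    (fun z hz => hz.2.1.1) (by
    rintro ⟨u, w⟩ hz hw
    obtain ⟨⟨h1, h2⟩, ⟨h3, h4⟩, h5, h6⟩ := hz
    simp only at h1 h2 h3 h4 h5 h6 hw
    subst hw
    have q1 := p1 (u + w) (by linarith) (by linarith)
    have q2 := p2 (b - u) (by linarith) (by linarith)
    simp only [neg_add_cancel_comm_assoc, sub_sub_cancel] at q1 q2
    rw [eventually_nhdsWithin_iff] at q1 q2 ⊢
    filter_upwards [q1, q2] with z z1 z2 hz
    rw [← z1 ⟨⟨by linarith [hz.1.1], hz.1.2⟩, hz.2⟩,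
      z2 ⟨hz.1, ⟨hz.2.1.1, hz.2.1.2.trans hMa⟩, hz.2.2.1, by linarith [hz.2.2.2]⟩])
  have hmem : min (δ + η) M ∈ S := by
    refine ⟨le_min (by linarith) hM0.le, min_le_right _ _, fun z hz h => ?_⟩
    rcases le_total z.2 δ with h1 | h1
    · exact hδ z hz h1
    · exact hs z ⟨hz.1, ⟨h1, hz.2.1.2⟩, hz.2.2⟩ (h.trans (min_le_left _ _))
  have h1 := le_csSup hSb hmem
  have h2 : δ < min (δ + η) M := lt_min (by linarith) hδM'
  rw [← hδdef] at h1
  linarith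

/-- If an immersive curve leaves the acute corner of an immersive parallelogram away from the side
of the same parity, then its endpoint is joined to the opposite corner. Each step moves the corner
along the curve while the other side of the parallelogram gets shorter by at least half of the first
side, unless the curve leaves the parallelogram at a straight angle. -/
theorem Atlas.IsBuilding.joined_of_rect (hA : A.IsBuilding) (n : ℕ) {τ : Bool} {a b c : ℝ}
    {f : Pl → X} {σ : ℝ → X} (ha : 0 ≤ a) (hb : 0 < b) (hc : 0 < c) (hab : a ≤ n * (b / 2))
    (hf : A.Imm τ (rect b a) f) (hσ : A.ISeg τ c σ) (h0 : σ 0 = f 0)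
    (hne : dart τ f 0 0 ≠ cdart τ σ) : A.Joined (f (b, a)) (σ c) := by
  induction n generalizing a b c f σ with
  | zero =>
    have ha' : a = 0 := le_antisymm (by simpa using hab) ha
    subst ha'
    have e : (0 : Pl) + b • dr 0 = (b, 0) := by ext <;> simp [dr]
    have c0 := hf.curve (e := 0) (k := 0) (c := b) (mem_rect.2 ⟨⟨le_rfl, hb.le⟩, le_rfl, le_rfl⟩)
      (by rw [e]; exact mem_rect.2 ⟨⟨hb.le, le_rfl⟩, le_rfl, le_rfl⟩)
    have := hA.joined_of_obtuse (τ := τ) hb hc c0 hσ (by simpa using h0.symm) hne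
    rwa [e] at this
  | succ n ih =>
    have e : (0 : Pl) + b • dr 0 = (b, 0) := by ext <;> simp [dr]
    have c0 := hf.curve (e := 0) (k := 0) (c := b) (mem_rect.2 ⟨⟨le_rfl, hb.le⟩, le_rfl, ha⟩)
      (by rw [e]; exact mem_rect.2 ⟨⟨hb.le, le_rfl⟩, le_rfl, ha⟩)
    rcases ha.eq_or_lt with rfl | ha'
    · have := hA.joined_of_obtuse (τ := τ) hb hc c0 hσ (by simpa using h0.symm) hne
      rwa [e] at this
    obtain ⟨g, hg, g1, g2⟩ := hA.exObt (τ := τ) hb hc c0 hσ (by simpa using h0.symm) hne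
    obtain ⟨δ, f', hδ0, hδM, hf', hx, hfg, hor⟩ := hA.branch ha' hb hc hf hg (fun r h1 h2 => by
      rw [g1 r h1 h2]; congr 1; ext <;> simp [dr]) rfl
    simp only [le_min_iff] at hδM
    obtain ⟨hδa, hδc, hδb⟩ := hδM
    have hf'0 : f' 0 = σ δ := by
      have := hfg 0 le_rfl hb.le
      rw [zero_sub, g2 δ hδ0 hδc] at this
      exact this
    rcases hδc.eq_or_lt with rfl | hδc
    · refine ⟨τ, _, f', hf', (b + δ, a - δ), ?_, 0, ?_, hx, hf'0⟩
      · exact mem_rect.2 (by refine ⟨⟨?_, ?_⟩, ?_, ?_⟩ <;> linarith)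
      · exact mem_rect.2 (by refine ⟨⟨?_, ?_⟩, ?_, ?_⟩ <;> linarith)
    have hσ' : A.ISeg τ (c - δ) fun r => σ (δ + r) := hσ.sub hδ0 (by linarith) (by linarith)
    have hd2 : cdart τ (fun r => σ (δ + r)) = dart τ g (-δ, δ) 2 :=
      cdart_congr (c - δ) (by linarith) fun r h1 h2 => by
        rw [← g2 (δ + r) (by linarith) (by linarith)]; congr 1; ext <;> simp [dr]; ring
    have hd0 : dart τ f' 0 0 = dart τ g (-δ, δ) 0 := cdart_congr b hb fun r h1 h2 => by
      have e : (0 : Pl) + r • dr 0 = (r, 0) := by ext <;> simp [dr]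
      rw [e, hfg r h1 h2]; congr 1; ext <;> simp [dr]; ring
    have hgm : ((-δ, δ) : Pl) ∈ par 0 0 b c :=
      mem_par_zero.2 (by simp; refine ⟨⟨?_, ?_⟩, ?_⟩ <;> linarith)
    have sg0 : Sees (par 0 0 b c) (-δ, δ) 0 := (isHex_par _ _ _ _).sees hgm hb (by
      rw [show ((-δ, δ) : Pl) + b • dr 0 = (b - δ, δ) by ext <;> simp [dr]; ring, mem_par_zero]
      refine ⟨⟨?_, ?_⟩, ?_, ?_⟩ <;> simp only <;> linarith)
    have sg2 : Sees (par 0 0 b c) (-δ, δ) 2 := (isHex_par _ _ _ _).sees hgm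
      (r := c - δ) (by linarith) (by
      rw [show ((-δ, δ) : Pl) + (c - δ) • dr 2 = (-c, c) by ext <;> simp [dr]; ring,
        mem_par_zero]
      refine ⟨⟨?_, ?_⟩, ?_, ?_⟩ <;> simp only <;> linarith)
    have hne' : dart τ f' 0 0 ≠ cdart τ fun r => σ (δ + r) := by
      rw [hd0, hd2]; exact (hg.2 _ hgm 0).1 sg0 sg2
    have hf'0' : σ (δ + 0) = f' 0 := by rw [add_zero, hf'0]
    have hc' : 0 < c - δ := by linarith
    have fin : A.Joined (f' (b + δ, a - δ)) ((fun r => σ (δ + r)) (c - δ)) := by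
      rcases hor with hM | hnadj
      · refine ih (σ := fun r => σ (δ + r)) (by linarith) (by linarith) hc' ?_ hf' hσ' hf'0' hne'
        have hn : (0 : ℝ) ≤ n := n.cast_nonneg
        push_cast at hab
        rcases min_choice a (min c (b / 2)) with h | h
        · have : a - δ = 0 := by rw [hM, h, sub_self]
          rw [this]; positivity
        · rcases min_choice c (b / 2) with h' | h'
          · exact absurd (hM.trans (h.trans h')) hδc.ne
          · have hd : δ = b / 2 := hM.trans (h.trans h')
            have : (n : ℝ) * (b / 2) ≤ n * ((b + δ) / 2) :=
              mul_le_mul_of_nonneg_left (by linarith) hn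
            linarith
      · rcases hδa.eq_or_lt with hd | hd
        · refine ih (σ := fun r => σ (δ + r)) (by linarith) (by linarith) hc' ?_ hf' hσ' hf'0' hne'
          rw [hd, sub_self]; positivity
        · refine hA.joined_straight (σ := fun r => σ (δ + r)) (by linarith) (by linarith) hc' hf' hσ' hf'0' ?_
          rw [hd2]; exact hnadj
    simp only [add_sub_cancel] at fin
    rwa [hx] at fin

/-- The endpoints of two immersive curves of opposite parities starting at the same point are
joined. -/
theorem Atlas.IsBuilding.joined_of_curves (hA : A.IsBuilding) {τ : Bool} {a c : ℝ} {γ σ : ℝ → X}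
    (ha : 0 < a) (hc : 0 < c) (hγ : A.ISeg (!τ) a γ) (hσ : A.ISeg τ c σ) (h0 : γ 0 = σ 0) :
    A.Joined (γ a) (σ c) := by
  by_cases hadj : A.Adj (cdart (!τ) γ) (cdart τ σ)
  swap
  · have hr := hγ.rev ha.le
    rw [Bool.not_not] at hr
    obtain ⟨γ', h1, h2, h3⟩ := exists_concat ha hc hr hσ (by simpa using h0) (by
      simp only [sub_sub_cancel]; exact fun h => hadj h.symm)
    have := h1.joined le_rfl (by linarith) (r' := a + c) (by linarith) le_rfl
    rwa [h2 0 ha.le, h3 c hc.le, sub_zero] at this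
  -- a chart containing the chamber between the two curves
  have hdσ := hσ.isDart hc
  obtain ⟨t, ht1, ht2⟩ := hA.exists_adj_ne (v := cdart (!τ) γ) hdσ
  have ht : t.1 = !τ := ht1.type
  obtain ⟨μ, hμ, hμ0, hμt⟩ := hA.exists_ray (hdσ.of_adj ht1)
  rw [ht] at hμ hμt
  obtain ⟨g, hg, g1, g2⟩ := hA.exObt ha one_pos hγ (hμ 1 zero_le_one) (h0.trans hμ0.symm)
    (by rw [hμt]; exact ht2.symm)
  have hP := isHex_par 0 0 a 1
  have hm0 : (0 : Pl) ∈ par 0 0 a 1 := mem_par_zero.2 (by simp [ha.le])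
  have d0 : dart (!τ) g 0 0 = cdart (!τ) γ := cdart_congr a ha fun r h1 h2 => by
    rw [← g1 r h1 h2]; congr 1; ext <;> simp [dr]
  have d2 : dart (!τ) g 0 2 = t := by
    rw [← hμt]
    exact cdart_congr 1 one_pos fun r h1 h2 => by
      rw [← g2 r h1 h2]; congr 1; ext <;> simp [dr]
  have s0 : Sees (par 0 0 a 1) 0 0 := hP.sees hm0 ha (mem_par_zero.2 (by simp [dr, ha.le]))
  have s2 : Sees (par 0 0 a 1) 0 2 := hP.sees hm0 one_pos (mem_par_zero.2 (by simp [dr, ha.le]))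
  have s1 : Sees (par 0 0 a 1) 0 1 := hP.sees hm0 (r := min a 1) (lt_min ha one_pos)
    (mem_par_zero.2 (by simp [dr, ha.le]))
  have d1 : dart (!τ) g 0 1 = cdart τ σ := by
    have a1 := A.adj_of_chart hg.1 hm0 s0 s1
    have a2 := A.adj_of_chart hg.1 hm0 s1 s2
    rw [d0] at a1
    refine hA.unique_mid a1 a2 hadj ?_ ?_
    · exact d2 ▸ ht1
    · exact d2.symm ▸ ht2.symm
  obtain ⟨-, s', hs', hgs⟩ := cdart_eq_iff.1 d1
  obtain ⟨s, hs0, hss', hsa, hsc, hs1⟩ : ∃ s > 0, s < s' ∧ s < a ∧ s < c ∧ s < 1 := by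
    obtain ⟨s, h1, h2⟩ := exists_between (show (0 : ℝ) < min (min s' a) (min c 1) from
      lt_min (lt_min hs' ha) (lt_min hc one_pos))
    simp only [lt_min_iff] at h2
    exact ⟨s, h1, h2.1.1, h2.1.2, h2.2.1, h2.2.2⟩
  have hgσ : ∀ r, 0 ≤ r → r ≤ s → g (0, r) = σ r := by
    intro r h1 h2
    rw [← hgs r h1 (by linarith)]; congr 1; ext <;> simp [dr]
  -- the same chart, with the corner moved to `σ s`
  have hfr : ∀ u w : ℝ, fr (0, s) 5 (u, w) = (u + w, s - u) := fun u w => by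
    have : (5 : Fin 6) + 1 = 0 := rfl
    ext <;> simp [fr, this, dr]; ring
  have ht5 : typ (!τ) 5 = τ := by simp [typ]
  have hf : A.Imm τ (rect s (a - s)) fun z => g (fr (0, s) 5 z) := by
    have := hg.frame (0, s) 5
    rw [ht5] at this
    refine this.mono (isHex_rect _ _) ?_
    rintro ⟨u, w⟩ ⟨⟨h1, h2⟩, h3, h4⟩
    rw [Set.mem_preimage, hfr, mem_par_zero]
    simp only at h1 h2 h3 h4 ⊢
    refine ⟨⟨?_, ?_⟩, ?_, ?_⟩ <;> linarith
  have hsP : ((0, s) : Pl) ∈ par 0 0 a 1 := mem_par_zero.2 (by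
    simp; refine ⟨⟨?_, ?_⟩, ?_, ?_⟩ <;> linarith)
  have e4 : ((0, s) : Pl) + s • dr 4 = 0 := by ext <;> simp [dr]
  have e5 : ((0, s) : Pl) + s • dr 5 = (s, 0) := by ext <;> simp [dr]
  have s4 : Sees (par 0 0 a 1) (0, s) 4 := hP.sees hsP hs0 (by rw [e4]; exact hm0)
  have s5 : Sees (par 0 0 a 1) (0, s) 5 := hP.sees hsP hs0 (by
    rw [e5]; exact mem_par_zero.2 (by simp; exact ⟨hs0.le, hsa.le⟩))
  have hne : dart τ (fun z => g (fr (0, s) 5 z)) 0 0 ≠ cdart τ fun r => σ (s + r) := by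
    have e := dart_fr (τ := !τ) (f := g) (e := (0, s)) (k := 5) (z := 0) (j := 0)
    rw [ht5, fr_zero, add_zero] at e
    rw [e]
    intro hcon
    have a45 := A.adj_of_chart hg.1 hsP s4 (k := 4) s5
    have d4 : dart (!τ) g (0, s) 4 = cdart (!τ) fun r => σ (s - r) :=
      cdart_congr s hs0 fun r h1 h2 => by
        rw [← hgσ (s - r) (by linarith) (by linarith)]; congr 1; ext <;> simp [dr]; ring
    rw [d4, show (4 : Fin 6) + 1 = 5 from rfl, hcon] at a45
    exact hσ.straight hs0 hsc a45.symm
  obtain ⟨n, hn⟩ := exists_nat_ge ((a - s) / (s / 2))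
  have hn' : a - s ≤ n * (s / 2) := by rwa [div_le_iff₀ (by linarith)] at hn
  have := hA.joined_of_rect n (by linarith) hs0 (c := c - s) (by linarith) hn' hf
    (hσ.sub hs0.le (by linarith) (by linarith)) (by
      simp only [add_zero, fr_zero]; exact (hgσ s hs0.le le_rfl).symm) hne
  simp only [hfr, add_sub_cancel, sub_self] at this
  rwa [g1 a ha.le le_rfl] at this

theorem Atlas.Imm.swap {τ : Bool} {b a : ℝ} {f : Pl → X} (hf : A.Imm τ (rect b a) f) :
    A.Imm (!τ) (rect a b) fun z => f (z.2, z.1) := by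
  have h : ∀ z : Pl, fr 0 1 (reflR z) = (z.2, z.1) := fun z => by
    ext <;> simp [fr, reflR, dr]
  have := (hf.frame 0 1).reflect
  simp only [h] at this
  refine Atlas.Imm.mono (τ := !τ) this (isHex_rect _ _) ?_
  rintro z ⟨h1, h2⟩
  rw [Set.mem_preimage, Set.mem_preimage, h]
  exact ⟨h2, h1⟩

/-- Two joined points are the acute corners of an immersive parallelogram. -/
theorem Atlas.Joined.exists_rect {x y : X} (h : A.Joined x y) (τ : Bool) : ∃ a b f, 0 ≤ a ∧ 0 ≤ b ∧
    A.Imm τ (rect b a) f ∧ f (b, a) = x ∧ f 0 = y := by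
  obtain ⟨τ', s, f, hf, z, hz, w, hw, rfl, rfl⟩ := h
  obtain ⟨k, p, q, hp, hq, hk⟩ := exists_chamber (z - w)
  have hz' : z = w + p • dr k + q • dr (k + 1) := by rw [add_assoc, ← hk]; abel
  have key : A.Imm (typ τ' k) (rect p q) fun z => f (fr w k z) := by
    refine (hf.frame w k).mono (isHex_rect _ _) ?_
    rintro u ⟨⟨h1, h2⟩, h3, h4⟩
    rw [hz'] at hz
    exact hf.isHex.acute_hull k hw hz h1 h2 h3 h4
  by_cases ht : typ τ' k = τ
  · rw [ht] at key
    exact ⟨q, p, _, hq, hp, key, by rw [hz']; rfl, by rw [fr_zero]⟩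
  · have ht' : (!typ τ' k) = τ := by
      revert ht; cases typ τ' k <;> cases τ <;> simp
    have key' := key.swap
    rw [ht'] at key'
    exact ⟨p, q, _, hp, hq, key', by rw [hz']; rfl, congrArg f (fr_zero w k)⟩

/-- A point that is joined to the start of an immersive curve is joined to its end: if the two are
acute corners of a parallelogram, `joined_of_rect` applies at the point where the curve leaves the side
of the parallelogram. -/
theorem Atlas.IsBuilding.joined_trans_curve (hA : A.IsBuilding) {τ : Bool} {c : ℝ} {x : X}
    {σ : ℝ → X} (hc : 0 < c) (hσ : A.ISeg τ c σ) (h : A.Joined x (σ 0)) : A.Joined x (σ c) := by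
  obtain ⟨a, b, f, ha, hb, hf, rfl, h0⟩ := h.exists_rect τ
  -- the case of a parallelogram with empty interior and no side of parity `τ`
  have key : ∀ (g : ℝ → X) (σ' : ℝ → X) (c' : ℝ), 0 < c' → A.ISeg (!τ) a g → A.ISeg τ c' σ' →
      g 0 = σ' 0 → A.Joined (g a) (σ' c') := by
    intro g σ' c' hc' hg hσ' hg0
    rcases ha.eq_or_lt with rfl | ha'
    · rw [hg0]; exact hσ'.joined le_rfl hc'.le hc'.le le_rfl
    · exact hA.joined_of_curves ha' hc' hg hσ' hg0
  have side : ∀ p, 0 ≤ p → p ≤ b → A.ISeg (!τ) a fun r => f (p, r) := by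
    intro p h1 h2
    have := hf.curve (e := (p, 0)) (k := 1) (c := a) (mem_rect.2 ⟨⟨h1, h2⟩, le_rfl, ha⟩) (by
      rw [show ((p, 0) : Pl) + a • dr 1 = (p, a) by ext <;> simp [dr]]
      exact mem_rect.2 ⟨⟨h1, h2⟩, ha, le_rfl⟩)
    refine Atlas.ISeg.congr (τ := !τ) this fun r _ _ => ?_
    congr 1; ext <;> simp [dr]
  -- the largest `δ` for which the curve runs along the parallelogram up to `δ`
  let m := min b c
  have hm0 : 0 ≤ m := le_min hb hc.le
  have hmb : m ≤ b := min_le_left _ _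
  have hmc : m ≤ c := min_le_right _ _
  let S : Set ℝ := {δ | 0 ≤ δ ∧ δ ≤ m ∧ ∀ r, 0 ≤ r → r ≤ δ → f (r, 0) = σ r}
  have hS0 : (0 : ℝ) ∈ S := ⟨le_rfl, hm0, fun r h1 h2 => by
    rw [le_antisymm h2 h1]; exact h0⟩
  have hSb : BddAbove S := ⟨m, fun x hx => hx.2.1⟩
  have bot : A.ISeg τ m fun r => f (r, 0) := by
    have := hf.curve (e := 0) (k := 0) (c := m) (mem_rect.2 ⟨⟨le_rfl, hb⟩, le_rfl, ha⟩) (by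
      rw [show (0 : Pl) + m • dr 0 = (m, 0) by ext <;> simp [dr]]
      exact mem_rect.2 ⟨⟨hm0, hmb⟩, le_rfl, ha⟩)
    refine Atlas.ISeg.congr (τ := τ) this fun r _ _ => ?_
    congr 1; ext <;> simp [dr]
  have hS : sSup S ∈ S := by
    have hle : sSup S ≤ m := csSup_le ⟨0, hS0⟩ fun x hx => hx.2.1
    have hlt : ∀ r, 0 ≤ r → r < sSup S → f (r, 0) = σ r := by
      intro r h1 h2
      obtain ⟨δ, h3, h4⟩ := exists_lt_of_lt_csSup ⟨0, hS0⟩ h2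
      exact h3.2.2 r h1 h4.le
    refine ⟨le_csSup hSb hS0, hle, fun r h1 h2 => ?_⟩
    rcases h2.lt_or_eq with h2 | h2
    · exact hlt r h1 h2
    rcases h1.eq_or_lt with h1 | h1
    · rw [← h1]; exact h0
    have hcl := isClosed_eqLocus bot.1 (hσ.take hm0 hmc).1
    have hlim : Filter.Tendsto (fun t : ℝ => ((t, 0) : Pl)) (𝓝[<] r) (𝓝 (r, 0)) := by
      have : Continuous fun t : ℝ => ((t, 0) : Pl) := by fun_prop
      exact (this.tendsto r).mono_left nhdsWithin_le_nhds
    refine (hcl.mem_of_tendsto hlim ?_).2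
    have : ∀ᶠ t in 𝓝[<] r, t ∈ Set.Ioo 0 r := Ioo_mem_nhdsLT h1
    filter_upwards [this] with t ht
    exact ⟨mem_hseg.2 ⟨ht.1.le, by linarith [ht.2]⟩, hlt t ht.1.le (by linarith [ht.2])⟩
  obtain ⟨δ, hδdef⟩ : ∃ δ, δ = sSup S := ⟨_, rfl⟩
  rw [← hδdef] at hS
  obtain ⟨hδ0, hδm, hδ⟩ := hS
  have hδe := hδ δ hδ0 le_rfl
  rcases (hδm.trans hmc).eq_or_lt with hδc | hδc
  · rw [← hδc, ← hδe]
    exact ⟨τ, _, f, hf, (b, a), mem_rect.2 ⟨⟨hb, le_rfl⟩, ha, le_rfl⟩, (δ, 0),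
      mem_rect.2 ⟨⟨hδ0, by linarith⟩, le_rfl, ha⟩, rfl, rfl⟩
  have hσ' : A.ISeg τ (c - δ) fun r => σ (δ + r) := hσ.sub hδ0 (by linarith) (by linarith)
  rcases (hδm.trans hmb).eq_or_lt with hδb | hδb
  · have := key _ _ (c - δ) (by linarith) (side b hb le_rfl) hσ' (by simpa [hδb] using hδe)
    rwa [add_sub_cancel] at this
  have hf' : A.Imm τ (rect (b - δ) a) fun z => f (fr (δ, 0) 0 z) := by
    refine Atlas.Imm.mono (τ := τ) (hf.frame (δ, 0) 0) (isHex_rect _ _) ?_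
    rintro z ⟨⟨h1, h2⟩, h3, h4⟩
    rw [Set.mem_preimage, fr_std]
    refine ⟨⟨?_, ?_⟩, ?_, ?_⟩ <;> simp <;> linarith
  have hne : dart τ (fun z => f (fr (δ, 0) 0 z)) 0 0 ≠ cdart τ fun r => σ (δ + r) := by
    intro hcon
    obtain ⟨-, η, hη, h⟩ := cdart_eq_iff.1 hcon
    have hmem : min (δ + η) m ∈ S := by
      refine ⟨le_min (by linarith) hm0, min_le_right _ _, fun r h1 h2 => ?_⟩
      rcases le_total r δ with h3 | h3
      · exact hδ r h1 h3
      · have := h (r - δ) (by linarith) (by have := min_le_left (δ + η) m; linarith)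
        rw [add_sub_cancel] at this
        rw [← this]; congr 1; ext <;> simp [fr_std, dr]
    have h1 := le_csSup hSb hmem
    have h2 : δ < min (δ + η) m := lt_min (by linarith) (lt_min hδb hδc)
    rw [← hδdef] at h1
    linarith
  obtain ⟨n, hn⟩ := exists_nat_ge (a / ((b - δ) / 2))
  have hn' : a ≤ n * ((b - δ) / 2) := by rwa [div_le_iff₀ (by linarith)] at hn
  have := hA.joined_of_rect n ha (by linarith) (by linarith) hn' hf' hσ' (by
    rw [fr_zero, add_zero]; exact hδe.symm) hne
  rw [add_sub_cancel, fr_std] at this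
  simpa using this

/-- Being joined to `x` is constant along every chart on a segment. -/
theorem Atlas.IsBuilding.joined_of_chart_curve (hA : A.IsBuilding) {τ : Bool} {c : ℝ} {x : X}
    {γ : ℝ → X} (hc : 0 ≤ c) (hγ : A.Chart τ (hseg c) fun z => γ z.1) (h : A.Joined x (γ 0)) :
    A.Joined x (γ c) := by
  refine real_induction (ℓ := c) (P := fun r => A.Joined x (γ r)) (fun _ => h) ?_ ?_ c hc le_rfl
  · intro r h0 hrc hP
    have := chart_curve hγ (e := (r, 0)) (k := 0) (c := c - r) (mem_hseg.2 ⟨h0, hrc.le⟩) (by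
      rw [show ((r, 0) : Pl) + (c - r) • dr 0 = (c, 0) by ext <;> simp [dr]]
      exact mem_hseg.2 ⟨hc, le_rfl⟩)
    obtain ⟨δ, hδ, -, hs⟩ := hA.exists_iseg (τ := τ)
      (γ := fun t => γ (((r, 0) : Pl) + t • dr 0).1) (by linarith) this
    have e : ∀ t : ℝ, (((r, 0) : Pl) + t • dr 0).1 = r + t := fun t => by simp [dr]
    simp only [e] at hs
    refine ⟨δ, hδ, fun r' h1 h2 h3 => ?_⟩
    rcases h1.eq_or_lt with rfl | h1
    · exact hP _ h0 le_rfl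
    · have := hA.joined_trans_curve (x := x) (c := r' - r) (by linarith)
        (hs.take (by linarith) (by linarith)) (by simpa using hP r h0 le_rfl)
      rwa [add_sub_cancel] at this
  · intro r h0 hrc hP
    have := chart_curve hγ (e := (r, 0)) (k := 3) (c := r) (mem_hseg.2 ⟨h0.le, hrc⟩) (by
      rw [show ((r, 0) : Pl) + r • dr 3 = (0, 0) by ext <;> simp [dr]]
      exact mem_hseg.2 ⟨le_rfl, hc⟩)
    obtain ⟨δ, hδ, hδr, hs⟩ := hA.exists_iseg (τ := typ τ 3)
      (γ := fun t => γ (((r, 0) : Pl) + t • dr 3).1) h0 this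
    have e : ∀ t : ℝ, (((r, 0) : Pl) + t • dr 3).1 = r - t := fun t => by
      simp [dr, sub_eq_add_neg]
    simp only [e] at hs
    have := hA.joined_trans_curve (x := x) hδ (hs.rev hδ.le)
      (by simpa using hP (r - δ) (by linarith) (by linarith))
    simpa using this

theorem Atlas.Joined.refl (A : Atlas X) (x : X) : A.Joined x x := by
  refine ⟨true, {0}, _, ⟨A.point x, fun e he k => ?_⟩, 0, rfl, 0, rfl, rfl, rfl⟩
  obtain rfl : e = 0 := he
  have hk : ¬ Sees ({0} : Set Pl) 0 k := fun h => by
    obtain ⟨c, hc, hm⟩ := h.exists_mem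
    rw [Set.mem_singleton_iff, zero_add, smul_eq_zero] at hm
    rcases hm with hm | hm
    · exact hc.ne' hm
    · fin_cases k <;> simp [dr] at hm
  exact ⟨fun h => absurd h hk, fun h => absurd h hk⟩

/-- Two points of a hexagonal region are connected in it by two segments with the directions of
walls. -/
theorem Atlas.IsBuilding.joined_of_chart (hA : A.IsBuilding) {τ : Bool} {s : Set Pl} {f : Pl → X}
    (hf : A.Chart τ s f) {x : X} {z w : Pl} (hz : z ∈ s) (hw : w ∈ s) (h : A.Joined x (f z)) :
    A.Joined x (f w) := by
  obtain ⟨k, p, q, hp, hq, hzw⟩ := exists_chamber (w - z)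
  obtain rfl : w = z + p • dr k + q • dr (k + 1) := by rw [add_assoc, ← hzw]; abel
  have hm : z + p • dr k ∈ s := by
    have := (A.isHex hf).acute_hull k hz hw hp le_rfl le_rfl hq
    simpa using this
  have h1 := hA.joined_of_chart_curve (x := x) (γ := fun r => f (z + r • dr k)) hp
    (chart_curve hf hz hm) (by simpa using h)
  exact hA.joined_of_chart_curve (γ := fun r => f (z + p • dr k + r • dr (k + 1))) hq
    (chart_curve hf hm hw) (by simpa using h1)

/-! ### Apartments from three sectors -/

/-- Two infinite curves of the same parity leaving a point in different directions are the sides of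
an immersive sector of angle `120°`. -/
theorem Atlas.IsBuilding.exists_sector (hA : A.IsBuilding) {τ : Bool} {α β : ℝ → X}
    (hα : ∀ T, 0 ≤ T → A.ISeg τ T α) (hβ : ∀ T, 0 ≤ T → A.ISeg τ T β) (h0 : α 0 = β 0)
    (hne : cdart τ α ≠ cdart τ β) : ∃ S : Pl → X, (∀ N, A.Imm τ (par 0 0 N N) S) ∧
      (∀ r, 0 ≤ r → S (r, 0) = α r) ∧ ∀ r, 0 ≤ r → S (-r, r) = β r := by
  have hex : ∀ n : ℕ, ∃ h, A.Imm τ (par 0 0 (n + 1) (n + 1)) h ∧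
      (∀ r, 0 ≤ r → r ≤ (n : ℝ) + 1 → h (r, 0) = α r) ∧
      ∀ r, 0 ≤ r → r ≤ (n : ℝ) + 1 → h (-r, r) = β r := fun n =>
    hA.exObt (by positivity) (by positivity) (hα _ (by positivity)) (hβ _ (by positivity)) h0 hne
  choose h hh h1 h2 using hex
  have hsub : ∀ {a b : ℝ}, a ≤ b → par 0 0 a a ⊆ par 0 0 b b := by
    intro a b hab z hz
    rw [mem_par_zero] at hz ⊢
    obtain ⟨⟨g1, g2⟩, g3, g4⟩ := hz
    exact ⟨⟨g1, g2.trans hab⟩, g3, g4.trans hab⟩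
  have hcoh : ∀ n m : ℕ, n ≤ m → ∀ z ∈ par 0 0 ((n : ℝ) + 1) (n + 1), h m z = h n z := by
    intro n m hnm
    have hnm' : (n : ℝ) + 1 ≤ m + 1 := by exact_mod_cast Nat.succ_le_succ hnm
    refine hA.par_unique ((hh m).mono (isHex_par _ _ _ _) (hsub hnm')) (hh n) (by positivity) ?_ ?_
    · intro r g1 g2
      rw [h1 m r g1 (g2.trans hnm'), h1 n r g1 g2]
    · intro r g1 g2
      rw [h2 m r g1 (g2.trans hnm'), h2 n r g1 g2]
  have key : ∀ (n : ℕ), ∀ z ∈ par 0 0 ((n : ℝ) + 1) (n + 1), h ⌈|z.1| + |z.2|⌉₊ z = h n z := by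
    intro n z hz
    rcases le_total ⌈|z.1| + |z.2|⌉₊ n with hle | hle
    · refine (hcoh _ _ hle z ?_).symm
      have hc := Nat.le_ceil (|z.1| + |z.2|)
      rw [mem_par_zero] at hz ⊢
      obtain ⟨⟨g1, g2⟩, g3, g4⟩ := hz
      have a1 := le_abs_self z.1
      have a2 := le_abs_self z.2
      have a3 := abs_nonneg z.1
      have a4 := abs_nonneg z.2
      refine ⟨⟨g1, ?_⟩, g3, ?_⟩ <;> linarith
    · exact hcoh _ _ hle z hz
  refine ⟨fun z => h ⌈|z.1| + |z.2|⌉₊ z, fun N => ?_, fun r hr => ?_, fun r hr => ?_⟩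
  · have hN : N ≤ (⌈N⌉₊ : ℝ) + 1 := by have := Nat.le_ceil N; linarith
    exact ((hh ⌈N⌉₊).congr (key ⌈N⌉₊)).mono (isHex_par _ _ _ _) (hsub hN)
  · have hN : r ≤ (⌈r⌉₊ : ℝ) + 1 := by have := Nat.le_ceil r; linarith
    rw [← h1 ⌈r⌉₊ r hr hN]
    refine key ⌈r⌉₊ (r, 0) (mem_par_zero.2 ?_)
    simp only [add_zero]
    exact ⟨⟨le_rfl, by linarith⟩, hr, hN⟩
  · have hN : r ≤ (⌈r⌉₊ : ℝ) + 1 := by have := Nat.le_ceil r; linarith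
    rw [← h2 ⌈r⌉₊ r hr hN]
    refine key ⌈r⌉₊ (-r, r) (mem_par_zero.2 ?_)
    simp only [neg_add_cancel]
    exact ⟨⟨hr, hN⟩, le_rfl, by linarith⟩

/-- The regular hexagon of radius `N` around the origin. -/
def hexa (N : ℝ) : Set Pl := {z | (-N ≤ z.1 ∧ z.1 ≤ N) ∧ (-N ≤ z.2 ∧ z.2 ≤ N) ∧
  (-N ≤ z.1 + z.2 ∧ z.1 + z.2 ≤ N)}

/-- A function on the plane that restricts to immersive charts on the three sectors of angle `120°`
which are bounded by the directions `dr 0`, `dr 2`, `dr 4`, and whose darts at the origin form a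
hexagon. -/
structure Atlas.IsTripod (A : Atlas X) (τ : Bool) (H : Pl → X) : Prop where
  imm : ∀ N, A.Imm τ (par 0 0 N N) H ∧ A.Imm τ (par 0 2 N N) H ∧ A.Imm τ (par 0 4 N N) H
  ne : ∀ k, dart τ H 0 k ≠ dart τ H 0 (k + 2)
  notAdj : ∀ k, ¬ A.Adj (dart τ H 0 k) (dart τ H 0 (k + 3))

theorem par_frame_frame (k j : Fin 6) (a b : ℝ) : fr 0 k ⁻¹' (par 0 (k + j) a b) = par 0 j a b := by
  obtain ⟨e', h1, h2⟩ := exists_fr_inv 0 k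
  have h : ∀ p q : ℝ, fr 0 k (0 + p • dr j + q • dr (j + 2)) =
      0 + p • dr (k + j) + q • dr (k + j + 2) := by
    intro p q
    rw [fr_line, fr_line, fr_zero, add_assoc k]
  ext z
  constructor
  · rintro ⟨p, q, hp, hq, hz⟩
    refine ⟨p, q, hp, hq, ?_⟩
    rw [← h2 z, hz, ← h, h2]
  · rintro ⟨p, q, hp, hq, rfl⟩
    exact ⟨p, q, hp, hq, h p q⟩

/-- The three sectors play the same role. -/
theorem Atlas.IsTripod.rotate {τ : Bool} {H : Pl → X} (hH : A.IsTripod τ H) :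
    A.IsTripod τ fun z => H (fr 0 2 z) := by
  have hd : ∀ k, dart τ (fun z => H (fr 0 2 z)) 0 k = dart τ H 0 (2 + k) := by
    intro k
    have := dart_fr (τ := τ) (f := H) (e := 0) (k := 2) (z := 0) (j := k)
    rwa [fr_zero] at this
  refine ⟨fun N => ⟨?_, ?_, ?_⟩, fun k => ?_, fun k => ?_⟩
  · have := (hH.imm N).2.1.frame 0 2
    rwa [par_frame] at this
  · have := (hH.imm N).2.2.frame 0 2
    rwa [show (4 : Fin 6) = 2 + 2 from rfl, par_frame_frame] at this
  · have := (hH.imm N).1.frame 0 2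
    rwa [show (0 : Fin 6) = 2 + 4 from rfl, par_frame_frame] at this
  · rw [hd, hd, ← add_assoc]; exact hH.ne _
  · rw [hd, hd, ← add_assoc]; exact hH.notAdj _

theorem mem_par_four {a b : ℝ} {z : Pl} : z ∈ par 0 4 a b ↔
    (0 ≤ z.1 ∧ z.1 ≤ b) ∧ 0 ≤ -z.2 ∧ -z.2 ≤ a := by
  constructor
  · rintro ⟨p, q, ⟨h1, h2⟩, ⟨h3, h4⟩, rfl⟩
    simp [dr]
    exact ⟨⟨h3, h4⟩, h1, h2⟩
  · rintro ⟨⟨h3, h4⟩, h5, h6⟩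
    refine ⟨-z.2, z.1, ⟨h5, h6⟩, ⟨h3, h4⟩, ?_⟩
    ext <;> simp [dr]

theorem mem_par_two {a b : ℝ} {z : Pl} : z ∈ par 0 2 a b ↔
    (0 ≤ -z.1 ∧ -z.1 ≤ a) ∧ 0 ≤ -z.1 - z.2 ∧ -z.1 - z.2 ≤ b := by
  constructor
  · rintro ⟨p, q, ⟨h1, h2⟩, ⟨h3, h4⟩, rfl⟩
    simp [dr]
    refine ⟨⟨?_, ?_⟩, ?_, ?_⟩ <;> linarith
  · rintro ⟨⟨h3, h4⟩, h5, h6⟩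
    refine ⟨-z.1, -z.1 - z.2, ⟨h3, h4⟩, ⟨h5, h6⟩, ?_⟩
    ext <;> simp [dr]

theorem Atlas.IsTripod.chart {τ : Bool} {H : Pl → X} (hH : A.IsTripod τ H) (N : ℝ) :
    A.Chart τ (hexa N) H := by
  refine A.glue (ι := Fin 3) ![par 0 0 N N, par 0 2 N N, par 0 4 N N] (isHex_mk _ _ _ _ _ _) ?_ ?_
  · intro z
    rw [Fin.exists_fin_succ, Fin.exists_fin_two]
    change _ ↔ z ∈ par 0 0 N N ∨ z ∈ par 0 2 N N ∨ z ∈ par 0 4 N N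
    rw [mem_par_zero, mem_par_two, mem_par_four]
    simp only [hexa, Set.mem_ofPred_eq]
    constructor
    · rintro ⟨⟨h1, h2⟩, ⟨h3, h4⟩, h5, h6⟩
      by_cases g1 : 0 ≤ z.2 ∧ 0 ≤ z.1 + z.2
      · exact Or.inl ⟨⟨g1.1, h4⟩, g1.2, h6⟩
      · by_cases g2 : 0 ≤ z.1
        · refine Or.inr (Or.inr ⟨⟨g2, h2⟩, ?_, by linarith⟩)
          by_contra hc
          exact g1 ⟨by linarith, by linarith⟩
        · refine Or.inr (Or.inl ⟨⟨by linarith, by linarith⟩, ?_, by linarith⟩)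
          by_contra hc
          exact g1 ⟨by linarith, by linarith⟩
    · rintro (⟨⟨h1, h2⟩, h3, h4⟩ | ⟨⟨h1, h2⟩, h3, h4⟩ | ⟨⟨h1, h2⟩, h3, h4⟩) <;>
        refine ⟨⟨?_, ?_⟩, ⟨?_, ?_⟩, ?_, ?_⟩ <;> linarith
  · intro i
    fin_cases i
    · exact (hH.imm N).1.1
    · exact (hH.imm N).2.1.1
    · exact (hH.imm N).2.2.1

theorem Atlas.IsTripod.adj {τ : Bool} {H : Pl → X} (hH : A.IsTripod τ H) (e : Pl) (k : Fin 6) :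
    A.Adj (dart τ H e k) (dart τ H e (k + 1)) := by
  have a1 := neg_abs_le e.1
  have a2 := neg_abs_le e.2
  have a3 := le_abs_self e.1
  have a4 := le_abs_self e.2
  have he : ∀ j, e + (1 : ℝ) • dr j ∈ hexa (|e.1| + |e.2| + 1) := by
    intro j
    have a5 := abs_nonneg e.1
    have a6 := abs_nonneg e.2
    simp only [hexa, Set.mem_ofPred_eq]
    fin_cases j <;> simp [dr] <;> refine ⟨⟨?_, ?_⟩, ⟨?_, ?_⟩, ?_, ?_⟩ <;> linarith
  have h0 : e ∈ hexa (|e.1| + |e.2| + 1) := by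
    have a5 := abs_nonneg e.1
    have a6 := abs_nonneg e.2
    simp only [hexa, Set.mem_ofPred_eq]
    refine ⟨⟨?_, ?_⟩, ⟨?_, ?_⟩, ?_, ?_⟩ <;> linarith
  have hx : IsHex (hexa (|e.1| + |e.2| + 1)) := isHex_mk _ _ _ _ _ _
  exact A.adj_of_chart (hH.chart _) h0 (hx.sees h0 one_pos (he _)) (hx.sees h0 one_pos (he _))

/-- The darts of `H` at `e` form a hexagon. -/
def Atlas.HexAt (A : Atlas X) (τ : Bool) (H : Pl → X) (e : Pl) : Prop :=
  ∀ k, dart τ H e k ≠ dart τ H e (k + 2) ∧ ¬ A.Adj (dart τ H e k) (dart τ H e (k + 3))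

theorem Atlas.HexAt.of_rotate {τ : Bool} {H : Pl → X} {k : Fin 6} {e : Pl}
    (h : A.HexAt (typ τ k) (fun z => H (fr 0 k z)) e) : A.HexAt τ H (fr 0 k e) := by
  intro j
  have := h (j - k)
  simp only [dart_fr] at this
  have e2 : k + (j - k + 2) = j + 2 := by abel
  have e3 : k + (j - k + 3) = j + 3 := by abel
  rwa [add_sub_cancel, e2, e3] at this

theorem Atlas.IsTripod.hexAt_interior {τ : Bool} {H : Pl → X} (hH : A.IsTripod τ H) {e : Pl}
    (h1 : 0 < e.2) (h2 : 0 < e.1 + e.2) : A.HexAt τ H e := by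
  let m := min e.2 (e.1 + e.2)
  have hm : 0 < m := lt_min h1 h2
  have m1 : m ≤ e.2 := min_le_left _ _
  have m2 : m ≤ e.1 + e.2 := min_le_right _ _
  let N := e.2 + (e.1 + e.2) + m
  have hN : N = e.2 + (e.1 + e.2) + m := rfl
  have h0 : e ∈ par 0 0 N N := by
    rw [mem_par_zero]; refine ⟨⟨?_, ?_⟩, ?_, ?_⟩ <;> linarith
  have hs : ∀ k, Sees (par 0 0 N N) e k := by
    intro k
    refine (isHex_par _ _ _ _).sees h0 hm ?_
    rw [mem_par_zero]
    fin_cases k <;> simp [dr] <;> refine ⟨⟨?_, ?_⟩, ?_, ?_⟩ <;> linarith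
  intro k
  have := ((hH.imm N).1.2 e h0 k)
  exact ⟨this.1 (hs _) (hs _), this.2 (hs _) (hs _)⟩

/-- On the ray between two sectors: if the chambers above and below a point of the ray were folded
together, the fold would propagate along the ray to the origin. -/
theorem Atlas.IsTripod.hexAt_ray (hA : A.IsBuilding) {τ : Bool} {H : Pl → X} (hH : A.IsTripod τ H)
    {t : ℝ} (ht : 0 < t) : A.HexAt τ H (t, 0) := by
  have hup := (hH.imm (2 * t)).1
  have hlo := (hH.imm (2 * t)).2.2
  have mup : ((t, 0) : Pl) ∈ par 0 0 (2 * t) (2 * t) := by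
    rw [mem_par_zero]; simp only; refine ⟨⟨?_, ?_⟩, ?_, ?_⟩ <;> linarith
  have mlo : ((t, 0) : Pl) ∈ par 0 4 (2 * t) (2 * t) := by
    rw [mem_par_four]; simp only; refine ⟨⟨?_, ?_⟩, ?_, ?_⟩ <;> linarith
  have sup : ∀ k ∈ ({0, 1, 2, 3} : Finset (Fin 6)), Sees (par 0 0 (2 * t) (2 * t)) (t, 0) k := by
    intro k hk
    refine (isHex_par _ _ _ _).sees mup ht ?_
    rw [mem_par_zero]
    fin_cases k <;> first | (simp at hk; done) | skip
    all_goals simp [dr]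
    all_goals and_intros
    all_goals linarith
  have slo : ∀ k ∈ ({3, 4, 5, 0} : Finset (Fin 6)), Sees (par 0 4 (2 * t) (2 * t)) (t, 0) k := by
    intro k hk
    refine (isHex_par _ _ _ _).sees mlo ht ?_
    rw [mem_par_four]
    fin_cases k <;> first | (simp at hk; done) | skip
    all_goals simp [dr]
    all_goals and_intros
    all_goals linarith
  have n02 := (hup.2 _ mup 0).1 (sup _ (by decide)) (sup _ (by decide))
  have n13 := (hup.2 _ mup 1).1 (sup _ (by decide)) (sup _ (by decide))
  have n03 := (hup.2 _ mup 0).2 (sup _ (by decide)) (sup _ (by decide))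
  have n35 := (hlo.2 _ mlo 3).1 (slo _ (by decide)) (slo _ (by decide))
  have n40 := (hlo.2 _ mlo 4).1 (slo _ (by decide)) (slo _ (by decide))
  have a := hH.adj (t, 0)
  have n15 : dart τ H (t, 0) 1 ≠ dart τ H (t, 0) 5 := by
    intro h15
    -- `H` is compared, above the ray, with the reflection of its values below the ray
    have hlo' := hlo.reflect
    have hsub : par 0 0 t t ⊆ reflR ⁻¹' (par 0 4 (2 * t) (2 * t)) := by
      intro z hz
      rw [mem_par_zero] at hz
      rw [Set.mem_preimage, mem_par_four]
      simp only [reflR]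
      refine ⟨⟨?_, ?_⟩, ?_, ?_⟩ <;> linarith [hz.1.1, hz.1.2, hz.2.1, hz.2.2]
    have hrefl : ∀ r : ℝ, reflR (r, 0) = (r, 0) := fun r => by ext <;> simp [reflR]
    have hd : ∀ (r : ℝ) (k : Fin 6), dart τ (fun z => H (reflR z)) (r, 0) k =
        dart τ H (r, 0) (-k) := fun r k => by rw [dart_reflR, hrefl]
    have hline : ∀ (r : ℝ), H (reflR (r, 0)) = H (r, 0) := fun r => by rw [hrefl]
    let E : Set Pl := {z | (0 ≤ z.1 ∧ z.1 ≤ 2 * t) ∧ (0 ≤ z.2 ∧ z.2 ≤ 2 * t) ∧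
      (0 ≤ z.1 + z.2 ∧ z.1 + z.2 ≤ 2 * t)}
    have hE : IsHex E := isHex_mk _ _ _ _ _ _
    have hEup : E ⊆ par 0 0 (2 * t) (2 * t) := fun z hz => mem_par_zero.2 ⟨hz.2.1, hz.2.2⟩
    have hElo : E ⊆ reflR ⁻¹' (par 0 4 (2 * t) (2 * t)) := fun z hz => by
      obtain ⟨⟨h1, h2⟩, ⟨h3, h4⟩, h5, h6⟩ := hz
      rw [Set.mem_preimage, mem_par_four]
      simp only [reflR, neg_neg]
      exact ⟨⟨h5, h6⟩, h3, h4⟩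
    have fE := hup.mono hE hEup
    have gE := hlo'.mono hE hElo
    have tE : ((t, 0) : Pl) ∈ E := by
      simp only [E, Set.mem_ofPred_eq]; refine ⟨⟨?_, ?_⟩, ⟨?_, ?_⟩, ?_, ?_⟩ <;> linarith
    have sE : ∀ k ∈ ({1, 2, 3} : Finset (Fin 6)), Sees E (t, 0) k := by
      intro k hk
      refine hE.sees tE ht ?_
      simp only [E, Set.mem_ofPred_eq]
      fin_cases k <;> first | (simp at hk; done) | skip
      all_goals simp [dr]
      all_goals and_intros
      all_goals linarith
    have d1 : dart τ H (t, 0) 1 = dart τ (fun z => H (reflR z)) (t, 0) 1 := by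
      rw [hd, h15]; rfl
    have d3 : dart τ H (t, 0) 3 = dart τ (fun z => H (reflR z)) (t, 0) 3 := by
      rw [hd]; rfl
    have d2 := hA.agree_mid (k := 1) fE gE.1 tE (sE _ (by decide)) (sE _ (by decide))
      (sE _ (by decide)) d1 d3
    let D : Set Pl := {z | (0 ≤ z.1 ∧ z.1 ≤ t) ∧ (0 ≤ z.2 ∧ z.2 ≤ t) ∧
      (0 ≤ z.1 + z.2 ∧ z.1 + z.2 ≤ t)}
    have hD : IsHex D := isHex_mk _ _ _ _ _ _
    have hDE : D ⊆ E := by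
      rintro z ⟨⟨h1, h2⟩, ⟨h3, h4⟩, h5, h6⟩
      refine ⟨⟨?_, ?_⟩, ⟨?_, ?_⟩, ?_, ?_⟩ <;> linarith
    have tD : ((t, 0) : Pl) ∈ D := by
      simp only [D, Set.mem_ofPred_eq]; refine ⟨⟨?_, ?_⟩, ⟨?_, ?_⟩, ?_, ?_⟩ <;> linarith
    have uD : ((0, t) : Pl) ∈ D := by
      simp only [D, Set.mem_ofPred_eq]; refine ⟨⟨?_, ?_⟩, ⟨?_, ?_⟩, ?_, ?_⟩ <;> linarith
    have oD : ∀ r, 0 ≤ r → r ≤ t → ((r, 0) : Pl) ∈ D := fun r h1 h2 => by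
      simp only [D, Set.mem_ofPred_eq]; refine ⟨⟨?_, ?_⟩, ⟨?_, ?_⟩, ?_, ?_⟩ <;> linarith
    have hn := hA.near_of_corner60 (k := 2) (fE.mono hD hDE).1 (gE.mono hD hDE).1 tD
      (hD.sees tD ht (by rw [show ((t, 0) : Pl) + t • dr 2 = (0, t) by ext <;> simp [dr]]; exact uD))
      (hD.sees tD ht (by
        rw [show ((t, 0) : Pl) + t • dr (2 + 1) = (0, 0) by ext <;> simp [dr]]
        exact oD 0 le_rfl ht.le)) d2 d3 (by
      rintro z ⟨⟨h1, h2⟩, ⟨h3, h4⟩, h5, h6⟩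
      refine ⟨z.2, t - z.1 - z.2, h3, by linarith, ?_⟩
      ext <;> simp [dr]
      ring)
    have hp := hA.propagate_left (e := (t, 0)) (ℓ := t) (fE.mono hD hDE) (gE.mono hD hDE)
      (fun z hz => ⟨hz.2.1.1, by simpa using hz.1.1⟩)
      (fun r h1 h2 => oD _ (by linarith) (by linarith)) (fun r h1 h2 => (hline _).symm)
      ⟨_, uD, ht⟩ hn t ht.le le_rfl
    simp only [sub_self] at hp
    obtain ⟨ε, hε, hp⟩ := eventually_nhdsWithin_pl.1 hp
    have h01 : dart τ H 0 1 = dart τ (fun z => H (reflR z)) 0 1 := by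
      refine cdart_congr (min t (ε / 2)) (lt_min ht (by linarith)) fun r h1 h2 => ?_
      rw [le_min_iff] at h2
      have e : (0 : Pl) + r • dr 1 = (0, r) := by ext <;> simp [dr]
      rw [e]
      refine hp (0, r) ?_ (by simpa using hε) (by simp [abs_of_nonneg h1]; linarith)
      simp only [D, Set.mem_ofPred_eq]
      refine ⟨⟨?_, ?_⟩, ⟨?_, ?_⟩, ?_, ?_⟩ <;> linarith [h2.1]
    have h05 : dart τ (fun z => H (reflR z)) 0 1 = dart τ H 0 5 := hd 0 1
    rw [h05] at h01
    exact hH.ne 5 h01.symm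
  have a01 := a 0
  have a12 := a 1
  have a23 := a 2
  have a34 := a 3
  have a45 := a 4
  have a50 := a 5
  simp only [Fin.reduceAdd] at a01 a12 a23 a34 a45 a50 n02 n13 n03 n35 n40
  have n24 : dart τ H (t, 0) 2 ≠ dart τ H (t, 0) 4 := fun h => by
    rw [← h] at a45
    rcases hA.noSquare a12 a45 a01.symm a50.symm with h' | h'
    · exact n15 h'
    · exact n02 h'.symm
  have n14 : ¬ A.Adj (dart τ H (t, 0) 1) (dart τ H (t, 0) 4) := fun h => by
    rcases hA.noSquare a01 h a50.symm a45.symm with h' | h'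
    · exact n40 h'.symm
    · exact n15 h'
  have n25 : ¬ A.Adj (dart τ H (t, 0) 2) (dart τ H (t, 0) 5) := fun h => by
    rcases hA.noSquare a12 h a01.symm a50.symm with h' | h'
    · exact n15 h'
    · exact n02 h'.symm
  intro k
  fin_cases k <;> simp only [Fin.reduceFinMk, Fin.reduceAdd, Fin.zero_eta, Fin.mk_one, zero_add]
  · exact ⟨n02, n03⟩
  · exact ⟨n13, n14⟩
  · exact ⟨n24, n25⟩
  · exact ⟨n35, fun h => n03 h.symm⟩
  · exact ⟨n40, fun h => n14 h.symm⟩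
  · exact ⟨n15.symm, fun h => n25 h.symm⟩

theorem Atlas.IsTripod.hexAt (hA : A.IsBuilding) {τ : Bool} {H : Pl → X} (hH : A.IsTripod τ H)
    (e : Pl) : A.HexAt τ H e := by
  -- the half-open sector from `dr 0` to `dr 2`, without the origin
  have key : ∀ {H : Pl → X}, A.IsTripod τ H → ∀ e : Pl, 0 ≤ e.2 → 0 < e.1 + e.2 → A.HexAt τ H e := by
    intro H hH e h1 h2
    rcases h1.eq_or_lt with h1 | h1
    · have : e = (e.1, 0) := by rw [h1]
      rw [this]
      exact Atlas.IsTripod.hexAt_ray hA hH (by linarith)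
    · exact hH.hexAt_interior h1 h2
  by_cases c1 : 0 ≤ e.2 ∧ 0 < e.1 + e.2
  · exact key hH e c1.1 c1.2
  by_cases c2 : e.1 + e.2 ≤ 0 ∧ e.1 < 0
  · have e2 : fr 0 2 (-e.1 - (-e.1 - e.2), -e.1 - e.2) = e := by ext <;> simp [fr, dr]
    rw [← e2]
    refine Atlas.HexAt.of_rotate (k := 2) (key hH.rotate _ ?_ ?_) <;> simp only <;> linarith
  by_cases c3 : 0 ≤ e.1 ∧ e.2 < 0
  · have e2 : fr 0 2 (fr 0 2 (-e.2 - e.1, e.1)) = e := by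
      ext <;> simp [fr, dr]
    rw [← e2]
    refine Atlas.HexAt.of_rotate (k := 2) (Atlas.HexAt.of_rotate (k := 2)
      (key hH.rotate.rotate _ ?_ ?_)) <;> simp only <;> linarith
  have : e = 0 := by
    have g1 : e.2 ≤ 0 := by
      by_contra h
      by_cases h' : 0 < e.1 + e.2
      · exact c1 ⟨by linarith, h'⟩
      · exact c2 ⟨by linarith, by linarith⟩
    have g2 : 0 ≤ e.1 := by
      by_contra h; exact c2 ⟨by linarith, by linarith⟩
    have g3 : 0 ≤ e.2 := by
      by_contra h; exact c3 ⟨g2, by linarith⟩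
    have g4 : e.1 ≤ 0 := by
      by_contra h; exact c1 ⟨g3, by linarith⟩
    ext
    · exact le_antisymm g4 g2
    · exact le_antisymm g1 g3
  rw [this]
  exact fun k => ⟨hH.ne k, hH.notAdj k⟩

/-- An immersion of the whole plane. -/
def Atlas.IsApartment (A : Atlas X) (τ : Bool) (H : Pl → X) : Prop :=
  (∀ N, A.Chart τ (hexa N) H) ∧ ∀ e, A.HexAt τ H e

theorem Atlas.IsBuilding.exists_second_ray (hA : A.IsBuilding) {τ : Bool} {α : ℝ → X}
    (hα : ∀ T, 0 ≤ T → A.ISeg τ T α) : ∃ β, (∀ T, 0 ≤ T → A.ISeg τ T β) ∧ α 0 = β 0 ∧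
      cdart τ α ≠ cdart τ β := by
  have hd := (hα 1 zero_le_one).isDart one_pos
  obtain ⟨c, hc, -, h1, -, h3, h4, -⟩ := hA.hexagon' hd hd
  obtain ⟨β, g1, g2, g3⟩ := hA.exists_ray (h1 2)
  have : (c 2).1 = τ := (h3 2).trans (typ_two τ 0)
  rw [this] at g1 g3
  refine ⟨β, g1, g2.symm, ?_⟩
  rw [g3, ← h4]
  exact fun h => absurd (hc h) (by decide)

/-- Two joined points lie on two infinite curves of the same parity which leave a common point in
different directions: the extensions of two sides of a parallelogram with the given points as its
acute corners. -/
theorem Atlas.IsBuilding.exists_rays (hA : A.IsBuilding) {x y : X} (h : A.Joined x y) :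
    ∃ τ α β, (∀ T, 0 ≤ T → A.ISeg τ T α) ∧ (∀ T, 0 ≤ T → A.ISeg τ T β) ∧ α 0 = β 0 ∧
      cdart τ α ≠ cdart τ β ∧ (∃ r, 0 ≤ r ∧ α r = x) ∧ ∃ r, 0 ≤ r ∧ β r = y := by
  obtain ⟨a, b, f, ha, hb, hf, rfl, rfl⟩ := h.exists_rect true
  have hm : ((b, 0) : Pl) ∈ rect b a := mem_rect.2 ⟨⟨hb, le_rfl⟩, le_rfl, ha⟩
  have e1 : ((b, 0) : Pl) + a • dr 1 = (b, a) := by ext <;> simp [dr]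
  have e3 : ((b, 0) : Pl) + b • dr 3 = 0 := by ext <;> simp [dr]
  have m1 : ((b, 0) : Pl) + a • dr 1 ∈ rect b a := by
    rw [e1]; exact mem_rect.2 ⟨⟨hb, le_rfl⟩, ha, le_rfl⟩
  have m3 : ((b, 0) : Pl) + b • dr 3 ∈ rect b a := by
    rw [e3]; exact mem_rect.2 ⟨⟨le_rfl, hb⟩, le_rfl, ha⟩
  have c1 := hf.curve hm m1
  have c3 := hf.curve hm m3
  rw [show typ true 1 = false from rfl] at c1
  rw [show typ true 3 = false from rfl] at c3
  rcases ha.eq_or_lt with rfl | ha'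
  · -- the point `f (b, 0)` is an end of the segment
    have hex : ∃ τ β, (∀ T, 0 ≤ T → A.ISeg τ T β) ∧ β 0 = f (b, 0) ∧ ∃ r, 0 ≤ r ∧ β r = f 0 := by
      rcases hb.eq_or_lt with rfl | hb'
      · obtain ⟨u, hu⟩ := hA.exists_dart (f (0, 0))
        obtain ⟨β, g1, g2, -⟩ := hA.exists_ray hu
        exact ⟨_, β, g1, g2, 0, le_rfl, g2⟩
      · obtain ⟨β, g1, g2⟩ := hA.extend_ray hb' c3
        exact ⟨_, β, g1, by simpa using g2 0 le_rfl hb, b, hb, by rw [g2 b hb le_rfl, e3]⟩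
    obtain ⟨τ, β, g1, g2, g3⟩ := hex
    obtain ⟨α, i1, i2, i3⟩ := hA.exists_second_ray g1
    exact ⟨τ, α, β, i1, g1, i2.symm, i3.symm, ⟨0, le_rfl, i2.symm.trans g2⟩, g3⟩
  · obtain ⟨α, g1, g2⟩ := hA.extend_ray ha' c1
    have gx : ∃ r, 0 ≤ r ∧ α r = f (b, a) := ⟨a, ha, by rw [g2 a ha le_rfl, e1]⟩
    have g0 : α 0 = f (b, 0) := by simpa using g2 0 le_rfl ha
    rcases hb.eq_or_lt with rfl | hb'
    · obtain ⟨β, i1, i2, i3⟩ := hA.exists_second_ray g1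
      exact ⟨_, α, β, g1, i1, i2, i3, gx, 0, le_rfl, by rw [← i2, g0]; rfl⟩
    · obtain ⟨β, i1, i2⟩ := hA.extend_ray hb' c3
      refine ⟨_, α, β, g1, i1, ?_, ?_, gx, b, hb, by rw [i2 b hb le_rfl, e3]⟩
      · rw [g0, i2 0 le_rfl hb]; simp
      · rw [cdart_congr a ha' g2, cdart_congr b hb' i2]
        refine (hf.2 _ hm 1).1 ((isHex_rect _ _).sees hm ha' m1) ((isHex_rect _ _).sees hm hb' m3)

/-- Two joined points lie in an apartment: the hexagon through the directions of the two curves of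
`exists_rays` provides a third curve, and the three sectors between these curves form a tripod. -/
theorem Atlas.IsBuilding.exists_apartment (hA : A.IsBuilding) {x y : X} (h : A.Joined x y) :
    ∃ τ H, A.IsApartment τ H ∧ (∃ z, H z = x) ∧ ∃ z, H z = y := by
  obtain ⟨τ, α, β, hα, hβ, h0, hne, ⟨r, hr, hx⟩, r', hr', hy⟩ := hA.exists_rays h
  have dα := (hα 1 zero_le_one).isDart one_pos
  have dβ := (hβ 1 zero_le_one).isDart one_pos
  rw [← h0] at dβ
  obtain ⟨c, hc, hadj, hd, hna, hty, c0, c2⟩ : ∃ c : Fin 6 → Dart X, Function.Injective c ∧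
      (∀ k, A.Adj (c k) (c (k + 1))) ∧ (∀ k, A.IsDart (α 0) (c k)) ∧
      (∀ k, ¬ A.Adj (c k) (c (k + 3))) ∧ (∀ k, (c k).1 = typ τ k) ∧ c 0 = cdart τ α ∧
      c 2 = cdart τ β := by
    obtain ⟨c, h1, h2, h3, h4, h5, h6, j, h7⟩ := hA.hexagon' dα dβ
    have hj : j = 2 ∨ j = 4 := by
      have g1 : j ≠ 0 := fun h => hne (by rw [← h6, ← h7, h])
      have g2 : typ τ j = τ := (h5 j).symm.trans (congrArg Prod.fst h7)
      have key : ∀ (τ : Bool) (j : Fin 6), j ≠ 0 → typ τ j = τ → j = 2 ∨ j = 4 := by decide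
      exact key τ j g1 g2
    rcases hj with rfl | rfl
    · exact ⟨c, h1, h2, h3, h4, h5, h6, h7⟩
    · refine ⟨fun k => c (-k), fun a b h => neg_injective (h1 h), fun k => ?_, fun k => h3 _,
        fun k => ?_, fun k => (h5 _).trans (typ_neg _ _), h6, h7⟩
      · have := (h2 (-(k + 1))).symm
        rwa [show -(k + 1) + 1 = -k by abel] at this
      · have := h4 (-k)
        rwa [show -k + 3 = -(k + 3) by clear this; revert k; decide] at this
  obtain ⟨γ, hγ, γ0, dγ⟩ := hA.exists_ray (hd 4)
  rw [show (c 4).1 = τ from (hty 4).trans (typ_two τ 2)] at hγ dγ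
  have i02 : cdart τ α ≠ cdart τ β := hne
  have i24 : cdart τ β ≠ cdart τ γ := by
    rw [dγ, ← c2]; exact fun h => absurd (hc h) (by decide)
  have i40 : cdart τ γ ≠ cdart τ α := by
    rw [dγ, ← c0]; exact fun h => absurd (hc h) (by decide)
  obtain ⟨S₀, s1, s2, s3⟩ := hA.exists_sector hα hβ h0 i02
  obtain ⟨S₂, t1, t2, t3⟩ := hA.exists_sector hβ hγ (h0.symm.trans γ0.symm) i24
  obtain ⟨S₄, u1, u2, u3⟩ := hA.exists_sector hγ hα γ0 i40
  classical
  let H : Pl → X := fun z => if 0 ≤ z.2 ∧ 0 ≤ z.1 + z.2 then S₀ z else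
    if z.1 ≤ 0 then S₂ (z.2, -z.1 - z.2) else S₄ (-z.1 - z.2, z.1)
  have H0 : ∀ z : Pl, 0 ≤ z.2 → 0 ≤ z.1 + z.2 → H z = S₀ z := fun z h1 h2 => if_pos ⟨h1, h2⟩
  have H2 : ∀ z : Pl, z.1 ≤ 0 → z.1 + z.2 ≤ 0 → H z = S₂ (z.2, -z.1 - z.2) := by
    intro z h1 h2
    by_cases h : 0 ≤ z.2 ∧ 0 ≤ z.1 + z.2
    · rw [H0 z h.1 h.2]
      have e : z.1 = -z.2 := by linarith [h.2]
      have e1 : z = (-z.2, z.2) := by rw [← e]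
      have e2 : ((z.2, -z.1 - z.2) : Pl) = (z.2, 0) := by rw [e]; simp
      rw [e2, t2 _ h.1, e1, s3 _ h.1]
    · simp only [H]; rw [if_neg h, if_pos h1]
  have H4 : ∀ z : Pl, 0 ≤ z.1 → z.2 ≤ 0 → H z = S₄ (-z.1 - z.2, z.1) := by
    intro z h1 h2
    by_cases h : 0 ≤ z.2 ∧ 0 ≤ z.1 + z.2
    · rw [H0 z h.1 h.2]
      have e : z.2 = 0 := le_antisymm h2 h.1
      have e1 : z = (z.1, 0) := by rw [← e]
      rw [e, sub_zero, u3 _ h1, e1, s2 _ h1]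
    by_cases h' : z.1 ≤ 0
    · have e : z.1 = 0 := le_antisymm h' h1
      rw [H2 z h' (by linarith), e]
      have v1 := t3 (-z.2) (by linarith)
      have v2 := u2 (-z.2) (by linarith)
      rw [neg_neg] at v1
      simp only [neg_zero, zero_sub]
      rw [v1, v2]
    · simp only [H]; rw [if_neg h, if_neg h']
  have dr0 : ∀ r : ℝ, (0 : Pl) + r • dr 0 = (r, 0) := fun r => by ext <;> simp [dr]
  have dr2 : ∀ r : ℝ, (0 : Pl) + r • dr 2 = (-r, r) := fun r => by ext <;> simp [dr]
  have dr4 : ∀ r : ℝ, (0 : Pl) + r • dr 4 = (0, -r) := fun r => by ext <;> simp [dr]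
  have hchart : ∀ N, A.Imm τ (par 0 0 N N) H ∧ A.Imm τ (par 0 2 N N) H ∧
      A.Imm τ (par 0 4 N N) H := by
    intro N
    refine ⟨(s1 N).congr fun z hz => ?_, ?_, ?_⟩
    · rw [mem_par_zero] at hz; exact H0 z hz.1.1 hz.2.1
    · refine Atlas.Imm.of_frame (e := 0) (k := 2) ?_
      rw [par_frame]
      refine (t1 N).congr fun z hz => ?_
      rw [mem_par_zero] at hz
      rw [H2]
      · congr 1; ext <;> simp [fr, dr]
      · simp [fr, dr]; linarith [hz.2.1]
      · simp [fr, dr]; linarith [hz.1.1]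
    · refine Atlas.Imm.of_frame (e := 0) (k := 4) ?_
      rw [par_frame]
      refine (u1 N).congr fun z hz => ?_
      rw [mem_par_zero] at hz
      rw [H4]
      · congr 1; ext <;> simp [fr, dr]
      · simp [fr, dr]; linarith [hz.1.1]
      · simp [fr, dr]; linarith [hz.2.1]
  have hdart : ∀ k, dart τ H 0 k = c k := by
    have d0 : dart τ H 0 0 = c 0 := by
      rw [c0]
      refine cdart_congr 1 one_pos fun r h1 _ => ?_
      rw [dr0, H0 _ le_rfl (by simpa using h1), s2 r h1]
    have d2 : dart τ H 0 2 = c 2 := by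
      rw [c2]
      refine cdart_congr 1 one_pos fun r h1 _ => ?_
      rw [dr2, H0 _ h1 (by simp), s3 r h1]
    have d4 : dart τ H 0 4 = c 4 := by
      rw [← dγ]
      refine cdart_congr 1 one_pos fun r h1 _ => ?_
      rw [dr4, H4 _ le_rfl (by simpa using h1)]
      simp only [neg_zero, zero_sub, neg_neg]
      exact u2 r h1
    have adj : ∀ k ∈ ({0, 2, 4} : Finset (Fin 6)), A.Adj (dart τ H 0 k) (dart τ H 0 (k + 1)) ∧
        A.Adj (dart τ H 0 (k + 1)) (dart τ H 0 (k + 2)) := by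
      have aux : ∀ k, A.Imm τ (par 0 k 1 1) H → A.Adj (dart τ H 0 k) (dart τ H 0 (k + 1)) ∧
          A.Adj (dart τ H 0 (k + 1)) (dart τ H 0 (k + 2)) := by
        intro k hk
        have hz : (0 : Pl) ∈ par 0 k 1 1 := ⟨0, 0, by norm_num, by norm_num, by simp⟩
        have e : ∀ p q : ℝ, 0 ≤ p → p ≤ 1 → 0 ≤ q → q ≤ 1 →
            (0 : Pl) + p • dr k + q • dr (k + 2) ∈ par 0 k 1 1 := fun p q h1 h2 h3 h4 =>
          ⟨p, q, ⟨h1, h2⟩, ⟨h3, h4⟩, rfl⟩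
        have v0 : Sees (par 0 k 1 1) 0 k := (isHex_par _ _ _ _).sees hz one_pos (by
          simpa using e 1 0 (by norm_num) le_rfl le_rfl (by norm_num))
        have v2 : Sees (par 0 k 1 1) 0 (k + 2) := (isHex_par _ _ _ _).sees hz one_pos (by
          simpa using e 0 1 le_rfl (by norm_num) (by norm_num) le_rfl)
        have v1 : Sees (par 0 k 1 1) 0 (k + 1) := (isHex_par _ _ _ _).sees hz one_pos (by
          have := e 1 1 (by norm_num) le_rfl (by norm_num) le_rfl
          have e' : dr (k + 1) = dr k + dr (k + 2) := by
            rw [dr_add k 2, dr_two]; simp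
          rw [e']; simpa using this)
        have k2 : k + 1 + 1 = k + 2 := by rw [add_assoc]; rfl
        have b := A.adj_of_chart hk.1 hz v1 (k2 ▸ v2)
        rw [k2] at b
        exact ⟨A.adj_of_chart hk.1 hz v0 v1, b⟩
      intro k hk
      simp only [Finset.mem_insert, Finset.mem_singleton] at hk
      rcases hk with rfl | rfl | rfl
      · exact aux _ (hchart 1).1
      · exact aux _ (hchart 1).2.1
      · exact aux _ (hchart 1).2.2
    have a0 := adj 0 (by decide)
    have a2 := adj 2 (by decide)
    have a4 := adj 4 (by decide)
    have b := hadj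
    have b0 := b 0
    have b1 := b 1
    have b2 := b 2
    have b3 := b 3
    have b4 := b 4
    have b5 := b 5
    simp only [Fin.reduceAdd, d0, d2, d4] at a0 a2 a4 b0 b1 b2 b3 b4 b5
    have n02 : c 0 ≠ c 2 := fun h => absurd (hc h) (by decide)
    have n24 : c 2 ≠ c 4 := fun h => absurd (hc h) (by decide)
    have n40 : c 4 ≠ c 0 := fun h => absurd (hc h) (by decide)
    intro k
    fin_cases k
    · exact d0
    · exact hA.unique_mid a0.1 a0.2 b0 b1 n02
    · exact d2
    · exact hA.unique_mid a2.1 a2.2 b2 b3 n24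
    · exact d4
    · exact hA.unique_mid a4.1 a4.2 b4 b5 n40
  have hH : A.IsTripod τ H := by
    refine ⟨hchart, fun k h => ?_, fun k h => ?_⟩
    · rw [hdart, hdart] at h
      exact absurd (hc h) ((by decide : ∀ k : Fin 6, k ≠ k + 2) k)
    · rw [hdart, hdart] at h
      exact hna k h
  refine ⟨τ, H, ⟨hH.chart, Atlas.IsTripod.hexAt hA hH⟩, ⟨(r, 0), ?_⟩, (-r', r'), ?_⟩
  · rw [H0 _ le_rfl (by simpa using hr), s2 r hr, hx]
  · rw [H0 _ hr' (by simp), s3 r' hr', hy]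

end Planar

namespace SL3

open Planar

/-! ### Coordinates on the affine space -/

/-- The point of `A` with coordinates `z` in the frame consisting of `wt τ` and of the vector that
makes an angle of `60°` with it. -/
noncomputable def ofPl (τ : Bool) (z : Pl) : Apt :=
  z.1 • wt τ + z.2 • if τ then wt false else rot (wt true)

/-- The inverse of `ofPl`. -/
def toPl (τ : Bool) (x : Apt) : Pl :=
  if τ then (crd x 0 - crd x 1, crd x 1 - crd x 2) else (crd x 0 - crd x 2, crd x 1 - crd x 0)

theorem crd_ofPl_true (z : Pl) (i : Fin 3) : crd (ofPl true z) i =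
    ![(2 * z.1 + z.2) / 3, (z.2 - z.1) / 3, (-z.1 - 2 * z.2) / 3] i := by
  fin_cases i <;> simp [ofPl] <;> ring

theorem crd_ofPl_false (z : Pl) (i : Fin 3) : crd (ofPl false z) i =
    ![(z.1 - z.2) / 3, (z.1 + 2 * z.2) / 3, (-2 * z.1 - z.2) / 3] i := by
  fin_cases i <;> simp [ofPl, rot, show (-1 : Fin 3) = 2 from rfl] <;> ring

theorem toPl_ofPl (τ : Bool) (z : Pl) : toPl τ (ofPl τ z) = z := by
  cases τ <;> ext <;> simp [toPl, crd_ofPl_true, crd_ofPl_false] <;> ring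

theorem ofPl_toPl (τ : Bool) (x : Apt) : ofPl τ (toPl τ x) = x := by
  have h := crd_sum x
  apply crd_ext
  intro i
  cases τ <;> fin_cases i <;> simp [toPl, crd_ofPl_true, crd_ofPl_false] <;> linarith

theorem ofPl_injective (τ : Bool) : Function.Injective (ofPl τ) :=
  Function.LeftInverse.injective (toPl_ofPl τ)

theorem ofPl_zero (τ : Bool) : ofPl τ 0 = 0 := by simp [ofPl]

theorem ofPl_add (τ : Bool) (z w : Pl) : ofPl τ (z + w) = ofPl τ z + ofPl τ w := by
  simp only [ofPl, Prod.fst_add, Prod.snd_add, add_smul]; abel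

theorem ofPl_smul (τ : Bool) (r : ℝ) (z : Pl) : ofPl τ (r • z) = r • ofPl τ z := by
  simp only [ofPl, Prod.smul_fst, Prod.smul_snd, smul_eq_mul, mul_smul, smul_add]

theorem ofPl_dr_zero (τ : Bool) : ofPl τ (dr 0) = wt τ := by simp [ofPl, dr]

theorem ofPl_line (τ : Bool) (r : ℝ) : ofPl τ (r, 0) = r • wt τ := by simp [ofPl]

theorem continuous_ofPl (τ : Bool) : Continuous (ofPl τ) := by
  unfold ofPl; fun_prop

theorem continuous_crd (i : Fin 3) : Continuous fun x : Apt => crd x i :=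
  (continuous_apply i).comp continuous_subtype_val

theorem continuous_toPl (τ : Bool) : Continuous (toPl τ) := by
  have h0 := continuous_crd 0
  have h1 := continuous_crd 1
  have h2 := continuous_crd 2
  cases τ
  · exact (h0.sub h2).prodMk (h1.sub h0)
  · exact (h0.sub h1).prodMk (h1.sub h2)

theorem ofPl_rotT_true (z : Pl) : ofPl true (rotT z) = ofPl false z := by
  apply crd_ext
  intro i
  rw [crd_ofPl_true, crd_ofPl_false]
  fin_cases i <;> simp [rotT] <;> ring

theorem ofPl_rotT_false (z : Pl) : ofPl false (rotT z) = rot (ofPl true z) := by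
  apply crd_ext
  intro i
  rw [crd_ofPl_false]
  fin_cases i <;> simp [rotT, rot, crd_ofPl_true, show (-1 : Fin 3) = 2 from rfl] <;> ring

/-- The symmetries `fr e k` of the plane are elements of the affine Weyl group, up to the change of
frame. -/
theorem exists_weyl_fr (τ : Bool) (e : Pl) (k : Fin 6) :
    ∃ g, IsWeyl g ∧ ∀ z, ofPl τ (fr e k z) = g (ofPl (typ τ k) z) := by
  have hrot : ∀ τ' : Bool, ∃ g, IsWeyl g ∧ ∀ z, ofPl τ' (rotT z) = g (ofPl (!τ') z) := by
    rintro (_ | _)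
    · exact ⟨rot, isWeyl_rot, ofPl_rotT_false⟩
    · exact ⟨id, isWeyl_id, ofPl_rotT_true⟩
  have step : ∀ k : Fin 6, (∃ g, IsWeyl g ∧ ∀ z, ofPl τ (fr e k z) = g (ofPl (typ τ k) z)) →
      ∃ g, IsWeyl g ∧ ∀ z, ofPl τ (fr e (k + 1) z) = g (ofPl (typ τ (k + 1)) z) := by
    rintro k ⟨g, hg, h⟩
    obtain ⟨g', hg', h'⟩ := hrot (typ τ k)
    refine ⟨_, hg.comp hg', fun z => ?_⟩
    rw [fr_succ, h, h', typ_succ]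
  have h0 : ∃ g, IsWeyl g ∧ ∀ z, ofPl τ (fr e 0 z) = g (ofPl (typ τ 0) z) :=
    ⟨_, isWeyl_translate (ofPl τ e), fun z => by rw [fr_std, ofPl_add, add_comm]; rfl⟩
  fin_cases k
  · exact h0
  · exact step 0 h0
  · exact step 1 (step 0 h0)
  · exact step 2 (step 1 (step 0 h0))
  · exact step 3 (step 2 (step 1 (step 0 h0)))
  · exact step 4 (step 3 (step 2 (step 1 (step 0 h0))))

theorem exists_weyl_reflR (τ : Bool) :
    ∃ g, IsWeyl g ∧ ∀ z, ofPl τ (reflR z) = g (ofPl τ z) := by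
  cases τ
  · refine ⟨_, isWeyl_perm (Equiv.swap 0 1) 0, fun z => crd_ext fun i => ?_⟩
    fin_cases i <;> simp [crd_ofPl_false, reflR, Equiv.swap_apply_of_ne_of_ne] <;> ring
  · refine ⟨_, isWeyl_perm (Equiv.swap 1 2) 0, fun z => crd_ext fun i => ?_⟩
    fin_cases i <;> simp [crd_ofPl_true, reflR, Equiv.swap_apply_of_ne_of_ne] <;> ring

theorem IsWeyl.exists_affine {g : Apt → Apt} (hg : IsWeyl g) (τ : Bool) :
    ∃ k : Pl →ᵃ[ℝ] Pl, ∀ z, k z = toPl τ (g (ofPl τ z)) := by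
  obtain ⟨σ, v, hg⟩ := hg
  have t1 : ∀ x y, toPl τ (x + y) = toPl τ x + toPl τ y := by
    intro x y; cases τ <;> ext <;> simp [toPl] <;> ring
  have t2 : ∀ (r : ℝ) x, toPl τ (r • x) = r • toPl τ x := by
    intro r x; cases τ <;> ext <;> simp [toPl] <;> ring
  have p1 : ∀ x y, permAct σ (x + y) = permAct σ x + permAct σ y := fun x y =>
    crd_ext fun i => by simp
  have p2 : ∀ (r : ℝ) x, permAct σ (r • x) = r • permAct σ x := fun r x =>
    crd_ext fun i => by simp
  let l : Pl →ₗ[ℝ] Pl :=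
    { toFun := fun z => toPl τ (permAct σ (ofPl τ z))
      map_add' := fun z w => by rw [ofPl_add, p1, t1]
      map_smul' := fun r z => by rw [ofPl_smul, p2, t2]; rfl }
  refine ⟨⟨fun z => toPl τ (g (ofPl τ z)), l, fun z w => ?_⟩, fun z => rfl⟩
  simp only [vadd_eq_add, hg, ofPl_add, p1, t1, l, LinearMap.coe_mk, AddHom.coe_mk, add_assoc]

/-! ### Enclosures as hexagonal regions -/

theorem isRootPolyhedron_univ : IsRootPolyhedron Set.univ :=
  ⟨∅, Set.finite_empty, by simp, by simp⟩

theorem isRootPolyhedron_empty : IsRootPolyhedron ∅ := by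
  have := (isRootPolyhedron_half (i := 0) (j := 1) (by decide) 1).inter
    (isRootPolyhedron_half (i := 1) (j := 0) (by decide) 0)
  convert this using 1
  ext x
  simp only [Set.mem_empty_iff_false, Set.mem_inter_iff, Set.mem_ofPred_eq, false_iff]
  rintro ⟨h1, h2⟩
  linarith

/-- In contrast to root half-spaces, `i = j` is allowed. -/
theorem isRootPolyhedron_le (i j : Fin 3) (c : ℝ) :
    IsRootPolyhedron {x | c ≤ crd x i - crd x j} := by
  by_cases h : i = j
  · subst h
    by_cases hc : c ≤ 0
    · convert isRootPolyhedron_univ using 1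
      ext x; simpa using hc
    · convert isRootPolyhedron_empty using 1
      ext x; simpa using hc
  · exact isRootPolyhedron_half h c

theorem IsRootPolyhedron.iInter {ι : Type} [Finite ι] {s : ι → Set Apt}
    (h : ∀ i, IsRootPolyhedron (s i)) : IsRootPolyhedron (⋂ i, s i) := by
  choose H h1 h2 h3 using h
  refine ⟨⋃ i, H i, Set.finite_iUnion h1, fun h hh => ?_, ?_⟩
  · obtain ⟨i, hi⟩ := Set.mem_iUnion.1 hh
    exact h2 i h hi
  · rw [Set.sInter_iUnion]
    exact Set.iInter_congr h3

/-- The set where two elements of the affine Weyl group coincide. -/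
theorem isRootPolyhedron_eq {g h : Apt → Apt} (hg : IsWeyl g) (hh : IsWeyl h) :
    IsRootPolyhedron {x | g x = h x} := by
  obtain ⟨σ, v, hg⟩ := hg
  obtain ⟨π, w, hh⟩ := hh
  have : {x | g x = h x} = ⋂ i : Fin 3, ({x | crd w i - crd v i ≤ crd x (σ i) - crd x (π i)} ∩
      {x | crd v i - crd w i ≤ crd x (π i) - crd x (σ i)}) := by
    ext x
    simp only [Set.mem_iInter, Set.mem_inter_iff, Set.mem_ofPred_eq]
    constructor
    · intro e i
      have := congrArg (fun y => crd y i) e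
      simp only [hg, hh, crd_add, crd_permAct] at this
      constructor <;> linarith
    · intro e
      apply crd_ext
      intro i
      obtain ⟨e1, e2⟩ := e i
      simp only [hg, hh, crd_add, crd_permAct]
      linarith
  rw [this]
  exact IsRootPolyhedron.iInter fun i => (isRootPolyhedron_le _ _ _).inter (isRootPolyhedron_le _ _ _)

theorem isHex_preimage_rotT {s : Set Pl} (hs : IsHex s) : IsHex (rotT ⁻¹' s) := by
  have := hs.fr_preimage 0 1
  have e : fr 0 1 = rotT := by
    funext z
    have := fr_succ 0 0 z
    rwa [fr_std, zero_add, zero_add] at this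
  rwa [e] at this

theorem isHex_inter_half {t : Set Pl} (ht : IsHex t) {h : Set Apt} (hh : IsRootHalfSpace h) :
    IsHex (t ∩ ofPl true ⁻¹' h) := by
  obtain ⟨i, j, c, hij, rfl⟩ := hh
  obtain ⟨a, a', b, b', d, d', rfl⟩ := ht
  have key : ∀ x : ℝ × ℝ, x ∈ ofPl true ⁻¹' {x | c ≤ crd x i - crd x j} ↔
      c ≤ ![(2 * x.1 + x.2) / 3, (x.2 - x.1) / 3, (-x.1 - 2 * x.2) / 3] i -
        ![(2 * x.1 + x.2) / 3, (x.2 - x.1) / 3, (-x.1 - 2 * x.2) / 3] j := by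
    intro x
    rw [Set.mem_preimage, Set.mem_ofPred_eq, crd_ofPl_true, crd_ofPl_true]
  fin_cases i <;> fin_cases j <;> first | exact absurd rfl hij | skip
  · refine ⟨max a c, a', b, b', d, d', ?_⟩
    ext z
    rw [Set.mem_inter_iff, key]
    simp only [Set.mem_ofPred_eq, max_le_iff]
    simp
    constructor <;> (intro hz; and_intros <;> linarith)
  · refine ⟨a, a', b, b', max d c, d', ?_⟩
    ext z
    rw [Set.mem_inter_iff, key]
    simp only [Set.mem_ofPred_eq, max_le_iff]
    simp
    constructor <;> (intro hz; and_intros <;> linarith)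
  · refine ⟨a, min a' (-c), b, b', d, d', ?_⟩
    ext z
    rw [Set.mem_inter_iff, key]
    simp only [Set.mem_ofPred_eq, le_min_iff]
    simp
    constructor <;> (intro hz; and_intros <;> linarith)
  · refine ⟨a, a', max b c, b', d, d', ?_⟩
    ext z
    rw [Set.mem_inter_iff, key]
    simp only [Set.mem_ofPred_eq, max_le_iff]
    simp
    constructor <;> (intro hz; and_intros <;> linarith)
  · refine ⟨a, a', b, b', d, min d' (-c), ?_⟩
    ext z
    rw [Set.mem_inter_iff, key]
    simp only [Set.mem_ofPred_eq, le_min_iff]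
    simp
    constructor <;> (intro hz; and_intros <;> linarith)
  · refine ⟨a, a', b, min b' (-c), d, d', ?_⟩
    ext z
    rw [Set.mem_inter_iff, key]
    simp only [Set.mem_ofPred_eq, le_min_iff]
    simp
    constructor <;> (intro hz; and_intros <;> linarith)

theorem Enclosure.exists_bound (E : Enclosure) : ∃ M : ℝ, 0 ≤ M ∧ ∀ x ∈ E.carrier, ∀ i,
    |crd x i| ≤ M := by
  obtain ⟨M, hM⟩ := isBounded_iff_forall_norm_le.1 E.isBounded
  refine ⟨max M 0, le_max_right _ _, fun x hx i => ?_⟩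
  have h1 := hM x hx
  rw [← Submodule.norm_coe] at h1
  exact (norm_le_pi_norm (x : Fin 3 → ℝ) i).trans (h1.trans (le_max_left _ _))

theorem Enclosure.isHex (E : Enclosure) (τ : Bool) : IsHex (ofPl τ ⁻¹' E.carrier) := by
  suffices h : IsHex (ofPl true ⁻¹' E.carrier) by
    cases τ
    · have := isHex_preimage_rotT h
      rw [← Set.preimage_comp] at this
      have e : ofPl true ∘ rotT = ofPl false := funext ofPl_rotT_true
      rwa [e] at this
    · exact h
  obtain ⟨M, hM, hE⟩ := E.exists_bound
  obtain ⟨H, hH, hH', hEH⟩ := E.isPoly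
  let B : Set Pl := {z | (-(2 * M) ≤ z.1 ∧ z.1 ≤ 2 * M) ∧ (-(2 * M) ≤ z.2 ∧ z.2 ≤ 2 * M) ∧
    (-(2 * M) ≤ z.1 + z.2 ∧ z.1 + z.2 ≤ 2 * M)}
  have hB : ofPl true ⁻¹' E.carrier ⊆ B := by
    intro z hz
    have h0 := hE _ hz 0
    have h1 := hE _ hz 1
    have h2 := hE _ hz 2
    rw [crd_ofPl_true] at h0 h1 h2
    simp [abs_le] at h0 h1 h2
    simp only [B, Set.mem_ofPred_eq]
    and_intros <;> linarith
  have key : ∀ K : Set (Set Apt), K.Finite → K ⊆ H → IsHex (B ∩ ofPl true ⁻¹' (⋂₀ K)) := by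
    intro K hK
    induction K, hK using Set.Finite.induction_on with
    | empty => intro _; simpa using isHex_mk _ _ _ _ _ _
    | insert _ _ ih =>
      intro hs
      rw [Set.insert_subset_iff] at hs
      have := isHex_inter_half (ih hs.2) (hH' _ hs.1)
      rw [Set.sInter_insert, Set.preimage_inter, Set.inter_comm (ofPl true ⁻¹' _), ← Set.inter_assoc]
      exact this
  have := key H hH subset_rfl
  rwa [← hEH, Set.inter_eq_self_of_subset_right hB] at this

/-- The enclosure with a given hexagonal region as its set of coordinates. -/
def encl (τ : Bool) (s : Set Pl) (hs : IsHex s) : Enclosure where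
  carrier := {x | toPl τ x ∈ s}
  isPoly := by
    obtain ⟨a, a', b, b', c, c', rfl⟩ := hs
    let J : Bool → Fin 3 × Fin 3 := fun τ => if τ then (0, 1) else (0, 2)
    let J' : Bool → Fin 3 × Fin 3 := fun τ => if τ then (1, 2) else (1, 0)
    let J'' : Bool → Fin 3 × Fin 3 := fun τ => if τ then (0, 2) else (1, 2)
    have : {x : Apt | toPl τ x ∈ {z : Pl | (a ≤ z.1 ∧ z.1 ≤ a') ∧ (b ≤ z.2 ∧ z.2 ≤ b') ∧
        (c ≤ z.1 + z.2 ∧ z.1 + z.2 ≤ c')}} =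
        ({x | a ≤ crd x (J τ).1 - crd x (J τ).2} ∩ {x | -a' ≤ crd x (J τ).2 - crd x (J τ).1}) ∩
        ({x | b ≤ crd x (J' τ).1 - crd x (J' τ).2} ∩ {x | -b' ≤ crd x (J' τ).2 - crd x (J' τ).1}) ∩
        ({x | c ≤ crd x (J'' τ).1 - crd x (J'' τ).2} ∩
          {x | -c' ≤ crd x (J'' τ).2 - crd x (J'' τ).1}) := by
      ext x
      cases τ <;> simp only [toPl, J, J', J'', Set.mem_inter_iff, Set.mem_ofPred_eq, if_true,
        Bool.false_eq_true, if_false] <;>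
      constructor <;> (intro hz; and_intros <;> linarith)
    rw [this]
    exact (((isRootPolyhedron_le _ _ _).inter (isRootPolyhedron_le _ _ _)).inter
      ((isRootPolyhedron_le _ _ _).inter (isRootPolyhedron_le _ _ _))).inter
      ((isRootPolyhedron_le _ _ _).inter (isRootPolyhedron_le _ _ _))
  isBounded := by
    obtain ⟨a, a', b, b', c, c', rfl⟩ := hs
    refine isBounded_of_root (|a| + |a'| + |b| + |b'| + |c| + |c'|) ?_
    rintro x hx i j
    have e1 := abs_nonneg a
    have e2 := abs_nonneg a'
    have e3 := abs_nonneg b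
    have e4 := abs_nonneg b'
    have e5 := abs_nonneg c
    have e6 := abs_nonneg c'
    have f1 := neg_abs_le a
    have f2 := le_abs_self a'
    have f3 := neg_abs_le b
    have f4 := le_abs_self b'
    have f5 := neg_abs_le c
    have f6 := le_abs_self c'
    cases τ <;> simp only [toPl, Set.mem_ofPred_eq, if_true, Bool.false_eq_true, if_false] at hx <;>
      fin_cases i <;> fin_cases j <;> simp <;> linarith

theorem mem_encl {τ : Bool} {s : Set Pl} {hs : IsHex s} {x : Apt} :
    x ∈ (encl τ s hs).carrier ↔ toPl τ x ∈ s := Iff.rfl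

theorem ofPl_mem_encl {τ : Bool} {s : Set Pl} {hs : IsHex s} {z : Pl} :
    ofPl τ z ∈ (encl τ s hs).carrier ↔ z ∈ s := by rw [mem_encl, toPl_ofPl]

/-! ### Sections of a construction are determined by their values -/

/-- Sections are determined by their values at points. -/
def IsSeparated (F : Enclosureᵒᵖ ⥤ Type) : Prop :=
  ∀ (E : Enclosure) (s s' : F.obj (op E)), (∀ e, evalAt s e = evalAt s' e) → s = s'

theorem Enclosure.Hom.ext' {D E : Enclosure} {f g : D ⟶ E}
    (h : ∀ x, (f.toFun x : Apt) = g.toFun x) : f = g :=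
  Enclosure.Hom.ext (funext fun x => Subtype.ext (h x))

theorem hom_pt_ext {D : Enclosure} (f g : D ⟶ pt) : f = g :=
  Enclosure.Hom.ext' fun x => ((f.toFun x).2 : _ = (0 : Apt)).trans ((g.toFun x).2 : _ = (0 : Apt)).symm

theorem id_mem_of_cover {S : Sieve pt} (hS : S ∈ encTopology pt) : S.arrows (𝟙 pt) := by
  obtain ⟨ι, -, D, f, hf, hc⟩ := hS
  obtain ⟨i, d, hd⟩ := hc ⟨0, rfl⟩
  have := S.downward_closed (hf i) (Enclosure.point d)
  convert this using 1
  exact hom_pt_ext _ _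

/-- Finite relatedness in terms of points. -/
theorem IsConstruction.exists_fiber {F : Enclosureᵒᵖ ⥤ Type} (hF : IsConstruction F)
    {E E' : Enclosure} (s : F.obj (op E)) (s' : F.obj (op E')) :
    ∃ (ι : Type) (_ : Finite ι) (D : ι → Enclosure) (a : ∀ i, D i ⟶ E) (b : ∀ i, D i ⟶ E'),
      (∀ i, F.map (a i).op s = F.map (b i).op s') ∧
      ∀ (e : E.carrier) (e' : E'.carrier), evalAt s e = evalAt s' e' →
        ∃ i d, (a i).toFun d = e ∧ (b i).toFun d = e' := by
  obtain ⟨ι, hι, D, q, h⟩ := hF.finitelyRelated E E' s s'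
  refine ⟨ι, hι, D, fun i => (q i).1.1, fun i => (q i).1.2, fun i => (q i).2, ?_⟩
  intro e e' hee
  obtain ⟨S, hS, hS'⟩ := h pt ⟨(Enclosure.point e, Enclosure.point e'), hee⟩
  obtain ⟨i, a, ha⟩ := hS' pt (𝟙 pt) (id_mem_of_cover hS)
  have h1 : Enclosure.point e = a ≫ (q i).1.1 := congrArg (fun z => z.1.1) ha
  have h2 : Enclosure.point e' = a ≫ (q i).1.2 := congrArg (fun z => z.1.2) ha
  refine ⟨i, a.toFun ⟨0, rfl⟩, ?_, ?_⟩
  · have := congrArg (fun f : pt ⟶ E => f.toFun ⟨0, rfl⟩) h1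
    exact this.symm.trans (Subtype.ext (zero_add _))
  · have := congrArg (fun f : pt ⟶ E' => f.toFun ⟨0, rfl⟩) h2
    exact this.symm.trans (Subtype.ext (zero_add _))

/-- Two sections over `E` coincide on a finite union of enclosures. -/
theorem IsConstruction.exists_eqLocus {F : Enclosureᵒᵖ ⥤ Type} (hF : IsConstruction F)
    {E : Enclosure} (s s' : F.obj (op E)) :
    ∃ (ι : Type) (_ : Finite ι) (Z : ι → Enclosure) (hZ : ∀ i, (Z i).carrier ⊆ E.carrier),
      (∀ i, F.map (Enclosure.incl (hZ i)).op s = F.map (Enclosure.incl (hZ i)).op s') ∧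
      ∀ e : E.carrier, evalAt s e = evalAt s' e → ∃ i, (e : Apt) ∈ (Z i).carrier := by
  obtain ⟨ι, hι, D, a, b, hab, hc⟩ := hF.exists_fiber s s'
  have key : ∀ i, ∃ Z : Enclosure, ∃ hZ : Z.carrier ⊆ E.carrier,
      F.map (Enclosure.incl hZ).op s = F.map (Enclosure.incl hZ).op s' ∧
      ∀ d, (a i).toFun d = (b i).toFun d → ((a i).toFun d : Apt) ∈ Z.carrier := by
    intro i
    obtain ⟨α, hα, ha⟩ := (a i).isAffine
    obtain ⟨β, hβ, hb⟩ := (b i).isAffine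
    obtain ⟨k, hk, hkα, hαk⟩ := hα.exists_inv
    -- the part of the image of `D i` on which the two maps to `E` are equal
    have hZ : (E.carrier ∩ k ⁻¹' (D i).carrier) ∩ {x | x = β (k x)} ⊆ E.carrier :=
      fun x hx => hx.1.1
    let Z : Enclosure :=
      { carrier := (E.carrier ∩ k ⁻¹' (D i).carrier) ∩ {x | x = β (k x)}
        isPoly := (E.isPoly.inter ((D i).isPoly.preimage hk)).inter
          (isRootPolyhedron_eq isWeyl_id (hβ.comp hk))
        isBounded := E.isBounded.subset hZ }
    let g : Z ⟶ D i := Enclosure.homOf k hk fun x hx => hx.1.2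
    have e1 : Enclosure.incl (D := Z) hZ = g ≫ a i := Enclosure.Hom.ext' fun x =>
      ((ha (g.toFun x)).trans (hαk x)).symm
    have e2 : Enclosure.incl (D := Z) hZ = g ≫ b i := Enclosure.Hom.ext' fun x =>
      (x.2.2.trans (hb (g.toFun x)).symm)
    refine ⟨Z, hZ, ?_, fun d hd => ?_⟩
    · have h1 : F.map (Enclosure.incl (D := Z) hZ).op s = F.map g.op (F.map (a i).op s) := by
        rw [e1]; simp
      have h2 : F.map (Enclosure.incl (D := Z) hZ).op s' = F.map g.op (F.map (b i).op s') := by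
        rw [e2]; simp
      rw [h1, h2, hab]
    · have h1 : ((a i).toFun d : Apt) = α d := ha d
      have h2 : ((b i).toFun d : Apt) = β d := hb d
      have h3 : k ((a i).toFun d) = d := by rw [h1, hkα]
      refine ⟨⟨((a i).toFun d).2, ?_⟩, ?_⟩
      · rw [Set.mem_preimage, h3]; exact d.2
      · rw [Set.mem_ofPred_eq, h3, ← h2, hd]
  choose Z hZ h1 h2 using key
  refine ⟨ι, hι, Z, hZ, h1, fun e he => ?_⟩
  obtain ⟨i, d, hd, hd'⟩ := hc e e he
  refine ⟨i, ?_⟩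
  rw [← hd]
  exact h2 i d (hd.trans hd'.symm)

theorem IsConstruction.presieve_isSheaf {F : Enclosureᵒᵖ ⥤ Type} (hF : IsConstruction F) :
    Presieve.IsSheaf encTopology F :=
  (isSheaf_iff_isSheaf_of_type _ _).1 hF.isSheaf

theorem generate_mem_of_cover {E : Enclosure} {ι : Type} [Finite ι] {Z : ι → Enclosure}
    (f : ∀ i, Z i ⟶ E) (h : ∀ x : E.carrier, ∃ i, x ∈ Set.range (f i).toFun) :
    Sieve.generate (Presieve.ofArrows Z f) ∈ encTopology E :=
  ⟨ι, inferInstance, Z, f, fun i => Sieve.le_generate _ _ _ (Presieve.ofArrows.mk i), h⟩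

theorem IsConstruction.isSheafFor {F : Enclosureᵒᵖ ⥤ Type} (hF : IsConstruction F)
    {E : Enclosure} {ι : Type} [Finite ι] {Z : ι → Enclosure}
    (f : ∀ i, Z i ⟶ E) (h : ∀ x : E.carrier, ∃ i, x ∈ Set.range (f i).toFun) :
    Presieve.IsSheafFor F (Presieve.ofArrows Z f) :=
  (Presieve.isSheafFor_iff_generate _).2 (hF.presieve_isSheaf _ (generate_mem_of_cover f h))

/-- The enclosures on which two sections with the same values coincide cover the domain. -/
theorem IsConstruction.isSeparated {F : Enclosureᵒᵖ ⥤ Type} (hF : IsConstruction F) :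
    IsSeparated F := by
  intro E s s' h
  obtain ⟨ι, hι, Z, hZ, h1, h2⟩ := hF.exists_eqLocus s s'
  refine (hF.isSheafFor (fun i => Enclosure.incl (hZ i)) fun x => ?_).isSeparatedFor.ext ?_
  · obtain ⟨i, hi⟩ := h2 x (h x)
    exact ⟨i, ⟨x, hi⟩, rfl⟩
  · rintro _ _ ⟨i⟩
    exact h1 i

theorem IsConstruction.exists_glue {F : Enclosureᵒᵖ ⥤ Type} (hF : IsConstruction F)
    {E : Enclosure} {ι : Type} [Finite ι] {Z : ι → Enclosure} (hZ : ∀ i, (Z i).carrier ⊆ E.carrier)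
    (hc : ∀ x ∈ E.carrier, ∃ i, x ∈ (Z i).carrier) (s : ∀ i, F.obj (op (Z i)))
    (v : Apt → Points F) (hs : ∀ i x, evalAt (s i) x = v x) :
    ∃ t : F.obj (op E), ∀ e, evalAt t e = v e := by
  have hsh := hF.isSheafFor (fun i => Enclosure.incl (hZ i)) fun x => by
    obtain ⟨i, hi⟩ := hc x x.2
    exact ⟨i, ⟨x, hi⟩, rfl⟩
  rw [Presieve.isSheafFor_arrows_iff] at hsh
  obtain ⟨t, ht, -⟩ := hsh s (fun i j G gi gj hg => hF.isSeparated _ _ _ fun e => by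
    rw [evalAt_map, evalAt_map, hs, hs]
    have := congrArg (fun f : G ⟶ E => ((f.toFun e : E.carrier) : Apt)) hg
    exact congrArg v this)
  refine ⟨t, fun e => ?_⟩
  obtain ⟨i, hi⟩ := hc e e.2
  have := evalAt_map (Enclosure.incl (hZ i)) t ⟨e, hi⟩
  rw [ht i, hs] at this
  exact this.symm

/-! ### Charts of a presheaf -/

/-- A chart of a presheaf: the values of a section, in coordinates. -/
def IsChart (F : Enclosureᵒᵖ ⥤ Type) (τ : Bool) (s : Set Pl) (f : Pl → Points F) : Prop :=
  ∃ (hs : IsHex s) (t : F.obj (op (encl τ s hs))), ∀ x, evalAt t x = f (toPl τ x)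

variable {F : Enclosureᵒᵖ ⥤ Type}

theorem IsChart.of_section {E : Enclosure} (t : F.obj (op E)) {τ : Bool} {f : Pl → Points F}
    {s : Set Pl} (hs : IsHex s) {g : Apt → Apt} (hg : IsWeyl g)
    (hE : ∀ z ∈ s, g (ofPl τ z) ∈ E.carrier)
    (h : ∀ z (hz : z ∈ s), evalAt t ⟨g (ofPl τ z), hE z hz⟩ = f z) : IsChart F τ s f := by
  have hE' : ∀ x ∈ (encl τ s hs).carrier, g x ∈ E.carrier := fun x hx => by
    have := hE _ hx
    rwa [ofPl_toPl] at this
  refine ⟨hs, F.map (Enclosure.homOf g hg hE').op t, fun x => ?_⟩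
  rw [evalAt_map]
  have := h (toPl τ x) x.2
  simp only [ofPl_toPl] at this
  exact this

/-- Change of coordinates by an element of the affine Weyl group. -/
theorem IsChart.comp {τ τ' : Bool} {s : Set Pl} {f : Pl → Points F} (hf : IsChart F τ s f)
    {φ : Pl → Pl} {t : Set Pl} (ht : IsHex t) (hts : ∀ z ∈ t, φ z ∈ s) {g : Apt → Apt}
    (hg : IsWeyl g) (hφ : ∀ z, ofPl τ (φ z) = g (ofPl τ' z)) :
    IsChart F τ' t fun z => f (φ z) := by
  obtain ⟨hs, u, hu⟩ := hf
  refine IsChart.of_section u ht hg (fun z hz => ?_) fun z hz => ?_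
  · rw [← hφ, ofPl_mem_encl]; exact hts z hz
  · rw [hu]; simp only [← hφ, toPl_ofPl]

theorem IsChart.frame {τ : Bool} {s : Set Pl} {f : Pl → Points F} (hf : IsChart F τ s f) (e : Pl)
    (k : Fin 6) : IsChart F (typ τ k) (fr e k ⁻¹' s) fun z => f (fr e k z) := by
  obtain ⟨g, hg, h⟩ := exists_weyl_fr τ e k
  exact hf.comp (hf.1.fr_preimage e k) (fun z hz => hz) hg h

theorem IsChart.reflect {τ : Bool} {s : Set Pl} {f : Pl → Points F} (hf : IsChart F τ s f) :
    IsChart F τ (reflR ⁻¹' s) fun z => f (reflR z) := by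
  obtain ⟨g, hg, h⟩ := exists_weyl_reflR τ
  exact hf.comp hf.1.refl_preimage (fun z hz => hz) hg h

theorem IsChart.mono {τ : Bool} {s t : Set Pl} {f : Pl → Points F} (hf : IsChart F τ s f)
    (ht : IsHex t) (hts : t ⊆ s) : IsChart F τ t f :=
  hf.comp (φ := id) ht hts isWeyl_id fun _ => rfl

theorem IsChart.congr {τ : Bool} {s : Set Pl} {f g : Pl → Points F} (hf : IsChart F τ s f)
    (h : ∀ z ∈ s, g z = f z) : IsChart F τ s g := by
  obtain ⟨hs, u, hu⟩ := hf
  exact ⟨hs, u, fun x => (hu x).trans (h _ x.2).symm⟩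

/-- The atlas of a construction. -/
def IsConstruction.atlas (hF : IsConstruction F) : Atlas (Points F) where
  Chart := IsChart F
  isHex hf := hf.1
  congr hf h := hf.congr h
  mono hf ht hts := hf.mono ht hts
  frame hf := hf.frame
  reflect hf := hf.reflect
  glue := by
    intro τ s f ι _ t hs hst ht
    choose h1 u hu using ht
    obtain ⟨v, hv⟩ := hF.exists_glue (E := encl τ s hs) (Z := fun i => encl τ (t i) (h1 i))
      (fun i x hx => (hst _).2 ⟨i, hx⟩) (fun x hx => (hst _).1 hx) u (fun x => f (toPl τ x)) hu
    exact ⟨hs, v, hv⟩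
  point x := by
    refine IsChart.of_section (E := pt) x ?_ isWeyl_id ?_ ?_
    · refine ⟨0, 0, 0, 0, 0, 0, ?_⟩
      ext z
      simp only [Set.mem_singleton_iff, Set.mem_ofPred_eq]
      constructor
      · rintro rfl; simp
      · rintro ⟨⟨h1, h2⟩, ⟨h3, h4⟩, -⟩
        ext
        · exact le_antisymm h2 h1
        · exact le_antisymm h4 h3
    · rintro z rfl; exact ofPl_zero _
    · rintro z rfl
      change F.map (Enclosure.point _).op x = x
      rw [hom_pt_ext (Enclosure.point _) (𝟙 pt), op_id, F.map_id]
      rfl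
  finRel := by
    rintro τ s f ⟨hs, u, hu⟩
    obtain ⟨ι, hι, D, a, b, hab, hc⟩ := hF.exists_fiber u u
    have key : ∀ i, ∃ k : Pl →ᵃ[ℝ] Pl, ∀ d, k (toPl τ ((a i).toFun d)) = toPl τ ((b i).toFun d) := by
      intro i
      obtain ⟨α, hα, ha⟩ := (a i).isAffine
      obtain ⟨β, hβ, hb⟩ := (b i).isAffine
      obtain ⟨k, hk, hkα, hαk⟩ := hα.exists_inv
      obtain ⟨κ, hκ⟩ := (hβ.comp hk).exists_affine τ
      refine ⟨κ, fun d => ?_⟩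
      have h1 : ((a i).toFun d : Apt) = α d := ha d
      have h2 : ((b i).toFun d : Apt) = β d := hb d
      rw [hκ, ofPl_toPl, h1, hkα, h2]
    choose k hk using key
    refine ⟨Set.range k, Set.finite_range k, fun z hz w hw hzw => ?_⟩
    obtain ⟨i, d, h1, h2⟩ := hc ⟨ofPl τ z, ofPl_mem_encl.2 hz⟩ ⟨ofPl τ w, ofPl_mem_encl.2 hw⟩ (by
      rw [hu, hu]; simp only [toPl_ofPl, hzw])
    refine ⟨k i, ⟨i, rfl⟩, ?_⟩
    have := hk i d
    rwa [h1, h2, toPl_ofPl, toPl_ofPl] at this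
  eqHex := by
    rintro τ s f g ⟨hs, u, hu⟩ ⟨hs', v, hv⟩
    obtain ⟨ι, hι, Z, hZ, h1, h2⟩ := hF.exists_eqLocus u v
    refine ⟨Set.range fun i => ofPl τ ⁻¹' (Z i).carrier, Set.finite_range _, ?_, fun z => ?_⟩
    · rintro _ ⟨i, rfl⟩
      exact (Z i).isHex τ
    · constructor
      · rintro ⟨hz, hfg⟩
        obtain ⟨i, hi⟩ := h2 ⟨ofPl τ z, ofPl_mem_encl.2 hz⟩ (by
          rw [hu, hv]; simp only [toPl_ofPl, hfg])
        exact ⟨_, ⟨i, rfl⟩, hi⟩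
      · rintro ⟨_, ⟨i, rfl⟩, hi⟩
        have hz := hZ i hi
        have := congrArg (fun w => evalAt w ⟨_, hi⟩) (h1 i)
        simp only [evalAt_map] at this
        rw [hu, hv] at this
        refine ⟨ofPl_mem_encl.1 hz, ?_⟩
        have e : toPl τ ((Enclosure.incl (hZ i)).toFun ⟨ofPl τ z, hi⟩) = z := toPl_ofPl τ z
        rwa [e] at this

/-! ### The graph at a point in terms of darts -/

open Classical in
/-- The value of a section at a point of `A`, or `d` outside of its domain. -/
noncomputable def evalD {E : Enclosure} (t : F.obj (op E)) (d : Points F) (x : Apt) : Points F :=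
  if h : x ∈ E.carrier then evalAt t ⟨x, h⟩ else d

theorem evalD_of_mem {E : Enclosure} (t : F.obj (op E)) (d : Points F) {x : Apt}
    (h : x ∈ E.carrier) : evalD t d x = evalAt t ⟨x, h⟩ := dif_pos h

theorem isChart_evalD {E : Enclosure} (t : F.obj (op E)) (d : Points F) (τ : Bool) :
    IsChart F τ (ofPl τ ⁻¹' E.carrier) fun z => evalD t d (ofPl τ z) :=
  IsChart.of_section t (E.isHex τ) isWeyl_id (fun _ hz => hz) fun _ hz =>
    (evalD_of_mem t d hz).symm

theorem IsCorner.exists_smul_mem {σ : Set Apt} {E : Enclosure} (h : IsCorner σ E) {v : Apt}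
    (hv : ∀ r : ℝ, 0 ≤ r → r • v ∈ σ) : ∃ δ > 0, ∀ r : ℝ, 0 ≤ r → r ≤ δ → r • v ∈ E.carrier := by
  rw [← eventually_nhdsGE_zero]
  have hc : Filter.Tendsto (fun r : ℝ => r • v) (𝓝[≥] 0) (𝓝 0) := by
    have : Continuous fun r : ℝ => r • v := by fun_prop
    have h := this.tendsto 0
    rw [zero_smul] at h
    exact h.mono_left nhdsWithin_le_nhds
  filter_upwards [hc.eventually h.2, self_mem_nhdsWithin] with r hr h0
  exact hr.2 (hv r h0)

theorem root_wt (ε ε' : Bool) : root ε' (wt ε) = if ε' = ε then 1 else 0 := by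
  cases ε <;> cases ε' <;> simp [root] <;> norm_num

theorem root_smul (ε : Bool) (r : ℝ) (x : Apt) : root ε (r • x) = r * root ε x := by
  cases ε <;> simp [root] <;> ring

theorem smul_wt_mem_ray (ε : Bool) {r : ℝ} (hr : 0 ≤ r) : r • wt ε ∈ ray ε := by
  refine ⟨?_, ?_⟩ <;> rw [root_smul, root_wt] <;> simp [hr]

theorem eq_smul_wt {ε : Bool} {x : Apt} (h : root (!ε) x = 0) : x = root ε x • wt ε := by
  have h0 := crd_sum x
  apply crd_ext
  intro i
  cases ε <;> simp [root] at h <;> fin_cases i <;> simp [root] <;> linarith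

theorem mem_seg {ε : Bool} {t : ℝ} {x : Apt} :
    x ∈ (seg ε t).carrier ↔ ∃ r, 0 ≤ r ∧ r ≤ t ∧ x = r • wt ε := by
  constructor
  · rintro ⟨h1, h2, h3⟩
    exact ⟨root ε x, h1, h2, eq_smul_wt h3⟩
  · rintro ⟨r, h1, h2, rfl⟩
    refine ⟨?_, ?_, ?_⟩ <;> rw [root_smul, root_wt] <;> simp [h1, h2]

/-- The dart defined by the germ of a section along a ray. -/
noncomputable def germDart {x : Points F} (ε : Bool) : SL3.Germ F x (ray ε) → Dart (Points F) :=
  Quotient.lift (fun a => cdart ε fun r => evalD a.sec x (r • wt ε)) (by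
    rintro a b ⟨D, hD, ha, hb, h⟩
    obtain ⟨δ, hδ, hm⟩ := hD.exists_smul_mem fun r hr => smul_wt_mem_ray ε hr
    refine cdart_congr δ hδ fun r h0 h1 => ?_
    have hr := hm r h0 h1
    rw [evalD_of_mem _ _ (ha hr), evalD_of_mem _ _ (hb hr)]
    have := congrArg (fun t => evalAt t ⟨_, hr⟩) h
    simp only [evalAt_map] at this
    exact this)

/-- The dart defined by a vertex of the graph `F_x`. -/
noncomputable def vertexDart {x : Points F} (u : (sphereAt F x).Vertex) : Dart (Points F) :=
  germDart u.1 u.2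

theorem vertexDart_mk {x : Points F} {ε : Bool} {E : Enclosure} (hE : IsCorner (ray ε) E)
    (t : F.obj (op E)) (ht : evalAt t ⟨0, hE.1⟩ = x) {γ : ℝ → Points F} {δ : ℝ} (hδ : 0 < δ)
    (h : ∀ r, 0 ≤ r → r ≤ δ → ∀ hr : r • wt ε ∈ E.carrier, evalAt t ⟨r • wt ε, hr⟩ = γ r) :
    vertexDart (F := F) (x := x) ⟨ε, Germ.mk hE t ht⟩ = cdart ε γ := by
  obtain ⟨δ', hδ', hm⟩ := hE.exists_smul_mem fun r hr => smul_wt_mem_ray ε hr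
  change cdart ε (fun r => evalD t x (r • wt ε)) = _
  refine cdart_congr (min δ δ') (lt_min hδ hδ') fun r h0 h1 => ?_
  rw [le_min_iff] at h1
  rw [evalD_of_mem _ _ (hm r h0 h1.2)]
  exact h r h0 h1.1 _

theorem vertexDart_injective (hF : IsSeparated F) {x : Points F} :
    Function.Injective (vertexDart (F := F) (x := x)) := by
  rintro ⟨ε, a⟩ ⟨ε', b⟩ h
  have hε : ε = ε' := by
    induction a using Quotient.inductionOn
    induction b using Quotient.inductionOn
    exact congrArg Prod.fst h
  subst hε
  congr 1
  induction a using Quotient.inductionOn with | _ a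
  induction b using Quotient.inductionOn with | _ b
  obtain ⟨-, δ, hδ, hab⟩ := cdart_eq_iff.1 h
  refine Quotient.sound ⟨(a.E.inter b.E).inter (seg ε δ), (a.corner.inter b.corner subset_rfl).inter
    (seg_corner ε hδ) subset_rfl, fun x hx => hx.1.1, fun x hx => hx.1.2, hF _ _ _ fun e => ?_⟩
  obtain ⟨r, h0, h1, hr⟩ := mem_seg.1 e.2.2
  rw [evalAt_map, evalAt_map]
  have := hab r h0 h1
  rw [← hr, evalD_of_mem _ _ e.2.1.1, evalD_of_mem _ _ e.2.1.2] at this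
  exact this

theorem root_true_ofPl (z : Pl) : root true (ofPl true z) = z.1 := by
  simp [root, crd_ofPl_true]; ring

theorem root_false_ofPl (z : Pl) : root false (ofPl true z) = z.2 := by
  simp [root, crd_ofPl_true]; ring

/-- The direction in the frame `ofPl true` of the ray of parity `ε` of the standard chamber. -/
def stdDir (ε : Bool) : Fin 6 := if ε then 0 else 1

theorem ofPl_stdDir (ε : Bool) (r : ℝ) : ofPl true (r • dr (stdDir ε)) = r • wt ε := by
  cases ε <;> simp [stdDir, ofPl, dr]

/-- The two faces of the germ of a section on a chamber. -/
theorem vertexDart_face {x : Points F} {E : Enclosure} (hE : IsCorner chamber E)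
    (t : F.obj (op E)) (ht : evalAt t ⟨0, hE.1⟩ = x) {f : Pl → Points F}
    (h : ∀ z (hz : ofPl true z ∈ E.carrier), evalAt t ⟨ofPl true z, hz⟩ = f z) (ε : Bool) :
    vertexDart (x := x) ⟨ε, (sphereAt F x).face ε (Germ.mk hE t ht)⟩ =
      dart true f 0 (stdDir ε) := by
  have : dart true f 0 (stdDir ε) = cdart ε fun r => f (0 + r • dr (stdDir ε)) := by
    cases ε <;> rfl
  rw [this]
  refine vertexDart_mk _ _ _ one_pos fun r h0 h1 hr => ?_
  rw [evalAt_map, zero_add, ← h _ (by rw [ofPl_stdDir]; exact hr.1)]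
  congr 1
  exact Subtype.ext (ofPl_stdDir ε r).symm

theorem sees_of_corner {E : Enclosure} (hE : IsCorner chamber E) (ε : Bool) :
    Sees (ofPl true ⁻¹' E.carrier) 0 (stdDir ε) := by
  obtain ⟨δ, hδ, hm⟩ := hE.exists_smul_mem (v := wt ε) fun r hr => ray_subset ε (smul_wt_mem_ray ε hr)
  refine eventually_nhdsGE_zero.2 ⟨δ, hδ, fun r h0 h1 => ?_⟩
  rw [Set.mem_preimage, zero_add, ofPl_stdDir]
  exact hm r h0 h1

/-- A chart containing the standard chamber near the origin defines a germ on this chamber. -/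
theorem IsChart.exists_corner {s : Set Pl} {f : Pl → Points F} (hf : IsChart F true s f)
    (h0 : 0 ∈ s) (h1 : Sees s 0 0) (h2 : Sees s 0 1) :
    ∃ (E : Enclosure) (hE : IsCorner chamber E) (t : F.obj (op E)),
      evalAt t ⟨0, hE.1⟩ = f 0 ∧ (∀ z, ofPl true z ∈ E.carrier → z ∈ s) ∧
      ∀ z (hz : ofPl true z ∈ E.carrier), evalAt t ⟨ofPl true z, hz⟩ = f z := by
  obtain ⟨ρ₁, hρ₁, hr1⟩ := eventually_nhdsGE_zero.1 h1
  obtain ⟨ρ₂, hρ₂, hr2⟩ := eventually_nhdsGE_zero.1 h2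
  obtain ⟨ρ, hρ, hρ1, hρ2⟩ : ∃ ρ > 0, ρ ≤ ρ₁ ∧ ρ ≤ ρ₂ :=
    ⟨min ρ₁ ρ₂, lt_min hρ₁ hρ₂, min_le_left _ _, min_le_right _ _⟩
  let D : Set Pl := {z | (0 ≤ z.1 ∧ z.1 ≤ ρ) ∧ (0 ≤ z.2 ∧ z.2 ≤ ρ) ∧
    (0 ≤ z.1 + z.2 ∧ z.1 + z.2 ≤ ρ)}
  have hD : IsHex D := isHex_mk _ _ _ _ _ _
  have hDs : D ⊆ s := by
    rintro ⟨p, q⟩ ⟨⟨a1, a2⟩, ⟨a3, a4⟩, a5, a6⟩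
    have := hf.1.convex_chamber (e := 0) 0 h0 (hr1 ρ hρ.le hρ1) (hr2 ρ hρ.le hρ2) a1 a3 a6
    simpa [dr] using this
  obtain ⟨hD', t, ht⟩ := hf.mono hD hDs
  have hE : IsCorner chamber (encl true D hD') := by
    have hz : toPl true 0 = 0 := by ext <;> simp [toPl]
    refine ⟨?_, ?_⟩
    · rw [mem_encl, hz]
      simp only [D, Set.mem_ofPred_eq, Prod.fst_zero, Prod.snd_zero]
      and_intros <;> linarith
    · have c1 : Continuous fun x : Apt => (toPl true x).1 + (toPl true x).2 :=
        (continuous_fst.comp (continuous_toPl true)).add (continuous_snd.comp (continuous_toPl true))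
      have e1 : ∀ᶠ x in 𝓝 (0 : Apt), (toPl true x).1 + (toPl true x).2 < ρ :=
        c1.continuousAt.eventually_lt continuousAt_const (by rw [hz]; simpa using hρ)
      filter_upwards [e1] with x hx
      rw [mem_encl]
      constructor
      · rintro ⟨⟨a1, a2⟩, ⟨a3, a4⟩, a5, a6⟩
        rintro (_ | _)
        · exact a3
        · exact a1
      · intro h
        have g1 : 0 ≤ (toPl true x).1 := h true
        have g2 : 0 ≤ (toPl true x).2 := h false
        simp only [D, Set.mem_ofPred_eq]
        and_intros <;> linarith
  refine ⟨_, hE, t, ?_, fun z hz => hDs (ofPl_mem_encl.1 hz), fun z hz => ?_⟩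
  · rw [ht]; congr 1; ext <;> simp [toPl]
  · rw [ht]; simp only [toPl_ofPl]

/-- Adjacency of darts for an arbitrary presheaf. -/
def IsAdj (F : Enclosureᵒᵖ ⥤ Type) (u v : Dart (Points F)) : Prop :=
  ∃ τ s f, IsChart F τ s f ∧ 0 ∈ s ∧ Sees s 0 0 ∧ Sees s 0 1 ∧ u = dart τ f 0 0 ∧ v = dart τ f 0 1

theorem IsAdj.symm {u v : Dart (Points F)} (h : IsAdj F u v) : IsAdj F v u := by
  obtain ⟨τ, s, f, hf, h0, h1, h2, rfl, rfl⟩ := h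
  refine ⟨_, _, _, (hf.frame 0 1).reflect, ?_, ?_, ?_, ?_, ?_⟩
  · simpa [reflR, fr] using h0
  · rw [sees_reflR, sees_fr]; simpa [reflR, fr] using h2
  · rw [sees_reflR, sees_fr]; simpa [reflR, fr] using h1
  · rw [dart_reflR (f := fun z => f (fr 0 1 z)), dart_fr]; simp [reflR, fr]
  · rw [dart_reflR (f := fun z => f (fr 0 1 z)), dart_fr]; simp [reflR, fr]

theorem IsAdj.type {u v : Dart (Points F)} (h : IsAdj F u v) : v.1 = !u.1 := by
  obtain ⟨τ, s, f, hf, h0, h1, h2, rfl, rfl⟩ := h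
  rfl

theorem vertexDart_type {x : Points F} (u : (sphereAt F x).Vertex) : (vertexDart u).1 = u.1 := by
  obtain ⟨ε, a⟩ := u
  induction a using Quotient.inductionOn
  rfl

theorem vertexDart_base {x : Points F} {u : (sphereAt F x).Vertex} {τ : Bool} {γ : ℝ → Points F}
    (h : vertexDart u = cdart τ γ) : γ 0 = x := by
  obtain ⟨ε, a⟩ := u
  induction a using Quotient.inductionOn with | _ a
  have := cdart_apply_zero h
  simp only [zero_smul, evalD_of_mem _ _ a.corner.1] at this
  rw [← this]
  exact a.base

theorem graph_adj_iff (hF : IsSeparated F) {x : Points F} {u v : (sphereAt F x).Vertex} :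
    (sphereAt F x).graph.Adj u v ↔ IsAdj F (vertexDart u) (vertexDart v) := by
  constructor
  · rintro ⟨e, ε, rfl, rfl⟩
    induction e using Quotient.inductionOn with | _ a
    have hc := isChart_evalD a.sec x true
    have h0 : (0 : Pl) ∈ ofPl true ⁻¹' a.E.carrier := by
      rw [Set.mem_preimage, ofPl_zero]; exact a.corner.1
    have hf := fun ε => vertexDart_face a.corner a.sec a.base
      (f := fun z => evalD a.sec x (ofPl true z)) (fun z hz => (evalD_of_mem _ _ hz).symm) ε
    have key : IsAdj F (vertexDart ⟨true, (sphereAt F x).face true (Germ.mk a.corner a.sec a.base)⟩)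
        (vertexDart ⟨false, (sphereAt F x).face false (Germ.mk a.corner a.sec a.base)⟩) :=
      ⟨true, _, _, hc, h0, sees_of_corner a.corner true, sees_of_corner a.corner false, hf true,
        hf false⟩
    cases ε
    · exact key.symm
    · exact key
  · intro h
    have key : ∀ {u v : (sphereAt F x).Vertex}, u.1 = true → IsAdj F (vertexDart u) (vertexDart v) →
        (sphereAt F x).graph.Adj u v := by
      intro u v hu h
      obtain ⟨τ, s, f, hf, h0, h1, h2, hu', hv'⟩ := h
      have hτ : τ = true := by
        rw [← hu, ← vertexDart_type u, hu']; rfl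
      subst hτ
      have hb : f 0 = x := by simpa using vertexDart_base hu'
      obtain ⟨E, hE, t, ht, -, hz⟩ := hf.exists_corner h0 h1 h2
      refine ⟨Germ.mk hE t (ht.trans hb), true, vertexDart_injective hF ?_,
        vertexDart_injective hF ?_⟩
      · rw [hu', vertexDart_face hE t _ hz]; rfl
      · rw [hv']; exact (vertexDart_face hE t (ht.trans hb) hz false).symm
    by_cases hu : u.1 = true
    · exact key hu h
    · refine (key ?_ h.symm).symm
      rw [← vertexDart_type, h.type, vertexDart_type]
      simpa using hu

/-- Every dart at `x` is defined by a vertex of `F_x`. -/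
theorem exists_vertexDart {x : Points F} {τ : Bool} {s : Set Pl} {f : Pl → Points F}
    (hf : IsChart F τ s f) (h0 : 0 ∈ s) (h1 : Sees s 0 0) (hx : f 0 = x) :
    ∃ u : (sphereAt F x).Vertex, vertexDart u = dart τ f 0 0 := by
  obtain ⟨c, hc, hcs⟩ := h1.exists_mem
  have hm : ∀ r, 0 ≤ r → r ≤ c → (0 : Pl) + r • dr 0 ∈ s := fun r a b => hf.1.line 0 h0 hcs a b
  obtain ⟨hs, t, ht⟩ := hf
  have hsub : (seg τ c).carrier ⊆ (encl τ s hs).carrier := by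
    intro x hx
    obtain ⟨r, a, b, rfl⟩ := mem_seg.1 hx
    rw [← ofPl_line, ofPl_mem_encl]
    simpa [dr] using hm r a b
  have hz : ∀ τ, toPl τ 0 = 0 := fun τ => by cases τ <;> (ext <;> simp [toPl])
  refine ⟨⟨τ, Germ.mk (seg_corner τ hc) (F.map (Enclosure.incl hsub).op t) ?_⟩, ?_⟩
  · rw [evalAt_map, ht, ← hx]
    exact congrArg f (hz τ)
  · refine vertexDart_mk _ _ _ hc fun r a b hr => ?_
    rw [evalAt_map, ht]
    have e : (((Enclosure.incl hsub).toFun ⟨r • wt τ, hr⟩ : (encl τ s hs).carrier) : Apt) =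
        ofPl τ (r, 0) := (ofPl_line τ r).symm
    rw [e, toPl_ofPl]
    congr 1; ext <;> simp [dr]

theorem exists_isChart_of_vertex {x : Points F} (u : (sphereAt F x).Vertex) :
    ∃ s f, IsChart F u.1 s f ∧ 0 ∈ s ∧ Sees s 0 0 ∧ f 0 = x ∧ vertexDart u = dart u.1 f 0 0 := by
  obtain ⟨ε, a⟩ := u
  induction a using Quotient.inductionOn with | _ a
  obtain ⟨δ, hδ, hm⟩ := a.corner.exists_smul_mem fun r hr => smul_wt_mem_ray ε hr
  have e : ∀ r : ℝ, ofPl ε ((0 : Pl) + r • dr 0) = r • wt ε := fun r => by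
    rw [zero_add, ofPl_smul, ofPl_dr_zero]
  refine ⟨_, _, isChart_evalD a.sec x ε, ?_, ?_, ?_, ?_⟩
  · rw [Set.mem_preimage, ofPl_zero]; exact a.corner.1
  · refine eventually_nhdsGE_zero.2 ⟨δ, hδ, fun r h0 h1 => ?_⟩
    rw [Set.mem_preimage, e]
    exact hm r h0 h1
  · simp only [ofPl_zero, evalD_of_mem _ _ a.corner.1]
    exact a.base
  · change cdart ε _ = cdart ε _
    simp only [e]

/-! ### Distances in bipartite graphs of diameter three -/

theorem SphericalConstruction.adj_color {H : SphericalConstruction} {u v : H.Vertex}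
    (h : H.graph.Adj u v) : v.1 = !u.1 := by
  obtain ⟨e, ε, rfl, rfl⟩ := h
  rfl

theorem SphericalConstruction.walk_color {H : SphericalConstruction} {u v : H.Vertex}
    (p : H.graph.Walk u v) : u.1 = v.1 ↔ Even p.length := by
  induction p with
  | nil => simp
  | @cons b c w h p ih =>
    have := H.adj_color h
    rw [SimpleGraph.Walk.length_cons, Nat.even_add_one, ← ih, this]
    cases b.1 <;> cases w.1 <;> simp

open Classical in
/-- Distances in a bipartite graph of diameter at most three. -/
theorem SphericalConstruction.edist_eq {H : SphericalConstruction}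
    (hd : ∀ u v, H.graph.edist u v ≤ 3) (u v : H.Vertex) : H.graph.edist u v =
      if u.1 = v.1 then if u = v then 0 else 2 else if H.graph.Adj u v then 1 else 3 := by
  have hne : H.graph.edist u v ≠ ⊤ := fun h => by
    have := hd u v
    rw [h] at this
    exact absurd this (by decide)
  obtain ⟨p, hp⟩ := SimpleGraph.exists_walk_of_edist_ne_top hne
  have hc := H.walk_color p
  have h3 : p.length ≤ 3 := by
    have := hd u v
    rw [← hp] at this
    exact_mod_cast this
  by_cases huv : u = v
  · subst huv; simp
  by_cases hadj : H.graph.Adj u v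
  · have h1 : u.1 ≠ v.1 := by rw [H.adj_color hadj]; cases u.1 <;> simp
    rw [if_neg h1, if_pos hadj]
    exact SimpleGraph.edist_eq_one_iff_adj.2 hadj
  rw [← hp]
  have h0 : p.length ≠ 0 := fun h => huv (SimpleGraph.Walk.eq_of_length_eq_zero h)
  have h1 : p.length ≠ 1 := fun h => hadj (SimpleGraph.edist_eq_one_iff_adj.1 (by rw [← hp, h]; rfl))
  have h23 : p.length = 2 ∨ p.length = 3 := by omega
  rcases h23 with h | h <;> rw [h] at hc ⊢
  · rw [if_pos (hc.2 (by decide)), if_neg huv]; rfl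
  · rw [if_neg (fun h => absurd (hc.1 h) (by decide)), if_neg hadj]; rfl

theorem SphericalConstruction.edist_eq_iff {H H' : SphericalConstruction}
    (hd : ∀ u v, H.graph.edist u v ≤ 3) (hd' : ∀ u v, H'.graph.edist u v ≤ 3) {u v : H.Vertex}
    {u' v' : H'.Vertex} (hu : u.1 = u'.1) (hv : v.1 = v'.1) :
    H.graph.edist u v = H'.graph.edist u' v' ↔ (u.1 = v.1 → (u = v ↔ u' = v')) ∧
      (u.1 ≠ v.1 → (H.graph.Adj u v ↔ H'.graph.Adj u' v')) := by
  classical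
  rw [H.edist_eq hd, H'.edist_eq hd', ← hu, ← hv]
  by_cases h : u.1 = v.1
  · rw [if_pos h, if_pos h]
    by_cases a : u = v <;> by_cases b : u' = v' <;> simp [a, b, h]
  · rw [if_neg h, if_neg h]
    by_cases a : H.graph.Adj u v <;> by_cases b : H'.graph.Adj u' v' <;> simp [a, b, h]

/-! ### The hexagon of directions in the affine space -/

/-- The point `a` of `A`, as a point of the presheaf `A`. -/
def aptPoint (a : Apt) : Points aptPresheaf :=
  ⟨fun x => x + a, _, isWeyl_translate a, fun _ => rfl⟩

/-- The inverse of `aptPoint`. -/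
def aptVal (x : Points aptPresheaf) : Apt := x.1 ⟨0, rfl⟩

theorem aptVal_injective : Function.Injective aptVal := by
  intro x y h
  apply Subtype.ext
  funext z
  have : z = ⟨0, rfl⟩ := Subtype.ext z.2
  rw [this]
  exact h

theorem aptVal_aptPoint (a : Apt) : aptVal (aptPoint a) = a := zero_add a

theorem aptPoint_aptVal (x : Points aptPresheaf) : aptPoint (aptVal x) = x :=
  aptVal_injective (aptVal_aptPoint _)

theorem aptVal_evalAt {E : Enclosure} (t : aptPresheaf.obj (op E)) (e : E.carrier) :
    aptVal (evalAt t e) = t.1 e := by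
  change t.1 ((Enclosure.point e).toFun ⟨0, rfl⟩) = t.1 e
  exact congrArg t.1 (Subtype.ext (zero_add _))

theorem isSeparated_aptPresheaf : IsSeparated aptPresheaf := by
  intro E s s' h
  apply Subtype.ext
  funext e
  have := congrArg aptVal (h e)
  rwa [aptVal_evalAt, aptVal_evalAt] at this

/-- The section of the presheaf `A` given by the inclusion of an enclosure. -/
def aptSec (E : Enclosure) : aptPresheaf.obj (op E) := ⟨Subtype.val, id, isWeyl_id, fun _ => rfl⟩

theorem evalAt_aptSec {E : Enclosure} (e : E.carrier) : evalAt (aptSec E) e = aptPoint e :=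
  aptVal_injective (by rw [aptVal_evalAt, aptVal_aptPoint]; rfl)

theorem isChart_aptPoint {s : Set Pl} (hs : IsHex s) (τ : Bool) :
    IsChart aptPresheaf τ s fun z => aptPoint (ofPl τ z) :=
  ⟨hs, aptSec _, fun x => by rw [evalAt_aptSec]; simp only [ofPl_toPl]⟩

/-- The action of `S₃` on the directions. -/
theorem exists_dr_of_perm (σ : Equiv.Perm (Fin 3)) (ε : Bool) :
    ∃ k, typ true k = ε ∧ permAct σ (wt ε) = ofPl true (dr k) := by
  have ht : ∀ j, crd (wt true) j = if j = 0 then 2 / 3 else -1 / 3 := by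
    intro j; fin_cases j <;> simp
  have hf : ∀ j, crd (wt false) j = if j = 2 then -2 / 3 else 1 / 3 := by
    intro j; fin_cases j <;> simp
  have hs : ∀ i j : Fin 3, σ i = j ↔ i = σ.symm j := fun i j => (Equiv.eq_symm_apply σ).symm
  cases ε
  · generalize hj : σ.symm 2 = j
    have : ∀ i, crd (permAct σ (wt false)) i = if i = j then -2 / 3 else 1 / 3 := by
      intro i; rw [crd_permAct, hf]; simp only [hs, hj]
    fin_cases j
    · refine ⟨3, rfl, crd_ext fun i => ?_⟩
      rw [this, crd_ofPl_true]; fin_cases i <;> simp [dr]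
    · refine ⟨5, rfl, crd_ext fun i => ?_⟩
      rw [this, crd_ofPl_true]; fin_cases i <;> simp [dr] <;> norm_num
    · refine ⟨1, rfl, crd_ext fun i => ?_⟩
      rw [this, crd_ofPl_true]; fin_cases i <;> simp [dr]
  · generalize hj : σ.symm 0 = j
    have : ∀ i, crd (permAct σ (wt true)) i = if i = j then 2 / 3 else -1 / 3 := by
      intro i; rw [crd_permAct, ht]; simp only [hs, hj]
    fin_cases j
    · refine ⟨0, rfl, crd_ext fun i => ?_⟩
      rw [this, crd_ofPl_true]; fin_cases i <;> simp [dr]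
    · refine ⟨2, rfl, crd_ext fun i => ?_⟩
      rw [this, crd_ofPl_true]; fin_cases i <;> simp [dr] <;> norm_num
    · refine ⟨4, rfl, crd_ext fun i => ?_⟩
      rw [this, crd_ofPl_true]; fin_cases i <;> simp [dr]

theorem permAct_zero (σ : Equiv.Perm (Fin 3)) : permAct σ 0 = 0 := crd_ext fun i => by simp

theorem permAct_smul (σ : Equiv.Perm (Fin 3)) (r : ℝ) (x : Apt) :
    permAct σ (r • x) = r • permAct σ x := crd_ext fun i => by simp

/-- The dart of the affine space at the point with coordinates `e` in the direction `dr k`. -/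
noncomputable def aptDart (e : Pl) (k : Fin 6) : Dart (Points aptPresheaf) :=
  dart true (fun z => aptPoint (ofPl true z)) e k

theorem dr_injective : Function.Injective dr := by
  intro k k' h
  rw [Prod.ext_iff] at h
  revert h
  fin_cases k <;> fin_cases k' <;> simp [dr] <;> norm_num

theorem aptDart_injective (e : Pl) : Function.Injective (aptDart e) := by
  intro k k' h
  obtain ⟨-, δ, hδ, h⟩ := cdart_eq_iff.1 h
  have := congrArg aptVal (h δ hδ.le le_rfl)
  rw [aptVal_aptPoint, aptVal_aptPoint] at this
  have := add_left_cancel (ofPl_injective true this)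
  exact dr_injective (smul_right_injective _ hδ.ne' this)

/-- The squared length on `A`. -/
def sqLen (x : Apt) : ℝ := ∑ i, crd x i ^ 2

theorem sqLen_permAct (σ : Equiv.Perm (Fin 3)) (x : Apt) : sqLen (permAct σ x) = sqLen x :=
  Equiv.sum_comp σ fun i => crd x i ^ 2

theorem permAct_sub (σ : Equiv.Perm (Fin 3)) (x y : Apt) :
    permAct σ x - permAct σ y = permAct σ (x - y) := rfl

theorem isAdj_aptDart_iff {e : Pl} {k k' : Fin 6} :
    IsAdj aptPresheaf (aptDart e k) (aptDart e k') ↔ k' = k + 1 ∨ k = k' + 1 := by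
  constructor
  · rintro ⟨τ, s, f, ⟨hs, t, ht⟩, h0, h1, h2, hu, hv⟩
    obtain ⟨g, ⟨σ, v, hg⟩, hgt⟩ := t.2
    have hf : ∀ z ∈ s, aptVal (f z) = permAct σ (ofPl τ z) + v := by
      intro z hz
      have h := ht ⟨ofPl τ z, ofPl_mem_encl.2 hz⟩
      simp only [toPl_ofPl] at h
      rw [← h, aptVal_evalAt, hgt, hg]
    obtain ⟨-, δ₁, p1, u1⟩ := cdart_eq_iff.1 hu
    obtain ⟨-, δ₂, p2, u2⟩ := cdart_eq_iff.1 hv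
    obtain ⟨δ₃, p3, u3⟩ := eventually_nhdsGE_zero.1 h1
    obtain ⟨δ₄, p4, u4⟩ := eventually_nhdsGE_zero.1 h2
    obtain ⟨r, hr, r1, r2, r3, r4⟩ : ∃ r > 0, r ≤ δ₁ ∧ r ≤ δ₂ ∧ r ≤ δ₃ ∧ r ≤ δ₄ :=
      ⟨min (min δ₁ δ₂) (min δ₃ δ₄), by positivity, by simp, by simp, by simp, by simp⟩
    have a1 := congrArg aptVal (u1 r hr.le r1)
    have a2 := congrArg aptVal (u2 r hr.le r2)
    rw [aptVal_aptPoint, hf _ (u3 r hr.le r3), zero_add, ofPl_add, ofPl_smul, ofPl_smul] at a1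
    rw [aptVal_aptPoint, hf _ (u4 r hr.le r4), zero_add, ofPl_add, ofPl_smul, ofPl_smul] at a2
    have a3 : r • (ofPl true (dr k) - ofPl true (dr k')) =
        r • permAct σ (ofPl τ (dr 0) - ofPl τ (dr 1)) := by
      rw [smul_sub, ← permAct_sub, smul_sub, ← permAct_smul, ← permAct_smul]
      have := congrArg₂ (· - ·) a1 a2
      simpa using this
    have a4 := congrArg sqLen (smul_right_injective _ hr.ne' a3)
    simp only [sqLen_permAct] at a4
    have a5 : sqLen (ofPl τ (dr 0) - ofPl τ (dr 1)) = 2 / 3 := by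
      cases τ <;> simp [sqLen, sub_eq_add_neg, crd_ofPl_true, crd_ofPl_false, Fin.sum_univ_three, dr]
        <;> norm_num
    rw [a5] at a4
    simp only [sqLen, sub_eq_add_neg, crd_add, crd_neg, crd_ofPl_true, Fin.sum_univ_three] at a4
    revert a4
    fin_cases k <;> fin_cases k' <;> simp [dr] <;> norm_num
  · have key : ∀ k, IsAdj aptPresheaf (aptDart e k) (aptDart e (k + 1)) := by
      intro k
      have hx := isHex_mk (-1) 1 (-1) 1 (-1) 1
      have hc := isChart_aptPoint ((hx.fr_preimage (-e) 0)) true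
      have hm : ∀ j, e + (1 : ℝ) • dr j ∈ fr (-e) 0 ⁻¹' {z : Pl | (-1 ≤ z.1 ∧ z.1 ≤ 1) ∧
          (-1 ≤ z.2 ∧ z.2 ≤ 1) ∧ (-1 ≤ z.1 + z.2 ∧ z.1 + z.2 ≤ 1)} := by
        intro j
        rw [Set.mem_preimage, fr_std, neg_add_cancel_left, one_smul]
        fin_cases j <;> simp [dr]
      have he : e ∈ fr (-e) 0 ⁻¹' {z : Pl | (-1 ≤ z.1 ∧ z.1 ≤ 1) ∧
          (-1 ≤ z.2 ∧ z.2 ≤ 1) ∧ (-1 ≤ z.1 + z.2 ∧ z.1 + z.2 ≤ 1)} := by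
        rw [Set.mem_preimage, fr_std, neg_add_cancel]
        simp
      have hs := fun j => hc.1.sees he one_pos (hm j)
      refine ⟨_, _, _, hc.frame e k, ?_, ?_, ?_, ?_, ?_⟩
      · rw [Set.mem_preimage, fr_zero]; exact he
      · rw [sees_fr, fr_zero]; exact hs _
      · rw [sees_fr, fr_zero]; exact hs _
      · rw [dart_fr (f := fun z => aptPoint (ofPl true z)), fr_zero, add_zero]; rfl
      · rw [dart_fr (f := fun z => aptPoint (ofPl true z)), fr_zero]; rfl
    rintro (rfl | rfl)
    · exact key _
    · exact (key _).symm

theorem exists_aptDart {x : Points aptPresheaf} (w : (sphereAt aptPresheaf x).Vertex) :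
    ∃ k, vertexDart w = aptDart (toPl true (aptVal x)) k := by
  obtain ⟨ε, a⟩ := w
  induction a using Quotient.inductionOn with | _ a
  obtain ⟨g, ⟨σ, v, hg⟩, ha⟩ := a.sec.2
  obtain ⟨k, hk, hk'⟩ := exists_dr_of_perm σ ε
  have hx : aptVal x = v := by
    rw [← a.base, aptVal_evalAt, ha, hg, permAct_zero, zero_add]
  refine ⟨k, ?_⟩
  have : aptDart (toPl true (aptVal x)) k = cdart ε fun r => aptPoint (r • permAct σ (wt ε) + v) := by
    unfold aptDart dart
    rw [hk]
    congr 1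
    funext r
    change aptPoint (ofPl true (_ + _)) = _
    rw [ofPl_add, ofPl_toPl, hx, ofPl_smul, hk', add_comm]
  rw [this]
  refine vertexDart_mk a.corner a.sec a.base one_pos fun r _ _ hr => aptVal_injective ?_
  rw [aptVal_evalAt, ha, hg, aptVal_aptPoint, permAct_smul]

theorem exists_aptVertex (x : Points aptPresheaf) (k : Fin 6) :
    ∃ w : (sphereAt aptPresheaf x).Vertex, vertexDart w = aptDart (toPl true (aptVal x)) k := by
  have h := (isAdj_aptDart_iff (e := toPl true (aptVal x)) (k := k)).2 (Or.inl rfl)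
  obtain ⟨τ, s, f, hf, h0, h1, -, hu, -⟩ := h
  rw [hu]
  refine exists_vertexDart hf h0 h1 ?_
  have := cdart_apply_zero hu
  simp only [zero_smul, add_zero, ofPl_toPl] at this
  rw [← this, aptPoint_aptVal]

theorem edist_aptPresheaf_le (x : Points aptPresheaf) (u v : (sphereAt aptPresheaf x).Vertex) :
    (sphereAt aptPresheaf x).graph.edist u v ≤ 3 := by
  choose W hW using exists_aptVertex x
  have hadj : ∀ k, (sphereAt aptPresheaf x).graph.Adj (W k) (W (k + 1)) := fun k => by
    rw [graph_adj_iff isSeparated_aptPresheaf, hW, hW, isAdj_aptDart_iff]; exact Or.inl rfl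
  have hsurj : ∀ u, ∃ k, u = W k := fun u => by
    obtain ⟨k, hk⟩ := exists_aptDart u
    exact ⟨k, vertexDart_injective isSeparated_aptPresheaf (by rw [hk, hW])⟩
  obtain ⟨i, rfl⟩ := hsurj u
  obtain ⟨j, rfl⟩ := hsurj v
  have key : ∀ i m, m ∈ ({0, 1, 2, 3} : Finset (Fin 6)) →
      (sphereAt aptPresheaf x).graph.edist (W i) (W (i + m)) ≤ 3 := by
    intro i m hm
    have h0 := hadj i
    have h1 := hadj (i + 1)
    have h2 := hadj (i + 2)
    rw [add_assoc i 1 1, show (1 : Fin 6) + 1 = 2 from rfl] at h1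
    rw [add_assoc i 2 1, show (2 : Fin 6) + 1 = 3 from rfl] at h2
    simp only [Finset.mem_insert, Finset.mem_singleton] at hm
    rcases hm with rfl | rfl | rfl | rfl
    · rw [add_zero, SimpleGraph.edist_self]; exact zero_le
    · exact (SimpleGraph.edist_le (.cons h0 .nil)).trans (by simp)
    · exact (SimpleGraph.edist_le (.cons h0 (.cons h1 .nil))).trans (by simp; decide)
    · exact (SimpleGraph.edist_le (.cons h0 (.cons h1 (.cons h2 .nil)))).trans (by simp)
  have hcase : ∀ i j : Fin 6, (∃ m ∈ ({0, 1, 2, 3} : Finset (Fin 6)), j = i + m) ∨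
      ∃ m ∈ ({0, 1, 2, 3} : Finset (Fin 6)), i = j + m := by decide
  rcases hcase i j with ⟨m, hm, rfl⟩ | ⟨m, hm, rfl⟩
  · exact key _ m hm
  · rw [SimpleGraph.edist_comm]; exact key _ m hm

/-! ### Immersive maps in terms of darts -/

/-- The vertex `u` of `E_e` points in the direction `dr k`, and so do its images under all maps
defined on `E`. -/
def HasDir {E : Enclosure} (e : E.carrier)
    (u : (sphereAt (yoneda.obj E) (Enclosure.pointOf e)).Vertex) (k : Fin 6) : Prop :=
  typ true k = u.1 ∧ Sees (ofPl true ⁻¹' E.carrier) (toPl true e) k ∧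
    ∀ (G : Enclosureᵒᵖ ⥤ Type) (g : G.obj (op E)) (d : Points G),
      vertexDart (sphereMap (secHom g) u) =
        dart true (fun z => evalD g d (ofPl true z)) (toPl true e) k

theorem hasDir_mk {E D : Enclosure} {e : E.carrier} {ε : Bool} (hD : IsCorner (ray ε) D)
    (h : D ⟶ E) (hb : evalAt (F := yoneda.obj E) h ⟨0, hD.1⟩ = Enclosure.pointOf e) {k : Fin 6}
    (hk : typ true k = ε) {δ : ℝ} (hδ : 0 < δ)
    (hh : ∀ r, 0 ≤ r → r ≤ δ → ∀ hr : r • wt ε ∈ D.carrier,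
      (h.toFun ⟨r • wt ε, hr⟩ : Apt) = ofPl true (toPl true e + r • dr k)) :
    HasDir e ⟨ε, Germ.mk hD h hb⟩ k := by
  obtain ⟨δ', hδ', hm⟩ := hD.exists_smul_mem fun r hr => smul_wt_mem_ray ε hr
  refine ⟨hk, eventually_nhdsGE_zero.2 ⟨min δ δ', lt_min hδ hδ', fun r h0 h1 => ?_⟩,
    fun G g d => ?_⟩
  · rw [le_min_iff] at h1
    rw [Set.mem_preimage, ← hh r h0 h1.1 (hm r h0 h1.2)]
    exact (h.toFun _).2
  · have e1 : dart true (fun z => evalD g d (ofPl true z)) (toPl true e) k =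
        cdart ε fun r => evalD g d (ofPl true (toPl true e + r • dr k)) := by
      unfold dart; rw [hk]
    rw [e1]
    refine vertexDart_mk (F := G) hD (G.map h.op g) _ hδ fun r h0 h1 hr => ?_
    rw [evalAt_map, ← hh r h0 h1 hr, evalD_of_mem _ _ (h.toFun _).2]

theorem exists_hasDir {E : Enclosure} (e : E.carrier)
    (u : (sphereAt (yoneda.obj E) (Enclosure.pointOf e)).Vertex) : ∃ k, HasDir e u k := by
  obtain ⟨ε, a⟩ := u
  induction a using Quotient.inductionOn with | _ a
  obtain ⟨D, hD, h, hb⟩ := a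
  change D ⟶ E at h
  obtain ⟨g, ⟨σ, v, hg⟩, ha⟩ := h.isAffine
  have ha' : ∀ x, (h.toFun x : Apt) = g x := ha
  obtain ⟨k, hk, hk'⟩ := exists_dr_of_perm σ ε
  have hv : (e : Apt) = v := by
    have h1 : Enclosure.point ⟨0, hD.1⟩ ≫ h = Enclosure.point e := hb
    have h2 := congrArg (fun f : pt ⟶ E => ((f.toFun ⟨0, rfl⟩ : E.carrier) : Apt)) h1
    have h3 : (((Enclosure.point e).toFun ⟨0, rfl⟩ : E.carrier) : Apt) = e := zero_add _
    have h4 : ((Enclosure.point (E := D) ⟨0, hD.1⟩).toFun ⟨0, rfl⟩) = ⟨0, hD.1⟩ :=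
      Subtype.ext (zero_add _)
    change ((h.toFun ((Enclosure.point (E := D) ⟨0, hD.1⟩).toFun ⟨0, rfl⟩) : E.carrier) : Apt) = _
      at h2
    rw [h3, h4, ha', hg, permAct_zero, zero_add] at h2
    exact h2.symm
  refine ⟨k, hasDir_mk hD h hb hk one_pos fun r _ _ hr => ?_⟩
  rw [ha', hg, permAct_smul, hk', ofPl_add, ofPl_toPl, ofPl_smul, hv, add_comm]

theorem exists_vertex_hasDir {E : Enclosure} (e : E.carrier) {k : Fin 6}
    (hk : Sees (ofPl true ⁻¹' E.carrier) (toPl true e) k) :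
    ∃ u : (sphereAt (yoneda.obj E) (Enclosure.pointOf e)).Vertex, HasDir e u k := by
  obtain ⟨δ, hδ, hm⟩ := eventually_nhdsGE_zero.1 hk
  obtain ⟨g, hg, hgz⟩ := exists_weyl_fr true (toPl true e) k
  have hgr : ∀ r : ℝ, g (r • wt (typ true k)) = ofPl true (toPl true e + r • dr k) := fun r => by
    rw [← ofPl_line, ← hgz, fr_smul_zero]
  let h : seg (typ true k) δ ⟶ E := Enclosure.homOf g hg fun x hx => by
    obtain ⟨r, h0, h1, rfl⟩ := mem_seg.1 hx
    rw [hgr]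
    exact hm r h0 h1
  refine ⟨_, hasDir_mk (seg_corner _ hδ) h ?_ rfl hδ fun r _ _ hr => hgr r⟩
  have h0 := hgr 0
  rw [zero_smul, zero_smul, add_zero, ofPl_toPl] at h0
  refine Enclosure.Hom.ext' fun x => ?_
  have hx : (x : Apt) = 0 := x.2
  change g ((x : Apt) + 0) = (x : Apt) + e
  rw [hx, add_zero, h0, zero_add]

theorem aptDart_eq {E : Enclosure} {e : E.carrier} {k : Fin 6} (d : Points aptPresheaf)
    (hk : Sees (ofPl true ⁻¹' E.carrier) (toPl true e) k) :
    dart true (fun z => evalD (aptSec E) d (ofPl true z)) (toPl true e) k =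
      aptDart (toPl true e) k :=
  dart_congr hk fun z hz => by rw [evalD_of_mem _ _ hz, evalAt_aptSec]

/-- The distances in `E_e` and in `F_x` are determined by equality of vertices of the same sign and
adjacency of vertices of opposite signs. -/
theorem immersiveAt_iff (hF : IsSeparated F) (hSB : SBLoc F) {E : Enclosure} (f : F.obj (op E))
    (d : Points F) (e : E.carrier) : ImmersiveAt f e ↔
      ∀ k k', Sees (ofPl true ⁻¹' E.carrier) (toPl true e) k →
        Sees (ofPl true ⁻¹' E.carrier) (toPl true e) k' →
        (typ true k = typ true k' →
          (dart true (fun z => evalD f d (ofPl true z)) (toPl true e) k =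
            dart true (fun z => evalD f d (ofPl true z)) (toPl true e) k' ↔ k = k')) ∧
        (typ true k ≠ typ true k' →
          (IsAdj F (dart true (fun z => evalD f d (ofPl true z)) (toPl true e) k)
            (dart true (fun z => evalD f d (ofPl true z)) (toPl true e) k') ↔
              k' = k + 1 ∨ k = k' + 1)) := by
  have key : ∀ {u v : (sphereAt (yoneda.obj E) (Enclosure.pointOf e)).Vertex} {k k' : Fin 6},
      HasDir e u k → HasDir e v k' →
      ((sphereAt F _).graph.edist (sphereMap (secHom f) u) (sphereMap (secHom f) v) =
        (sphereAt aptPresheaf _).graph.edist (sphereMap E.toApt u) (sphereMap E.toApt v) ↔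
        (typ true k = typ true k' →
          (dart true (fun z => evalD f d (ofPl true z)) (toPl true e) k =
            dart true (fun z => evalD f d (ofPl true z)) (toPl true e) k' ↔ k = k')) ∧
        (typ true k ≠ typ true k' →
          (IsAdj F (dart true (fun z => evalD f d (ofPl true z)) (toPl true e) k)
            (dart true (fun z => evalD f d (ofPl true z)) (toPl true e) k') ↔
              k' = k + 1 ∨ k = k' + 1))) := by
    rintro u v k k' ⟨hu1, hu2, hu3⟩ ⟨hv1, hv2, hv3⟩
    refine (SphericalConstruction.edist_eq_iff (u := sphereMap (secHom f) u)
      (v := sphereMap (secHom f) v) (u' := sphereMap E.toApt u) (v' := sphereMap E.toApt v)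
      (hSB _).edist_le (edist_aptPresheaf_le _) rfl rfl).trans ?_
    have eu : vertexDart (sphereMap E.toApt u) = aptDart (toPl true e) k :=
      (hu3 aptPresheaf (aptSec E) (aptPoint 0)).trans (aptDart_eq _ hu2)
    have ev : vertexDart (sphereMap E.toApt v) = aptDart (toPl true e) k' :=
      (hv3 aptPresheaf (aptSec E) (aptPoint 0)).trans (aptDart_eq _ hv2)
    have c : (sphereMap (secHom f) u).1 = (sphereMap (secHom f) v).1 ↔ typ true k = typ true k' := by
      rw [hu1, hv1]; rfl
    refine and_congr (imp_congr c (iff_congr ?_ ?_)) (imp_congr (not_congr c) (iff_congr ?_ ?_))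
    · refine (vertexDart_injective hF).eq_iff.symm.trans ?_
      rw [hu3 F f d, hv3 F f d]
    · refine (vertexDart_injective isSeparated_aptPresheaf).eq_iff.symm.trans ?_
      rw [eu, ev, (aptDart_injective _).eq_iff]
    · refine (graph_adj_iff hF).trans ?_
      rw [hu3 F f d, hv3 F f d]
    · refine (graph_adj_iff isSeparated_aptPresheaf).trans ?_
      rw [eu, ev, isAdj_aptDart_iff]
  constructor
  · intro h k k' hk hk'
    obtain ⟨u, hu⟩ := exists_vertex_hasDir e hk
    obtain ⟨v, hv⟩ := exists_vertex_hasDir e hk'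
    exact (key hu hv).1 (h u v)
  · intro h u v
    obtain ⟨k, hu⟩ := exists_hasDir e u
    obtain ⟨k', hv⟩ := exists_hasDir e v
    exact (key hu hv).2 (h k k' hu.2.1 hv.2.1)

theorem immersive_iff_imm_true (hF : IsConstruction F) (hSB : SBLoc F) {E : Enclosure}
    (f : F.obj (op E)) (d : Points F) : Immersive f ↔
      hF.atlas.Imm true (ofPl true ⁻¹' E.carrier) fun z => evalD f d (ofPl true z) := by
  have hc : hF.atlas.Chart true (ofPl true ⁻¹' E.carrier) fun z => evalD f d (ofPl true z) :=
    isChart_evalD f d true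
  constructor
  · intro h
    refine ⟨hc, fun z hz k => ?_⟩
    have hi := (immersiveAt_iff hF.isSeparated hSB f d ⟨_, hz⟩).1 (h ⟨_, hz⟩)
    simp only [toPl_ofPl] at hi
    refine ⟨fun h1 h2 heq => ?_, fun h1 h2 hadj => ?_⟩
    · have := ((hi k (k + 2) h1 h2).1 (typ_two _ _).symm).1 heq
      exact absurd this ((by decide : ∀ k : Fin 6, k ≠ k + 2) k)
    · have := ((hi k (k + 3) h1 h2).2 (by rw [typ_three]; cases typ true k <;> simp)).1 hadj
      exact absurd this ((by decide : ∀ k : Fin 6, ¬ (k + 3 = k + 1 ∨ k = k + 3 + 1)) k)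
  · intro h e
    rw [immersiveAt_iff hF.isSeparated hSB f d]
    have he : toPl true e ∈ ofPl true ⁻¹' E.carrier := by
      rw [Set.mem_preimage, ofPl_toPl]; exact e.2
    intro k k' hk hk'
    have hi := h.2 _ he
    have cases6 : ∀ k k' : Fin 6, k' = k ∨ k' = k + 2 ∨ k = k' + 2 ∨ k' = k + 1 ∨ k = k' + 1 ∨
        k' = k + 3 := by decide
    have typ1 : ∀ k, typ true k ≠ typ true (k + 1) := by decide
    have typ3 : ∀ k, typ true k ≠ typ true (k + 3) := by decide
    have ne2 : ∀ k : Fin 6, k ≠ k + 2 := by decide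
    rcases cases6 k k' with rfl | rfl | rfl | rfl | rfl | rfl
    · exact ⟨fun _ => by simp, fun h => absurd rfl h⟩
    · exact ⟨fun _ => iff_of_false ((hi k).1 hk hk') (ne2 k), fun h => absurd (typ_two _ _).symm h⟩
    · exact ⟨fun _ => iff_of_false ((hi k').1 hk' hk).symm (ne2 k').symm,
        fun h => absurd (typ_two _ _) h⟩
    · exact ⟨fun h => absurd h (typ1 k), fun _ => iff_of_true (hF.atlas.adj_of_chart hc he hk hk')
        (Or.inl rfl)⟩
    · exact ⟨fun h => absurd h.symm (typ1 k'), fun _ => iff_of_true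
        (hF.atlas.adj_of_chart hc he hk' hk).symm (Or.inr rfl)⟩
    · exact ⟨fun h => absurd h (typ3 k), fun _ => iff_of_false ((hi k).2 hk hk')
        ((by decide : ∀ k : Fin 6, ¬ (k + 3 = k + 1 ∨ k = k + 3 + 1)) k)⟩

/-- A map from an enclosure is immersive if and only if it is an immersive chart of the atlas, in
either of the two frames. -/
theorem immersive_iff_imm (hF : IsConstruction F) (hSB : SBLoc F) {E : Enclosure}
    (f : F.obj (op E)) {τ : Bool} {s : Set Pl} {g : Pl → Points F}
    (hs : ∀ z, ofPl τ z ∈ E.carrier ↔ z ∈ s)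
    (hg : ∀ z (hz : ofPl τ z ∈ E.carrier), evalAt f ⟨ofPl τ z, hz⟩ = g z) :
    Immersive f ↔ hF.atlas.Imm τ s g := by
  obtain rfl : ofPl τ ⁻¹' E.carrier = s := Set.ext hs
  have h1 : hF.atlas.Imm τ (ofPl τ ⁻¹' E.carrier) g ↔ hF.atlas.Imm τ (ofPl τ ⁻¹' E.carrier)
      fun z => evalD f (g 0) (ofPl τ z) :=
    ⟨fun h => h.congr fun z hz => by rw [evalD_of_mem _ _ hz, hg],
      fun h => h.congr fun z hz => by rw [evalD_of_mem _ _ hz, hg]⟩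
  rw [h1, immersive_iff_imm_true hF hSB f (g 0)]
  cases τ
  · have e : ∀ z, ofPl true (fr 0 1 z) = ofPl false z := fun z => by
      rw [← ofPl_rotT_true]
      congr 1
      have := fr_succ 0 0 z
      rwa [fr_std, zero_add, zero_add] at this
    have e1 : fr 0 1 ⁻¹' (ofPl true ⁻¹' E.carrier) = ofPl false ⁻¹' E.carrier := by
      ext z; simp only [Set.mem_preimage, e]
    constructor
    · intro h
      have := h.frame 0 1
      rw [e1] at this
      simp only [e] at this
      exact this
    · intro h
      refine Atlas.Imm.of_frame (e := 0) (k := 1) ?_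
      rw [e1]
      simp only [e]
      exact h
  · rfl

/-! ### The local conditions in terms of the atlas -/

theorem IsChart.exists_section {τ : Bool} {s : Set Pl} {f : Pl → Points F} (hf : IsChart F τ s f)
    {E : Enclosure} (h : ∀ z, ofPl τ z ∈ E.carrier → z ∈ s) :
    ∃ t : F.obj (op E), ∀ z (hz : ofPl τ z ∈ E.carrier), evalAt t ⟨ofPl τ z, hz⟩ = f z := by
  obtain ⟨hs, u, hu⟩ := hf
  have hsub : E.carrier ⊆ (encl τ s hs).carrier := fun x hx => by
    rw [← ofPl_toPl τ x] at hx ⊢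
    exact ofPl_mem_encl.2 (h _ hx)
  refine ⟨F.map (Enclosure.incl hsub).op u, fun z hz => ?_⟩
  rw [evalAt_map, hu]
  exact congrArg f (toPl_ofPl τ z)

theorem IsAdj.exists_vertex_left {u v : Dart (Points F)} (h : IsAdj F u v) :
    ∃ (x : Points F) (a : (sphereAt F x).Vertex), vertexDart a = u := by
  obtain ⟨τ, s, f, hf, h0, h1, h2, rfl, rfl⟩ := h
  exact ⟨_, exists_vertexDart hf h0 h1 rfl⟩

theorem IsAdj.exists_vertex_right {x : Points F} {a : (sphereAt F x).Vertex} {v : Dart (Points F)}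
    (h : IsAdj F (vertexDart a) v) : ∃ b : (sphereAt F x).Vertex, vertexDart b = v := by
  obtain ⟨τ, s, f, hf, h0, h1, h2, ha, rfl⟩ := h
  have hx : f 0 = x := by simpa using vertexDart_base ha
  obtain ⟨b, hb⟩ := exists_vertexDart (x := x) (hf.frame 0 1) (by simpa [fr] using h0)
    (by rw [sees_fr]; simpa [fr_zero] using h2) (by simpa [fr_zero] using hx)
  refine ⟨b, hb.trans ?_⟩
  rw [dart_fr, fr_zero, add_zero]

theorem SBLoc.noSquare (hF : IsSeparated F) (hSB : SBLoc F) {u v v' w : Dart (Points F)}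
    (h1 : IsAdj F u v) (h2 : IsAdj F v w) (h3 : IsAdj F u v') (h4 : IsAdj F v' w) :
    u = w ∨ v = v' := by
  obtain ⟨x, a, rfl⟩ := h1.exists_vertex_left
  obtain ⟨b, rfl⟩ := h1.exists_vertex_right
  obtain ⟨c, rfl⟩ := h2.exists_vertex_right
  obtain ⟨d, rfl⟩ := h3.exists_vertex_right
  by_contra hne
  rw [not_or] at hne
  have hac : a ≠ c := fun h => hne.1 (by rw [h])
  have hbd : b ≠ d := fun h => hne.2 (by rw [h])
  rw [← graph_adj_iff hF] at h1 h2 h3 h4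
  have := (hSB x).no_short_cycle a (.cons h1 (.cons h2 (.cons h4.symm (.cons h3.symm .nil)))) (by
    rw [SimpleGraph.Walk.cons_isCycle_iff]
    have := h1.ne
    have := h2.ne
    have := h3.ne
    have := h4.ne
    constructor
    · simp only [SimpleGraph.Walk.cons_isPath_iff, SimpleGraph.Walk.support_cons,
        SimpleGraph.Walk.support_nil, SimpleGraph.Walk.IsPath.nil, true_and, List.mem_cons, List.not_mem_nil, or_false, not_or]
      grind
    · simp only [SimpleGraph.Walk.edges_cons, SimpleGraph.Walk.edges_nil, List.mem_cons,
        List.not_mem_nil, or_false, not_or, Sym2.eq_iff]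
      grind)
  simp at this

theorem SBLoc.hexagon (hF : IsSeparated F) (hSB : SBLoc F) {x : Points F}
    (a b : (sphereAt F x).Vertex) : ∃ c : Fin 6 → Dart (Points F), Function.Injective c ∧
      (∀ k, IsAdj F (c k) (c (k + 1))) ∧ ∃ i j, c i = vertexDart a ∧ c j = vertexDart b := by
  obtain ⟨w, p, hp, hl, ha, hb⟩ := (hSB x).hexagon a b
  have hmem : ∀ {v}, v ∈ p.support → ∃ i : Fin 6, p.getVert i = v := by
    intro v hv
    obtain ⟨n, hn, hn'⟩ := SimpleGraph.Walk.mem_support_iff_exists_getVert.1 hv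
    rw [hl] at hn'
    rcases hn'.lt_or_eq with h | h
    · exact ⟨⟨n, h⟩, hn⟩
    · refine ⟨0, ?_⟩
      have e := p.getVert_length
      rw [hl] at e
      rw [← hn, h, e]
      exact p.getVert_zero
  refine ⟨fun k => vertexDart (p.getVert k), ?_, fun k => ?_, ?_⟩
  · intro i j hij
    have h := vertexDart_injective hF hij
    have := hp.getVert_injOn' (show (i : ℕ) ∈ {i | i ≤ p.length - 1} by
      change (i : ℕ) ≤ _; omega) (show (j : ℕ) ∈ {i | i ≤ p.length - 1} by
      change (j : ℕ) ≤ _; omega) h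
    exact Fin.ext this
  · rw [← graph_adj_iff hF]
    have h := p.adj_getVert_succ (i := k) (by omega)
    have e : p.getVert ((k + 1 : Fin 6) : ℕ) = p.getVert (k + 1) := by
      by_cases hk : k = 5
      · subst hk
        rw [show ((5 + 1 : Fin 6) : ℕ) = 0 from rfl, show ((5 : Fin 6) : ℕ) + 1 = p.length by
          rw [hl]; rfl, SimpleGraph.Walk.getVert_length, SimpleGraph.Walk.getVert_zero]
      · congr 1
        exact (by decide : ∀ k : Fin 6, ¬k = 5 → ((k + 1 : Fin 6) : ℕ) = (k : ℕ) + 1) k hk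
    rw [e]
    exact h
  · obtain ⟨i, hi⟩ := hmem ha
    obtain ⟨j, hj⟩ := hmem hb
    exact ⟨i, j, by simp only [hi], by simp only [hj]⟩

/-- There are no double edges: a germ on the standard chamber is determined by its two faces. -/
theorem SBLoc.noDouble_true (hF : IsSeparated F) (hSB : SBLoc F) {s : Set Pl} {f g : Pl → Points F}
    (hf : IsChart F true s f) (hg : IsChart F true s g) (h0 : 0 ∈ s) (h1 : Sees s 0 0)
    (h2 : Sees s 0 1) (d1 : dart true f 0 0 = dart true g 0 0)
    (d2 : dart true f 0 1 = dart true g 0 1) :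
    ∃ δ > 0, ∀ p q : ℝ, 0 ≤ p → p ≤ δ → 0 ≤ q → q ≤ δ → f (p, q) = g (p, q) := by
  obtain ⟨E, hE, t, ht, -, hz⟩ := hf.exists_corner h0 h1 h2
  obtain ⟨E', hE', t', ht', -, hz'⟩ := hg.exists_corner h0 h1 h2
  have hx : g 0 = f 0 := by simpa using (cdart_apply_zero d1).symm
  have heq : (Germ.mk hE t ht : Germ F (f 0) chamber) = Germ.mk hE' t' (ht'.trans hx) := by
    refine (hSB (f 0)).no_double_edge _ _ fun ε => ?_
    have h := (vertexDart_face hE t ht hz ε).trans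
      (Eq.trans ?_ (vertexDart_face hE' t' (ht'.trans hx) hz' ε).symm)
    · have := vertexDart_injective hF h
      simpa using this
    · cases ε
      · exact d2
      · exact d1
  obtain ⟨D, hD, hDE, hDE', h⟩ := Quotient.exact heq
  have hev : ∀ᶠ z in 𝓝 (0 : Pl), ofPl true z ∈ D.carrier ↔ ofPl true z ∈ chamber := by
    have hc := (continuous_ofPl true).tendsto 0
    rw [ofPl_zero] at hc
    exact hc.eventually hD.2
  rw [Metric.eventually_nhds_iff] at hev
  obtain ⟨δ, hδ, hm⟩ := hev
  refine ⟨δ / 2, by linarith, fun p q hp hp' hq hq' => ?_⟩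
  have hpq : ofPl true (p, q) ∈ D.carrier := by
    refine (hm ?_).2 ?_
    · rw [dist_zero_right, Prod.norm_def, max_lt_iff, Real.norm_eq_abs, Real.norm_eq_abs,
        abs_of_nonneg hp, abs_of_nonneg hq]
      constructor <;> linarith
    · rintro (_ | _)
      · rw [root_false_ofPl]; exact hq
      · rw [root_true_ofPl]; exact hp
  have := congrArg (fun u => evalAt u ⟨_, hpq⟩) h
  simp only [evalAt_map] at this
  rw [← hz _ (hDE hpq), ← hz' _ (hDE' hpq)]
  exact this

theorem SBLoc.noDouble (hF : IsSeparated F) (hSB : SBLoc F) {τ : Bool} {s : Set Pl}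
    {f g : Pl → Points F} (hf : IsChart F τ s f) (hg : IsChart F τ s g) (h0 : 0 ∈ s)
    (h1 : Sees s 0 0) (h2 : Sees s 0 1) (d1 : dart τ f 0 0 = dart τ g 0 0)
    (d2 : dart τ f 0 1 = dart τ g 0 1) :
    ∃ δ > 0, ∀ p q : ℝ, 0 ≤ p → p ≤ δ → 0 ≤ q → q ≤ δ → f (p, q) = g (p, q) := by
  cases τ
  · -- Exchange the two edges of the chamber.
    have e : ∀ p q : ℝ, fr 0 1 (reflR (p, q)) = (q, p) := fun p q => by
      ext <;> simp [fr, reflR, dr]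
    have e0 : fr 0 1 (reflR 0) = 0 := e 0 0
    have e1 : (1 : Fin 6) + -1 = 0 := by decide
    have key := SBLoc.noDouble_true hF hSB (hf.frame 0 1).reflect (hg.frame 0 1).reflect
      (by simpa [e0] using h0) ?_ ?_ ?_ ?_
    · obtain ⟨δ, hδ, h⟩ := key
      refine ⟨δ, hδ, fun p q hp hp' hq hq' => ?_⟩
      have := h q p hq hq' hp hp'
      simpa only [e] using this
    · rw [sees_reflR, sees_fr, e0]; exact h2
    · rw [sees_reflR, sees_fr, e0, e1]; exact h1
    · have := fun f : Pl → Points F => dart_reflR (τ := typ false 1) (f := fun z => f (fr 0 1 z))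
        (z := 0) (j := 0)
      refine (this f).trans (Eq.trans ?_ (this g).symm)
      rw [dart_fr, dart_fr, e0]; exact d2
    · have := fun f : Pl → Points F => dart_reflR (τ := typ false 1) (f := fun z => f (fr 0 1 z))
        (z := 0) (j := 1)
      refine (this f).trans (Eq.trans ?_ (this g).symm)
      rw [dart_fr, dart_fr, e0, e1]; exact d1
  · exact hSB.noDouble_true hF hf hg h0 h1 h2 d1 d2

/-! ### The extension conditions in terms of the atlas -/

theorem ofPl_mem_seg {ε : Bool} {t : ℝ} {z : Pl} : ofPl ε z ∈ (seg ε t).carrier ↔ z ∈ hseg t := by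
  rw [mem_seg]
  constructor
  · rintro ⟨r, h0, h1, h⟩
    rw [← ofPl_line] at h
    rw [ofPl_injective ε h]
    exact mem_hseg.2 ⟨h0, h1⟩
  · rintro ⟨h0, h1, h2⟩
    refine ⟨z.1, h0, h1, ?_⟩
    rw [← ofPl_line, ← h2]

theorem smul_wt_mem_seg {ε : Bool} {t r : ℝ} (h0 : 0 ≤ r) (h1 : r ≤ t) :
    r • wt ε ∈ (seg ε t).carrier := mem_seg.2 ⟨r, h0, h1, rfl⟩

theorem rot_wt (ε : Bool) : rot (wt ε) = ofPl ε (dr 2) := by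
  apply crd_ext
  intro i
  cases ε <;> fin_cases i <;>
    simp [rot, crd_ofPl_true, crd_ofPl_false, dr, show (-1 : Fin 3) = 2 from rfl] <;> norm_num

theorem ofPl_mem_para {ε : Bool} {a b : ℝ} {z : Pl} :
    ofPl ε z ∈ (para ε a b).carrier ↔ z ∈ par 0 0 a b := by
  have e : ∀ p q : ℝ, p • wt ε + q • rot (wt ε) = ofPl ε (0 + p • dr 0 + q • dr (0 + 2)) := by
    intro p q
    rw [rot_wt, ← ofPl_dr_zero, ofPl_add, ofPl_add, ofPl_zero, zero_add, ofPl_smul, ofPl_smul,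
      zero_add]
  constructor
  · rintro ⟨p, q, hp, hq, h⟩
    rw [e] at h
    exact ⟨p, q, hp, hq, ofPl_injective ε h⟩
  · rintro ⟨p, q, hp, hq, rfl⟩
    exact ⟨p, q, hp, hq, (e p q).symm⟩

theorem immersive_iff_iSeg (hF : IsConstruction F) (hSB : SBLoc F) {ε : Bool} {t : ℝ}
    (φ : F.obj (op (seg ε t))) {γ : ℝ → Points F}
    (h : ∀ r (h0 : 0 ≤ r) (h1 : r ≤ t), evalAt φ ⟨r • wt ε, smul_wt_mem_seg h0 h1⟩ = γ r) :
    Immersive φ ↔ hF.atlas.ISeg ε t γ := by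
  refine immersive_iff_imm hF hSB φ (fun z => ofPl_mem_seg) fun z hz => ?_
  obtain ⟨h0, h1, h2⟩ := ofPl_mem_seg.1 hz
  rw [← h _ h0 h1]
  congr 1
  refine Subtype.ext ?_
  change ofPl ε z = z.1 • wt ε
  rw [← ofPl_line, ← h2]

theorem exists_section_of_iSeg (hF : IsConstruction F) {ε : Bool} {t : ℝ} {γ : ℝ → Points F}
    (hγ : hF.atlas.ISeg ε t γ) : ∃ φ : F.obj (op (seg ε t)),
      ∀ r (h0 : 0 ≤ r) (h1 : r ≤ t), evalAt φ ⟨r • wt ε, smul_wt_mem_seg h0 h1⟩ = γ r := by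
  have hc : IsChart F ε (hseg t) fun z => γ z.1 := hγ.1
  obtain ⟨φ, hφ⟩ := hc.exists_section (E := seg ε t) fun z hz => ofPl_mem_seg.1 hz
  refine ⟨φ, fun r h0 h1 => ?_⟩
  have := hφ (r, 0) (ofPl_mem_seg.2 (mem_hseg.2 ⟨h0, h1⟩))
  simpa only [ofPl_line] using this

theorem segRev_apply {ε : Bool} {t r : ℝ} (h : r • wt (!ε) ∈ (seg (!ε) t).carrier) :
    (((segRev ε t).toFun ⟨r • wt (!ε), h⟩ : (seg ε t).carrier) : Apt) = (t - r) • wt ε := by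
  change permAct (Equiv.swap 0 2) (r • wt (!ε)) + t • wt ε = _
  apply crd_ext
  intro i
  cases ε <;> fin_cases i <;> simp [Equiv.swap_apply_of_ne_of_ne] <;> ring

theorem segShift_apply {ε : Bool} {t t' r : ℝ} (ht : 0 ≤ t)
    (h : r • wt ε ∈ (seg ε (t' - t)).carrier) :
    (((segShift ε ht t').toFun ⟨r • wt ε, h⟩ : (seg ε t').carrier) : Apt) = (t + r) • wt ε := by
  change r • wt ε + t • wt ε = _
  rw [add_smul, add_comm]

theorem IsConstruction.exSeg (hF : IsConstruction F) (hSB : SBLoc F) (hSeg : ExSeg F) {τ : Bool}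
    {t t' : ℝ} {γ : ℝ → Points F} {u : Dart (Points F)} (ht : 0 < t) (htt : t < t')
    (hγ : hF.atlas.ISeg τ t γ) (hu : hF.atlas.IsDart (γ t) u) (hu1 : u.1 = τ)
    (hadj : ¬ hF.atlas.Adj (cdart (!τ) fun r => γ (t - r)) u) :
    ∃ γ', hF.atlas.ISeg τ t' γ' ∧ (∀ r, 0 ≤ r → r ≤ t → γ' r = γ r) ∧
      cdart τ (fun r => γ' (t + r)) = u := by
  classical
  obtain ⟨φ, hφ⟩ := exists_section_of_iSeg hF hγ
  obtain ⟨τ', s, f, hf, h0, h1, hx, rfl⟩ := hu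
  obtain rfl : τ' = τ := hu1
  obtain ⟨⟨ε, ν⟩, hν⟩ := exists_vertexDart hf h0 h1 hx
  obtain rfl : ε = τ' := by
    have := vertexDart_type (F := F) ⟨ε, ν⟩
    rw [hν] at this
    exact this.symm
  have hrev : ∀ r, 0 ≤ r → r ≤ t → ∀ hr : r • wt (!ε) ∈ (seg (!ε) t).carrier,
      evalAt (F.map (segRev ε t).op φ) ⟨r • wt (!ε), hr⟩ = γ (t - r) := by
    intro r hr0 hr1 hr
    rw [evalAt_map, ← hφ (t - r) (by linarith) (by linarith)]
    congr 1
    exact Subtype.ext (segRev_apply hr)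
  have hy : evalAt (F.map (segRev ε t).op φ) ⟨0, (seg_corner (!ε) ht).1⟩ = γ t := by
    have := hrev 0 le_rfl ht.le (by rw [zero_smul]; exact (seg_corner (!ε) ht).1)
    simpa only [zero_smul, sub_zero] using this
  have hbw := vertexDart_mk (seg_corner (!ε) ht) _ hy ht hrev
  obtain ⟨φ', hi, hres, hy', hgerm⟩ := hSeg ε t t' ht htt φ
    ((immersive_iff_iSeg hF hSB φ hφ).2 hγ) (γ t) hy ν (by
      rw [SphericalConstruction.edist_eq (hSB _).edist_le, if_neg (by cases ε <;> simp), if_neg]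
      rw [graph_adj_iff hF.isSeparated, hbw, hν]
      exact hadj)
  refine ⟨fun r => evalD φ' (γ t) (r • wt ε), ?_, fun r hr0 hr1 => ?_, ?_⟩
  · exact (immersive_iff_iSeg hF hSB φ' fun r hr0 hr1 =>
      (evalD_of_mem _ _ (smul_wt_mem_seg hr0 hr1)).symm).1 hi
  · have hm := smul_wt_mem_seg (ε := ε) hr0 hr1
    beta_reduce
    rw [evalD_of_mem _ _ (smul_wt_mem_seg hr0 (hr1.trans htt.le)), ← hφ r hr0 hr1, ← hres,
      evalAt_map]
    rfl
  · rw [← hν, ← hgerm]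
    refine (vertexDart_mk (seg_corner ε (sub_pos.2 htt)) _ hy' (sub_pos.2 htt) ?_).symm
    intro r hr0 hr1 hr
    beta_reduce
    rw [evalAt_map, evalD_of_mem _ _ (smul_wt_mem_seg (by linarith) (by linarith))]
    congr 1
    exact Subtype.ext (segShift_apply ht.le hr)

theorem IsConstruction.exObt (hF : IsConstruction F) (hSB : SBLoc F) (hObt : ExObt F) {τ : Bool}
    {a b : ℝ} {γ₁ γ₂ : ℝ → Points F} (ha : 0 < a) (hb : 0 < b) (h1 : hF.atlas.ISeg τ a γ₁)
    (h2 : hF.atlas.ISeg τ b γ₂) (hx : γ₁ 0 = γ₂ 0) (hne : cdart τ γ₁ ≠ cdart τ γ₂) :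
    ∃ h, hF.atlas.Imm τ (par 0 0 a b) h ∧ (∀ r, 0 ≤ r → r ≤ a → h (r, 0) = γ₁ r) ∧
      ∀ r, 0 ≤ r → r ≤ b → h (-r, r) = γ₂ r := by
  classical
  obtain ⟨φ, hφ⟩ := exists_section_of_iSeg hF h1
  obtain ⟨ψ, hψ⟩ := exists_section_of_iSeg hF h2
  have hφ0 : evalAt φ ⟨0, (seg_corner τ ha).1⟩ = γ₁ 0 := by
    simpa only [zero_smul] using hφ 0 le_rfl ha.le
  have hψ0 : evalAt ψ ⟨0, (seg_corner τ hb).1⟩ = γ₁ 0 := by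
    rw [hx]
    simpa only [zero_smul] using hψ 0 le_rfl hb.le
  have d1 := vertexDart_mk (seg_corner τ ha) φ hφ0 ha fun r p q _ => hφ r p q
  have d2 := vertexDart_mk (seg_corner τ hb) ψ hψ0 hb fun r p q _ => hψ r p q
  obtain ⟨ζ, hi, hr1, hr2⟩ := hObt τ a b ha hb φ ψ (γ₁ 0) hφ0 hψ0
    ((immersive_iff_iSeg hF hSB φ hφ).2 h1) ((immersive_iff_iSeg hF hSB ψ hψ).2 h2) (by
      rw [SphericalConstruction.edist_eq (hSB _).edist_le, if_pos rfl, if_neg]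
      intro h
      exact hne (d1.symm.trans ((congrArg vertexDart h).trans d2)))
  refine ⟨fun z => evalD ζ (γ₁ 0) (ofPl τ z), ?_, fun r p q => ?_, fun r p q => ?_⟩
  · exact (immersive_iff_imm hF hSB ζ (fun z => ofPl_mem_para) fun z hz =>
      (evalD_of_mem _ _ hz).symm).1 hi
  · have hm := smul_wt_mem_seg (ε := τ) p q
    beta_reduce
    rw [ofPl_line, ← hφ r p q, ← hr1, evalAt_map]
    exact evalD_of_mem _ _ ((paraFst τ a hb.le).toFun ⟨_, hm⟩).2
  · have hm := smul_wt_mem_seg (ε := τ) p q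
    have e : ofPl τ (-r, r) = rot (r • wt τ) := by
      have : rot (r • wt τ) = r • rot (wt τ) := permAct_smul _ _ _
      rw [this, rot_wt, ← ofPl_smul]
      congr 1
      ext <;> simp [dr]
    beta_reduce
    rw [e, ← hψ r p q, ← hr2, evalAt_map]
    exact evalD_of_mem _ _ ((paraSnd τ ha.le b).toFun ⟨_, hm⟩).2

theorem IsConstruction.isBuilding (hF : IsConstruction F) (hSB : SBLoc F) (hSeg : ExSeg F)
    (hObt : ExObt F) : hF.atlas.IsBuilding where
  exists_dart x := by
    obtain ⟨u⟩ := (hSB x).nonempty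
    obtain ⟨s, f, hf, h0, h1, hx, -⟩ := exists_isChart_of_vertex u
    exact ⟨_, _, _, _, hf, h0, h1, hx, rfl⟩
  noDouble hf hg h0 h1 h2 d1 d2 := hSB.noDouble hF.isSeparated hf hg h0 h1 h2 d1 d2
  noSquare h1 h2 h3 h4 := hSB.noSquare hF.isSeparated h1 h2 h3 h4
  hexagon := by
    rintro x u v ⟨τ, s, f, hf, h0, h1, hx, rfl⟩ ⟨τ', s', f', hf', h0', h1', hx', rfl⟩
    obtain ⟨a, ha⟩ := exists_vertexDart hf h0 h1 hx
    obtain ⟨b, hb⟩ := exists_vertexDart hf' h0' h1' hx'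
    rw [← ha, ← hb]
    exact hSB.hexagon hF.isSeparated a b
  exSeg ht htt hγ hu hu1 hadj := hF.exSeg hSB hSeg ht htt hγ hu hu1 hadj
  exObt ha hb h1 h2 hx hne := hF.exObt hSB hObt ha hb h1 h2 hx hne

/-! ### Connectedness -/

/-- A set that contains all values of each section of which it contains one is open. -/
theorem isOpen_of_saturated {U : Set (Points F)} (h : ∀ (E : Enclosure) (f : F.obj (op E))
    (e e' : E.carrier), evalAt f e ∈ U → evalAt f e' ∈ U) : IsOpen U := by
  rw [isOpen_iSup_iff]
  intro E
  rw [isOpen_iSup_iff]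
  intro f
  rw [isOpen_coinduced]
  by_cases hU : ∃ e, evalAt f e ∈ U
  · obtain ⟨e, he⟩ := hU
    rw [Set.eq_univ_of_forall fun e' => show e' ∈ evalAt f ⁻¹' U from h E f e e' he]
    exact isOpen_univ
  · rw [Set.eq_empty_of_forall_notMem fun e (he : e ∈ evalAt f ⁻¹' U) => hU ⟨e, he⟩]
    exact isOpen_empty

theorem IsConstruction.joined (hF : IsConstruction F) (hA : hF.atlas.IsBuilding)
    (hconn : ConnectedSpace (Points F)) (x y : Points F) : hF.atlas.Joined x y := by
  have key : ∀ (E : Enclosure) (f : F.obj (op E)) (e e' : E.carrier),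
      hF.atlas.Joined x (evalAt f e) → hF.atlas.Joined x (evalAt f e') := by
    intro E f e e' h
    have hmem : ∀ e : E.carrier, toPl true e ∈ ofPl true ⁻¹' E.carrier := fun e => by
      rw [Set.mem_preimage, ofPl_toPl]; exact e.2
    have hv : ∀ e : E.carrier, evalD f x (ofPl true (toPl true e)) = evalAt f e := fun e => by
      rw [ofPl_toPl, evalD_of_mem _ _ e.2]
    have hc : hF.atlas.Chart true (ofPl true ⁻¹' E.carrier) fun z => evalD f x (ofPl true z) :=
      isChart_evalD f x true
    have := hA.joined_of_chart hc (x := x) (hmem e) (hmem e')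
    rw [hv, hv] at this
    exact this h
  -- the complement is saturated as well
  have hclopen : IsClopen {y | hF.atlas.Joined x y} := by
    refine ⟨⟨isOpen_of_saturated fun E f e e' h h' => h (key E f e' e h')⟩,
      isOpen_of_saturated key⟩
  exact hclopen.eq_univ ⟨x, Atlas.Joined.refl _ x⟩ |>.ge (Set.mem_univ y)

theorem IsConstruction.exists_immersive (hF : IsConstruction F) (hSB : SBLoc F) {x y : Points F}
    (h : hF.atlas.Joined x y) : ∃ (E : Enclosure) (f : F.obj (op E)), Immersive f ∧
      x ∈ Set.range (evalAt f) ∧ y ∈ Set.range (evalAt f) := by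
  obtain ⟨τ, s, f, hf, z, hz, w, hw, rfl, rfl⟩ := h
  have hc : IsChart F τ s f := hf.1
  obtain ⟨t, ht⟩ := hc.exists_section (E := encl τ s hc.1) fun z hz => ofPl_mem_encl.1 hz
  exact ⟨_, t, (immersive_iff_imm hF hSB t (fun z => ofPl_mem_encl) ht).2 hf,
    ⟨_, ht z (ofPl_mem_encl.2 hz)⟩, ⟨_, ht w (ofPl_mem_encl.2 hw)⟩⟩

/-! ### Apartments as maps of presheaves -/

theorem evalAt_pt (x : F.obj (op pt)) (e : pt.carrier) : evalAt x e = x := by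
  change F.map (Enclosure.point _).op x = x
  rw [hom_pt_ext (Enclosure.point _) (𝟙 pt), op_id, F.map_id]
  rfl

theorem exists_section_comp (hF : IsConstruction F) {τ : Bool} {H : Pl → Points F}
    (hH : hF.atlas.IsApartment τ H) (E : Enclosure) (g : aptPresheaf.obj (op E)) :
    ∃ t : F.obj (op E), ∀ e, evalAt t e = H (toPl τ (g.1 e)) := by
  obtain ⟨a, ha, hga⟩ := g.2
  obtain ⟨M, hM, hEM⟩ := E.exists_bound
  obtain ⟨σ, v, hσ⟩ := id ha
  obtain ⟨hs, u, hu⟩ := hH.1 (2 * (M + (|crd v 0| + |crd v 1| + |crd v 2|)))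
  have hE : ∀ x ∈ E.carrier, a x ∈ (encl τ _ hs).carrier := by
    intro x hx
    have h : ∀ i, |crd (a x) i| ≤ M + (|crd v 0| + |crd v 1| + |crd v 2|) := by
      intro i
      rw [hσ, crd_add, crd_permAct]
      refine (abs_add_le _ _).trans (add_le_add (hEM x hx _) ?_)
      have h0 := abs_nonneg (crd v 0)
      have h1 := abs_nonneg (crd v 1)
      have h2 := abs_nonneg (crd v 2)
      fin_cases i <;> simp <;> linarith
    obtain ⟨a0, b0⟩ := abs_le.1 (h 0)
    obtain ⟨a1, b1⟩ := abs_le.1 (h 1)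
    obtain ⟨a2, b2⟩ := abs_le.1 (h 2)
    rw [mem_encl]
    cases τ <;> simp only [toPl, hexa, Set.mem_ofPred_eq, if_true, Bool.false_eq_true, if_false] <;>
      and_intros <;> linarith
  refine ⟨F.map (Enclosure.homOf a ha hE).op u, fun e => ?_⟩
  rw [evalAt_map, hu, hga]
  rfl

theorem exists_aptPresheaf_hom (hF : IsConstruction F) {τ : Bool} {H : Pl → Points F}
    (hH : hF.atlas.IsApartment τ H) : ∃ φ : aptPresheaf ⟶ F,
      ∀ (E : Enclosure) (g : aptPresheaf.obj (op E)) (e : E.carrier),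
        evalAt (φ.app (op E) g) e = H (toPl τ (g.1 e)) := by
  choose t ht using exists_section_comp hF hH
  refine ⟨{ app := fun E => TypeCat.ofHom (t E.unop), naturality := ?_ }, ht⟩
  intro D E h
  ext g
  refine hF.isSeparated E.unop _ _ fun e => ?_
  change evalAt (t E.unop (aptPresheaf.map h g)) e = evalAt (F.map h.unop.op (t D.unop g)) e
  rw [evalAt_map, ht, ht]
  rfl

theorem IsConstruction.exists_apartment (hF : IsConstruction F) (hSB : SBLoc F) {τ : Bool}
    {H : Pl → Points F} (hH : hF.atlas.IsApartment τ H) : ∃ φ : aptPresheaf ⟶ F,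
      IsApartment φ ∧ ∀ z, H z ∈ Set.range (φ.app (op pt)) := by
  obtain ⟨φ, hφ⟩ := exists_aptPresheaf_hom hF hH
  refine ⟨φ, fun E => ?_, fun z => ⟨aptPoint (ofPl τ z), ?_⟩⟩
  · have e : yonedaEquiv (E.toApt ≫ φ) = φ.app (op E) (aptSec E) := by
      rw [yonedaEquiv_comp]
      congr 1
    rw [e]
    have hv : ∀ z (hz : ofPl τ z ∈ E.carrier),
        evalAt (φ.app (op E) (aptSec E)) ⟨ofPl τ z, hz⟩ = H z := fun z hz => by
      rw [hφ]
      exact congrArg H (toPl_ofPl τ z)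
    refine (immersive_iff_imm hF hSB _ (s := ofPl τ ⁻¹' E.carrier) (fun z => Iff.rfl) hv).2 ⟨?_, ?_⟩
    · exact IsChart.of_section _ (E.isHex τ) isWeyl_id (fun _ hz => hz) hv
    · exact fun e _ k => ⟨fun _ _ => (hH.2 e k).1, fun _ _ => (hH.2 e k).2⟩
  · refine (evalAt_pt _ ⟨0, rfl⟩).symm.trans ((hφ pt (aptPoint (ofPl τ z)) ⟨0, rfl⟩).trans
      (congrArg H ?_))
    change toPl τ (0 + ofPl τ z) = z
    rw [zero_add, toPl_ofPl]

end SL3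

theorem mainTheorem9 (F : SL3.Enclosureᵒᵖ ⥤ Type) (hF : SL3.IsConstruction F)
    (hconn : ConnectedSpace (SL3.Points F)) (hSB : SL3.SBLoc F) (hSeg : SL3.ExSeg F)
    (hObt : SL3.ExObt F) (x y : SL3.Points F) :
    (∃ (E : SL3.Enclosure) (f : F.obj (op E)), SL3.Immersive f ∧
      x ∈ Set.range (SL3.evalAt f) ∧ y ∈ Set.range (SL3.evalAt f)) ∧
    (∃ φ : SL3.aptPresheaf ⟶ F, SL3.IsApartment φ ∧
      x ∈ Set.range (φ.app (op SL3.pt)) ∧ y ∈ Set.range (φ.app (op SL3.pt))) := by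
  have hA := hF.isBuilding hSB hSeg hObt
  have hxy := hF.joined hA hconn x y
  refine ⟨hF.exists_immersive hSB hxy, ?_⟩
  obtain ⟨τ, H, hH, ⟨z, rfl⟩, w, rfl⟩ := hA.exists_apartment hxy
  obtain ⟨φ, hφ, hr⟩ := hF.exists_apartment hSB hH
  exact ⟨φ, hφ, hr z, hr w⟩
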